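/- **Theorem (kangaroos).** A two-dimensional string is a partial function from $\mathbb{Z}^2$ to the integers (its characters), stored as a list of point–character pairs in arbitrary order. For a two-dimensional string $S$ and $q\in\mathbb{Z}^2$, the string $S+q$ has domain $\mathrm{dom}(S)+q$ and satisfies $(S+q)(v)=S(v-q)$, and $\mathrm{Ham}(S,R)$ is the number of points $u\in\mathrm{dom}(S)\cap\mathrm{dom}(R)$ with $S(u)\ne R(u)$. Write $[k]=\{0,\dots,k-1\}$. There is a word-RAM algorithm which, given integers $1\le m\le n$, two-dimensional strings $P,T$ with $\mathrm{dom}(P)=[m]\times[m]$ and $\mathrm{dom}(T)=[n]\times[n]$, whose characters are polynomially bounded in the input size, i.e. at most $(n^2+m^2)^{\kappa}$ in absolute value for a constant $\kappa$, and a set $Q\subseteq\mathbb{Z}^2$ of shifts with $\mathrm{dom}(P+q)\subseteq\mathrm{dom}(T)$ for all $q\in Q$ (listed without repetition), computes $$d_q=\mathrm{Ham}(P+q,T)\quad\text{for every } q\in Q$$ in total time $$O\Big(n^2+\sum_{q\in Q} d_q\Big).$$ Here the machine has words of $w\ge C\log_2(n^2+m^2)$ bits with unit-cost arithmetic, bitwise,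 comparison and memory-access operations on words; the algorithm is one fixed program (independent of $\kappa$, $w$ and the input), and $C$ and the constant hidden in $O(\cdot)$ depend only on $\kappa$. -/

import Mathlib

/-! ### A word RAM with words of `w` bits

The memory has one word-sized cell for each address, and addresses are words. A program uses
finitely many registers; it is a fixed finite object that does not depend on `w` or on the input.
Control flow is structured (branches and loops), and every executed basic instruction and every
evaluated test costs one step. -/

namespace WordRAM

/-- Unit-cost arithmetic and bitwise operations; `div` and `mod` are unsigned. -/
inductive BinOp where
  | add | sub | mul | div | mod | and | or | xor | shl | shr

/-- Unit-cost tests: equality, unsigned order, signed (two's complement) order. -/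
inductive Cmp where
  | eq | ult | slt

def BinOp.eval {w : ℕ} : BinOp → BitVec w → BitVec w → BitVec w
  | .add, x, y => x + y
  | .sub, x, y => x - y
  | .mul, x, y => x * y
  | .div, x, y => x / y
  | .mod, x, y => x % y
  | .and, x, y => x &&& y
  | .or, x, y => x ||| y
  | .xor, x, y => x ^^^ y
  | .shl, x, y => x <<< y
  | .shr, x, y => x >>> y

def Cmp.eval {w : ℕ} : Cmp → BitVec w → BitVec w → Bool
  | .eq, x, y => x == y
  | .ult, x, y => x.ult y
  | .slt, x, y => x.slt y

/-- Programs. Natural-number arguments named `d`, `a`, `b`, `s` are names of registers. -/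
inductive Program where
  /-- do nothing -/
  | skip : Program
  /-- `reg d := k`, for a constant `k` written in the program -/
  | const (d k : ℕ) : Program
  /-- `reg d := reg a o reg b` -/
  | op (o : BinOp) (d a b : ℕ) : Program
  /-- `reg d := mem (reg a)` -/
  | load (d a : ℕ) : Program
  /-- `mem (reg a) := reg s` -/
  | store (a s : ℕ) : Program
  /-- run `p`, then `q` -/
  | seq (p q : Program) : Program
  /-- if `reg a r reg b` then `p` else `q` -/
  | ite (r : Cmp) (a b : ℕ) (p q : Program) : Program
  /-- while `reg a r reg b` do `p` -/
  | loop (r : Cmp) (a b : ℕ) (p : Program) : Program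

/-- A configuration of the machine with words of `w` bits. -/
structure State (w : ℕ) where
  reg : ℕ → BitVec w
  mem : BitVec w → BitVec w

def State.setReg {w : ℕ} (σ : State w) (d : ℕ) (v : BitVec w) : State w :=
  { σ with reg := Function.update σ.reg d v }

def State.setMem {w : ℕ} (σ : State w) (x v : BitVec w) : State w :=
  { σ with mem := Function.update σ.mem x v }

/-- `Exec p σ t σ'`: started in `σ`, the program `p` halts after exactly `t` steps in `σ'`. -/
inductive Exec {w : ℕ} : Program → State w → ℕ → State w → Prop where
  | skip (σ : State w) : Exec .skip σ 1 σ
  | const (d k : ℕ) (σ : State w) :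
      Exec (.const d k) σ 1 (σ.setReg d (BitVec.ofNat w k))
  | op (o : BinOp) (d a b : ℕ) (σ : State w) :
      Exec (.op o d a b) σ 1 (σ.setReg d (o.eval (σ.reg a) (σ.reg b)))
  | load (d a : ℕ) (σ : State w) :
      Exec (.load d a) σ 1 (σ.setReg d (σ.mem (σ.reg a)))
  | store (a s : ℕ) (σ : State w) :
      Exec (.store a s) σ 1 (σ.setMem (σ.reg a) (σ.reg s))
  | seq {p q : Program} {σ₁ σ₂ σ₃ : State w} {t₁ t₂ : ℕ} :
      Exec p σ₁ t₁ σ₂ → Exec q σ₂ t₂ σ₃ → Exec (.seq p q) σ₁ (t₁ + t₂) σ₃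
  | iteTrue {r : Cmp} {a b : ℕ} {p q : Program} {σ σ' : State w} {t : ℕ} :
      r.eval (σ.reg a) (σ.reg b) = true → Exec p σ t σ' →
      Exec (.ite r a b p q) σ (t + 1) σ'
  | iteFalse {r : Cmp} {a b : ℕ} {p q : Program} {σ σ' : State w} {t : ℕ} :
      r.eval (σ.reg a) (σ.reg b) = false → Exec q σ t σ' →
      Exec (.ite r a b p q) σ (t + 1) σ'
  | loopTrue {r : Cmp} {a b : ℕ} {p : Program} {σ₁ σ₂ σ₃ : State w} {t₁ t₂ : ℕ} :
      r.eval (σ₁.reg a) (σ₁.reg b) = true → Exec p σ₁ t₁ σ₂ →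
      Exec (.loop r a b p) σ₂ t₂ σ₃ →
      Exec (.loop r a b p) σ₁ (t₁ + t₂ + 1) σ₃
  | loopFalse {r : Cmp} {a b : ℕ} {p : Program} {σ : State w} :
      r.eval (σ.reg a) (σ.reg b) = false → Exec (.loop r a b p) σ 1 σ

/-- The initial configuration on an input given as a list of integers: the input occupies the
memory cells `0, 1, 2, …`, one integer (in two's complement) per cell; all the rest is zero. -/
def State.init (w : ℕ) (input : List ℤ) : State w where
  reg := fun _ => 0
  mem := fun x => BitVec.ofInt w (input.getD x.toNat 0)

end WordRAM

/-! ### Two-dimensional strings -/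

/-- A two-dimensional string: a partial function from `ℤ²` to characters, which are integers. -/
abbrev String2D : Type := ℤ × ℤ → Option ℤ

namespace String2D

def dom (S : String2D) : Set (ℤ × ℤ) := {u | ∃ a, S u = some a}

/-- The string `S + q`. -/
def shift (S : String2D) (q : ℤ × ℤ) : String2D := fun v => S (v - q)

/-- The set of mismatches between two strings. -/
def MI (S R : String2D) : Set (ℤ × ℤ) :=
  {u | ∃ a b, S u = some a ∧ R u = some b ∧ a ≠ b}

/-- The Hamming distance. -/
noncomputable def Ham (S R : String2D) : ℕ := (MI S R).ncard

/-- The square `[k] × [k]`, where `[k] = {0, …, k - 1}`. -/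
def square (k : ℕ) : Set (ℤ × ℤ) := Set.Ico (0 : ℤ) k ×ˢ Set.Ico (0 : ℤ) k

/-- All characters of `S` are bounded by `B` in absolute value. -/
def CharsBounded (S : String2D) (B : ℕ) : Prop := ∀ u a, S u = some a → |a| ≤ (B : ℤ)

/-- The list `l` of point-character pairs stores `S`: it lists, in some order and without
repetition, the points of the domain of `S` together with their characters. -/
def Stores (l : List ((ℤ × ℤ) × ℤ)) (S : String2D) : Prop :=
  (l.map Prod.fst).Nodup ∧ ∀ u a, (u, a) ∈ l ↔ S u = some a

/-- The input to the machine: `n`, `m`, the number of shifts, the stored text as triples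
`x, y, character`, the stored pattern likewise, and the shifts as pairs `x, y`. -/
def encodeInput (m n : ℕ) (lP lT : List ((ℤ × ℤ) × ℤ)) (lQ : List (ℤ × ℤ)) : List ℤ :=
  [(n : ℤ), (m : ℤ), (lQ.length : ℤ)]
    ++ lT.flatMap (fun e => [e.1.1, e.1.2, e.2])
    ++ lP.flatMap (fun e => [e.1.1, e.1.2, e.2])
    ++ lQ.flatMap (fun q => [q.1, q.2])

end String2D

/-! ### A small imperative language with arrays of natural numbers -/

/-! Write the text and then the pattern, row by row, as one string X on the positions 1, …, N with N
= n² + m², its characters renamed to 1, …, N and X 0 = 0 serving as a sentinel. Suppose that the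
longest common suffix of two prefixes of X can be found in constant time. Then the mismatches of one
row of the shifted pattern are found by kangaroo jumps: start at the right end of the row, jump over
the common suffix, land on a mismatch, step over it, repeat. This costs one jump per mismatch and at
most one more per row. The jump per row is too much, since m jumps for each of the |Q| shifts need
not be O(n² + ∑ d_q).

Hence rows without mismatches have to be skipped in bulk. Each position of X gets a name for the
window of m characters ending there, equal names meaning equal windows (`names_spec`). The names are
written column by column into a second string Y. A row of the shifted pattern matches iff the window
ending in its last column has the name of the corresponding window of the text (`Ready.row_eq`). So
a jump in Y passes over a run of matching rows and lands on a row with a mismatch, and this mismatch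
pays for the jump in Y and for the superfluous jump in X. A query takes at most 3 d_q + 1 loop
iterations (`scanRow_spec`, `query_spec`). The shifts are distinct points of [n]², so the |Q|
additional iterations are O(n²).

Longest common suffixes are answered in constant time after linear preprocessing (`build_spec`). The
prefixes, read backwards, are sorted by the skew algorithm: the prefixes whose length is not
divisible by 3 are sorted through a string of two thirds of the length (`plt_reduced`,
`descend_spec`), and the others are merged in by looking up ranks (`ascend_spec`). The common
suffixes of neighbours in this order come from Kasai's algorithm (`IsSA.lcs_pred`). For arbitrary
prefixes the length is the minimum over the neighbours in between (`IsSA.lcs_isMin`). Range minima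
take constant time by a sparse table over blocks of length about log N, together with bit masks
inside the blocks (`IsMask.isMin`). The names of the windows can be read off the same sorted order.

The algorithm is written in a small language with named arrays of natural numbers whose clock counts
loop iterations only. `compile_correct` translates it to the word RAM with a constant factor. The
memory is initially zero and polynomially large, and cells that are never touched cost nothing. This
permits renaming characters by direct table lookup, and storing the levels of the suffix sort
generously spaced. One fixed program serves all κ because no address computation involves the array
length. -/

namespace Kangaroo

set_option linter.unusedSectionVars false
set_option linter.unusedSimpArgs false

/-- Parameters of the machine: `W = 2 ^ w`, all arrays have length `L`, and the input area has
length `B`. -/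
structure Mach where
  W : ℕ
  L : ℕ
  B : ℕ

/-- Variables, arrays, the input-output area, and a clock that counts iterations of loops. -/
structure HState (V A : Type) where
  var : V → ℕ
  arr : A → ℕ → ℕ
  io : ℕ → ℕ
  time : ℕ

/-- Subtraction is truncated and tests yield 0 or 1, so that conditions are ordinary expressions.
Only `neg` works modulo `2 ^ w`; it gives access to the absolute value of a negative character. -/
inductive Expr (V A : Type) where
  | const (c : ℕ) : Expr V A
  | var (x : V) : Expr V A
  | arr (a : A) (e : Expr V A) : Expr V A
  | io (e : Expr V A) : Expr V A
  | add (e f : Expr V A) : Expr V A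
  | sub (e f : Expr V A) : Expr V A
  | mul (e f : Expr V A) : Expr V A
  | div (e f : Expr V A) : Expr V A
  | mod (e f : Expr V A) : Expr V A
  | neg (e : Expr V A) : Expr V A
  | lt (e f : Expr V A) : Expr V A
  | eq (e f : Expr V A) : Expr V A

inductive Stmt (V A : Type) where
  | set (x : V) (e : Expr V A) : Stmt V A
  | put (a : A) (e f : Expr V A) : Stmt V A
  | output (e f : Expr V A) : Stmt V A
  | seq (p q : Stmt V A) : Stmt V A
  | ite (e : Expr V A) (p q : Stmt V A) : Stmt V A
  | loop (e : Expr V A) (p : Stmt V A) : Stmt V A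

infixr:60 " ;; " => Stmt.seq

variable {V A : Type}

namespace HState

variable [DecidableEq V] [DecidableEq A]

def set (s : HState V A) (x : V) (v : ℕ) : HState V A :=
  { s with var := Function.update s.var x v }

def put (s : HState V A) (a : A) (i v : ℕ) : HState V A :=
  { s with arr := Function.update s.arr a (Function.update (s.arr a) i v) }

def output (s : HState V A) (i v : ℕ) : HState V A :=
  { s with io := Function.update s.io i v }

def tick (s : HState V A) : HState V A := { s with time := s.time + 1 }

@[simp] theorem set_var (s : HState V A) (x y : V) (v : ℕ) :
    (s.set x v).var y = if y = x then v else s.var y := by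
  simp [set, Function.update_apply]
@[simp] theorem set_arr (s : HState V A) (x : V) (v : ℕ) : (s.set x v).arr = s.arr := rfl
@[simp] theorem set_io (s : HState V A) (x : V) (v : ℕ) : (s.set x v).io = s.io := rfl
@[simp] theorem set_time (s : HState V A) (x : V) (v : ℕ) : (s.set x v).time = s.time := rfl
@[simp] theorem put_var (s : HState V A) (a : A) (i v : ℕ) : (s.put a i v).var = s.var := rfl
@[simp] theorem put_arr (s : HState V A) (a b : A) (i v : ℕ) :
    (s.put a i v).arr b = if b = a then Function.update (s.arr a) i v else s.arr b := by
  simp [put, Function.update_apply]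
@[simp] theorem put_io (s : HState V A) (a : A) (i v : ℕ) : (s.put a i v).io = s.io := rfl
@[simp] theorem put_time (s : HState V A) (a : A) (i v : ℕ) : (s.put a i v).time = s.time := rfl
@[simp] theorem output_var (s : HState V A) (i v : ℕ) : (s.output i v).var = s.var := rfl
@[simp] theorem output_arr (s : HState V A) (i v : ℕ) : (s.output i v).arr = s.arr := rfl
@[simp] theorem output_io (s : HState V A) (i v : ℕ) :
    (s.output i v).io = Function.update s.io i v := rfl
@[simp] theorem output_time (s : HState V A) (i v : ℕ) : (s.output i v).time = s.time := rfl
@[simp] theorem tick_var (s : HState V A) : s.tick.var = s.var := rfl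
@[simp] theorem tick_arr (s : HState V A) : s.tick.arr = s.arr := rfl
@[simp] theorem tick_io (s : HState V A) : s.tick.io = s.io := rfl
@[simp] theorem tick_time (s : HState V A) : s.tick.time = s.time + 1 := rfl

end HState

namespace Expr

instance : Add (Expr V A) := ⟨.add⟩
instance : Sub (Expr V A) := ⟨.sub⟩
instance : Mul (Expr V A) := ⟨.mul⟩
instance : Div (Expr V A) := ⟨.div⟩
instance : Mod (Expr V A) := ⟨.mod⟩
instance (n : ℕ) : OfNat (Expr V A) n := ⟨.const n⟩
instance : Coe V (Expr V A) := ⟨.var⟩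

def eval (M : Mach) (s : HState V A) : Expr V A → ℕ
  | const c => c
  | var x => s.var x
  | arr a e => s.arr a (e.eval M s)
  | io e => s.io (e.eval M s)
  | add e f => e.eval M s + f.eval M s
  | sub e f => e.eval M s - f.eval M s
  | mul e f => e.eval M s * f.eval M s
  | div e f => e.eval M s / f.eval M s
  | mod e f => e.eval M s % f.eval M s
  | neg e => (M.W - e.eval M s) % M.W
  | lt e f => if e.eval M s < f.eval M s then 1 else 0
  | eq e f => if e.eval M s = f.eval M s then 1 else 0

/-- The evaluation of the expression neither overflows nor leaves the arrays. -/
def Safe (M : Mach) (s : HState V A) : Expr V A → Prop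
  | const c => c < M.L
  | var _ => True
  | arr _ e => e.Safe M s ∧ e.eval M s < M.L
  | io e => e.Safe M s ∧ e.eval M s < M.B
  | add e f => e.Safe M s ∧ f.Safe M s ∧ e.eval M s + f.eval M s < M.L
  | sub e f => e.Safe M s ∧ f.Safe M s
  | mul e f => e.Safe M s ∧ f.Safe M s ∧ e.eval M s * f.eval M s < M.L
  | div e f => e.Safe M s ∧ f.Safe M s
  | mod e f => e.Safe M s ∧ f.Safe M s
  | neg e => e.Safe M s
  | lt e f => e.Safe M s ∧ f.Safe M s
  | eq e f => e.Safe M s ∧ f.Safe M s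

variable (M : Mach) (s : HState V A) (e f : Expr V A)

@[simp] theorem eval_const (c : ℕ) : (const c : Expr V A).eval M s = c := rfl
@[simp] theorem eval_ofNat (c : ℕ) : (no_index (OfNat.ofNat c) : Expr V A).eval M s = c := rfl
@[simp] theorem eval_var (x : V) : (var x : Expr V A).eval M s = s.var x := rfl
@[simp] theorem eval_arr (a : A) : (arr a e).eval M s = s.arr a (e.eval M s) := rfl
@[simp] theorem eval_io : (io e).eval M s = s.io (e.eval M s) := rfl
@[simp] theorem eval_add : (e + f).eval M s = e.eval M s + f.eval M s := rfl
@[simp] theorem eval_sub : (e - f).eval M s = e.eval M s - f.eval M s := rfl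
@[simp] theorem eval_mul : (e * f).eval M s = e.eval M s * f.eval M s := rfl
@[simp] theorem eval_div : (e / f).eval M s = e.eval M s / f.eval M s := rfl
@[simp] theorem eval_mod : (e % f).eval M s = e.eval M s % f.eval M s := rfl
@[simp] theorem eval_neg : (neg e).eval M s = (M.W - e.eval M s) % M.W := rfl
@[simp] theorem eval_lt : (lt e f).eval M s = if e.eval M s < f.eval M s then 1 else 0 := rfl
@[simp] theorem eval_eq : (eq e f).eval M s = if e.eval M s = f.eval M s then 1 else 0 := rfl

@[simp] theorem safe_const (c : ℕ) : (const c : Expr V A).Safe M s ↔ c < M.L := Iff.rfl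
@[simp] theorem safe_ofNat (c : ℕ) : (no_index (OfNat.ofNat c) : Expr V A).Safe M s ↔ c < M.L := Iff.rfl
@[simp] theorem safe_var (x : V) : (var x : Expr V A).Safe M s := trivial
@[simp] theorem safe_arr (a : A) : (arr a e).Safe M s ↔ e.Safe M s ∧ e.eval M s < M.L := Iff.rfl
@[simp] theorem safe_io : (io e).Safe M s ↔ e.Safe M s ∧ e.eval M s < M.B := Iff.rfl
@[simp] theorem safe_add : (e + f).Safe M s ↔
    e.Safe M s ∧ f.Safe M s ∧ e.eval M s + f.eval M s < M.L := Iff.rfl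
@[simp] theorem safe_sub : (e - f).Safe M s ↔ e.Safe M s ∧ f.Safe M s := Iff.rfl
@[simp] theorem safe_mul : (e * f).Safe M s ↔
    e.Safe M s ∧ f.Safe M s ∧ e.eval M s * f.eval M s < M.L := Iff.rfl
@[simp] theorem safe_div : (e / f).Safe M s ↔ e.Safe M s ∧ f.Safe M s := Iff.rfl
@[simp] theorem safe_mod : (e % f).Safe M s ↔ e.Safe M s ∧ f.Safe M s := Iff.rfl
@[simp] theorem safe_neg : (neg e).Safe M s ↔ e.Safe M s := Iff.rfl
@[simp] theorem safe_lt : (lt e f).Safe M s ↔ e.Safe M s ∧ f.Safe M s := Iff.rfl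
@[simp] theorem safe_eq : (eq e f).Safe M s ↔ e.Safe M s ∧ f.Safe M s := Iff.rfl

end Expr

variable [DecidableEq V] [DecidableEq A]

/-- Big-step semantics; the clock of the state is advanced by every iteration of a loop. -/
inductive HExec (M : Mach) : Stmt V A → HState V A → HState V A → Prop where
  | set {x : V} {e : Expr V A} {s : HState V A} :
      e.Safe M s → HExec M (.set x e) s (s.set x (e.eval M s))
  | put {a : A} {e f : Expr V A} {s : HState V A} :
      e.Safe M s → f.Safe M s → e.eval M s < M.L →
      HExec M (.put a e f) s (s.put a (e.eval M s) (f.eval M s))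
  | output {e f : Expr V A} {s : HState V A} :
      e.Safe M s → f.Safe M s → e.eval M s < M.B →
      HExec M (.output e f) s (s.output (e.eval M s) (f.eval M s))
  | seq {p q : Stmt V A} {s s' s'' : HState V A} :
      HExec M p s s' → HExec M q s' s'' → HExec M (.seq p q) s s''
  | iteTrue {e : Expr V A} {p q : Stmt V A} {s s' : HState V A} :
      e.Safe M s → e.eval M s ≠ 0 → HExec M p s s' → HExec M (.ite e p q) s s'
  | iteFalse {e : Expr V A} {p q : Stmt V A} {s s' : HState V A} :
      e.Safe M s → e.eval M s = 0 → HExec M q s s' → HExec M (.ite e p q) s s'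
  | loopTrue {e : Expr V A} {p : Stmt V A} {s s' s'' : HState V A} :
      e.Safe M s → e.eval M s ≠ 0 → HExec M p s.tick s' → HExec M (.loop e p) s' s'' →
      HExec M (.loop e p) s s''
  | loopFalse {e : Expr V A} {p : Stmt V A} {s : HState V A} :
      e.Safe M s → e.eval M s = 0 → HExec M (.loop e p) s s

/-- Some execution of `p` from `s` halts in a state that satisfies `Q`. -/
def Run (M : Mach) (p : Stmt V A) (s : HState V A) (Q : HState V A → Prop) : Prop :=
  ∃ s', HExec M p s s' ∧ Q s'

namespace Stmt

/-- The variables that a statement may change. -/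
def wv : Stmt V A → V → Bool
  | set x _, y => decide (y = x)
  | put _ _ _, _ => false
  | output _ _, _ => false
  | seq p q, y => p.wv y || q.wv y
  | ite _ p q, y => p.wv y || q.wv y
  | loop _ p, y => p.wv y

/-- The arrays that a statement may change. -/
def wa : Stmt V A → A → Bool
  | set _ _, _ => false
  | put a _ _, b => decide (b = a)
  | output _ _, _ => false
  | seq p q, y => p.wa y || q.wa y
  | ite _ p q, y => p.wa y || q.wa y
  | loop _ p, y => p.wa y

/-- Whether a statement may change the input-output area. -/
def wio : Stmt V A → Bool
  | set _ _ => false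
  | put _ _ _ => false
  | output _ _ => true
  | seq p q => p.wio || q.wio
  | ite _ p q => p.wio || q.wio
  | loop _ p => p.wio

end Stmt

/-- `s'` agrees with `s` on everything that `p` does not change. -/
structure Frame (p : Stmt V A) (s s' : HState V A) : Prop where
  var : ∀ x, p.wv x = false → s'.var x = s.var x
  arr : ∀ a, p.wa a = false → s'.arr a = s.arr a
  io : p.wio = false → s'.io = s.io

/-- The sets of written variables and arrays are syntactic, so for a concrete program the side
conditions that something is unchanged reduce by `rfl`. -/
theorem HExec.frame {M : Mach} {p : Stmt V A} {s s' : HState V A} (h : HExec M p s s') :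
    Frame p s s' := by
  induction h with
  | set _ => exact ⟨fun x hx => by simpa [Stmt.wv] using fun h => by simp_all [Stmt.wv],
      fun _ _ => rfl, fun _ => rfl⟩
  | put _ _ _ => exact ⟨fun _ _ => rfl, fun b hb => by
      simp only [Stmt.wa, decide_eq_false_iff_not] at hb; simp [hb], fun _ => rfl⟩
  | output _ _ _ => exact ⟨fun _ _ => rfl, fun _ _ => rfl, fun h => by simp [Stmt.wio] at h⟩
  | seq _ _ h₁ h₂ =>
    refine ⟨fun x hx => ?_, fun x hx => ?_, fun hx => ?_⟩
    · simp only [Stmt.wv, Bool.or_eq_false_iff] at hx; rw [h₂.var x hx.2, h₁.var x hx.1]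
    · simp only [Stmt.wa, Bool.or_eq_false_iff] at hx; rw [h₂.arr x hx.2, h₁.arr x hx.1]
    · simp only [Stmt.wio, Bool.or_eq_false_iff] at hx; rw [h₂.io hx.2, h₁.io hx.1]
  | iteTrue _ _ _ h =>
    refine ⟨fun x hx => ?_, fun x hx => ?_, fun hx => ?_⟩
    · simp only [Stmt.wv, Bool.or_eq_false_iff] at hx; exact h.var x hx.1
    · simp only [Stmt.wa, Bool.or_eq_false_iff] at hx; exact h.arr x hx.1
    · simp only [Stmt.wio, Bool.or_eq_false_iff] at hx; exact h.io hx.1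
  | iteFalse _ _ _ h =>
    refine ⟨fun x hx => ?_, fun x hx => ?_, fun hx => ?_⟩
    · simp only [Stmt.wv, Bool.or_eq_false_iff] at hx; exact h.var x hx.2
    · simp only [Stmt.wa, Bool.or_eq_false_iff] at hx; exact h.arr x hx.2
    · simp only [Stmt.wio, Bool.or_eq_false_iff] at hx; exact h.io hx.2
  | loopTrue _ _ _ _ h₁ h₂ =>
    exact ⟨fun x hx => (h₂.var x hx).trans (h₁.var x hx),
      fun x hx => (h₂.arr x hx).trans (h₁.arr x hx), fun hx => (h₂.io hx).trans (h₁.io hx)⟩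
  | loopFalse _ _ => exact ⟨fun _ _ => rfl, fun _ _ => rfl, fun _ => rfl⟩

/-- Needed for compilation: clock differences are nonnegative, so the cost factor of one part of a
program may also be multiplied with the clock difference of another part. -/
theorem HExec.time_le {M : Mach} {p : Stmt V A} {s s' : HState V A} (h : HExec M p s s') :
    s.time ≤ s'.time := by
  induction h with
  | seq _ _ h₁ h₂ => exact h₁.trans h₂
  | iteTrue _ _ _ h => exact h
  | iteFalse _ _ _ h => exact h
  | loopTrue _ _ _ _ h₁ h₂ => exact (Nat.le_succ _).trans (h₁.trans h₂)
  | _ => simp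

/-! ### Proof rules for total correctness -/

section Rules

variable {M : Mach} {s : HState V A} {Q R : HState V A → Prop}

theorem Run.mono {p : Stmt V A} (h : Run M p s Q) (hQ : ∀ s', Q s' → R s') : Run M p s R := by
  obtain ⟨s', h₁, h₂⟩ := h
  exact ⟨s', h₁, hQ _ h₂⟩

theorem Run.frame {p : Stmt V A} (h : Run M p s Q) : Run M p s (fun s' => Q s' ∧ Frame p s s') := by
  obtain ⟨s', h₁, h₂⟩ := h
  exact ⟨s', h₁, h₂, h₁.frame⟩

theorem run_seq {p q : Stmt V A} :
    Run M (p ;; q) s Q ↔ Run M p s (fun s' => Run M q s' Q) := by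
  constructor
  · rintro ⟨s', h, hQ⟩
    cases h with | seq h₁ h₂ => exact ⟨_, h₁, _, h₂, hQ⟩
  · rintro ⟨s', h₁, s'', h₂, hQ⟩
    exact ⟨s'', .seq h₁ h₂, hQ⟩

theorem Run.seq {p q : Stmt V A} (h : Run M p s R) (hq : ∀ s', R s' → Run M q s' Q) :
    Run M (p ;; q) s Q :=
  run_seq.2 (h.mono hq)

theorem run_set {x : V} {e : Expr V A} :
    Run M (.set x e) s Q ↔ e.Safe M s ∧ Q (s.set x (e.eval M s)) := by
  constructor
  · rintro ⟨s', h, hQ⟩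
    cases h with | set h => exact ⟨h, hQ⟩
  · rintro ⟨h, hQ⟩
    exact ⟨_, .set h, hQ⟩

theorem run_put {a : A} {e f : Expr V A} :
    Run M (.put a e f) s Q ↔ e.Safe M s ∧ f.Safe M s ∧ e.eval M s < M.L ∧
      Q (s.put a (e.eval M s) (f.eval M s)) := by
  constructor
  · rintro ⟨s', h, hQ⟩
    cases h with | put h₁ h₂ h₃ => exact ⟨h₁, h₂, h₃, hQ⟩
  · rintro ⟨h₁, h₂, h₃, hQ⟩
    exact ⟨_, .put h₁ h₂ h₃, hQ⟩

theorem run_output {e f : Expr V A} :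
    Run M (.output e f) s Q ↔ e.Safe M s ∧ f.Safe M s ∧ e.eval M s < M.B ∧
      Q (s.output (e.eval M s) (f.eval M s)) := by
  constructor
  · rintro ⟨s', h, hQ⟩
    cases h with | output h₁ h₂ h₃ => exact ⟨h₁, h₂, h₃, hQ⟩
  · rintro ⟨h₁, h₂, h₃, hQ⟩
    exact ⟨_, .output h₁ h₂ h₃, hQ⟩

theorem run_ite {e : Expr V A} {p q : Stmt V A} :
    Run M (.ite e p q) s Q ↔ e.Safe M s ∧
      ((e.eval M s ≠ 0 → Run M p s Q) ∧ (e.eval M s = 0 → Run M q s Q)) := by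
  constructor
  · rintro ⟨s', h, hQ⟩
    cases h with
    | iteTrue h₁ h₂ h₃ => exact ⟨h₁, fun _ => ⟨_, h₃, hQ⟩, fun h => absurd h h₂⟩
    | iteFalse h₁ h₂ h₃ => exact ⟨h₁, fun h => absurd h₂ h, fun _ => ⟨_, h₃, hQ⟩⟩
  · rintro ⟨h, hp, hq⟩
    by_cases h0 : e.eval M s = 0
    · obtain ⟨s', h₁, h₂⟩ := hq h0
      exact ⟨s', .iteFalse h h0 h₁, h₂⟩
    · obtain ⟨s', h₁, h₂⟩ := hp h0
      exact ⟨s', .iteTrue h h0 h₁, h₂⟩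

/-- Rule for loops: an invariant and a decreasing measure. -/
theorem Run.loop {e : Expr V A} {p : Stmt V A} (Inv : HState V A → Prop) (μ : HState V A → ℕ)
    (h0 : Inv s) (hsafe : ∀ s, Inv s → e.Safe M s)
    (hstep : ∀ s, Inv s → e.eval M s ≠ 0 →
      Run M p s.tick (fun s' => Inv s' ∧ μ s' < μ s))
    (hend : ∀ s, Inv s → e.eval M s = 0 → Q s) :
    Run M (.loop e p) s Q := by
  generalize hk : μ s = k
  induction k using Nat.strong_induction_on generalizing s with
  | _ k ih =>
    by_cases he : e.eval M s = 0
    · exact ⟨s, .loopFalse (hsafe s h0) he, hend s h0 he⟩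
    · obtain ⟨s', h₁, h₂, h₃⟩ := hstep s h0 he
      obtain ⟨s'', h₄, h₅⟩ := ih (μ s') (hk ▸ h₃) h₂ rfl
      exact ⟨s'', .loopTrue (hsafe s h0) he h₁ h₄, h₅⟩

/-- `for i from (current value) while i < e do p` -/
def Stmt.for (i : V) (e : Expr V A) (p : Stmt V A) : Stmt V A :=
  .loop (.lt (.var i) e) (p ;; .set i (.var i + 1))

/-- The rule for loops, with the frame. -/
theorem Run.loop_frame {e : Expr V A} {p : Stmt V A} (Inv : HState V A → Prop)
    (μ : HState V A → ℕ) (h0 : Inv s)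
    (hsafe : ∀ s', Inv s' → Frame (Stmt.loop e p) s s' → e.Safe M s')
    (hstep : ∀ s', Inv s' → Frame (Stmt.loop e p) s s' → e.eval M s' ≠ 0 →
      Run M p s'.tick (fun s'' => Inv s'' ∧ μ s'' < μ s'))
    (hend : ∀ s', Inv s' → Frame (Stmt.loop e p) s s' → e.eval M s' = 0 → Q s') :
    Run M (.loop e p) s Q := by
  refine Run.loop (fun s' => Inv s' ∧ Frame (Stmt.loop e p) s s') μ
    ⟨h0, fun _ _ => rfl, fun _ _ => rfl, fun _ => rfl⟩ (fun s' h => hsafe s' h.1 h.2) ?_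
    (fun s' h => hend s' h.1 h.2)
  rintro s' ⟨hI, hf⟩ hne
  refine (hstep s' hI hf hne).frame.mono ?_
  rintro s'' ⟨⟨h1, h2⟩, hf'⟩
  exact ⟨⟨h1, fun x hx => (hf'.var x hx).trans (hf.var x hx),
    fun x hx => (hf'.arr x hx).trans (hf.arr x hx), fun hx => (hf'.io hx).trans (hf.io hx)⟩, h2⟩

/-- Rule for loops with a counter that runs from `a` to `b`. -/
theorem Run.for_inv {i : V} {e : Expr V A} {p : Stmt V A} (Inv : ℕ → HState V A → Prop) (a b : ℕ)
    (hi : s.var i = a) (hab : a ≤ b) (hb : b < M.L) (h0 : Inv a s)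
    (he : ∀ s', Frame (Stmt.for i e p) s s' → e.Safe M s' ∧ e.eval M s' = b)
    (hp : p.wv i = false)
    (hstep : ∀ k s', a ≤ k → k < b → Inv k s' → Frame (Stmt.for i e p) s s' → s'.var i = k →
      Run M p s'.tick (fun s'' => Inv (k + 1) (s''.set i (k + 1)))) :
    Run M (Stmt.for i e p) s (fun s' => Inv b s' ∧ s'.var i = b) := by
  refine Run.loop_frame (fun s' => ∃ k, a ≤ k ∧ k ≤ b ∧ s'.var i = k ∧ Inv k s')
      (fun s' => b - s'.var i) ?_ ?_ ?_ ?_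
  · exact ⟨a, le_rfl, hab, hi, h0⟩
  · rintro s' ⟨k, -, -, -, -⟩ hf
    simpa using (he s' hf).1
  · rintro s' ⟨k, hk, hkb, hsk, hI⟩ hf hne
    have hlt : k < b := by
      by_contra hcon
      simp [(he s' hf).2, hsk, hcon] at hne
    obtain ⟨s'', hx, hI'⟩ := hstep k s' hk hlt hI hf hsk
    have hvar : s''.var i = k := by rw [hx.frame.var i hp]; exact hsk
    refine ⟨s''.set i (k + 1), ?_, ⟨k + 1, by omega, by omega, by simp, hI'⟩, ?_⟩
    · refine .seq hx ?_
      have := HExec.set (M := M) (x := i) (e := .var i + 1) (s := s'')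
        (by simp only [Expr.safe_add, Expr.safe_var, Expr.safe_ofNat, Expr.eval_var,
              Expr.eval_ofNat, hvar, true_and]; omega)
      simpa [hvar] using this
    · simp [hsk]; omega
  · rintro s' ⟨k, hk, hkb, hsk, hI⟩ hf h
    have : k = b := by
      by_contra hcon
      have : k < b := by omega
      simp [(he s' hf).2, hsk, this] at h
    subst this
    exact ⟨hI, hsk⟩

/-- Rule for loops with a counter that runs from `a` to `b`. Each iteration takes time at most
`T + 1`. -/
theorem Run.for {i : V} {e : Expr V A} {p : Stmt V A} (Inv : ℕ → HState V A → Prop) (a b T : ℕ)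
    (hi : s.var i = a) (hab : a ≤ b) (hb : b < M.L) (h0 : Inv a s)
    (he : ∀ s', Frame (Stmt.for i e p) s s' → e.Safe M s' ∧ e.eval M s' = b)
    (hp : p.wv i = false)
    (hstep : ∀ k s', a ≤ k → k < b → Inv k s' → Frame (Stmt.for i e p) s s' → s'.var i = k →
      Run M p s'.tick (fun s'' => Inv (k + 1) (s''.set i (k + 1)) ∧ s''.time ≤ s'.time + 1 + T))
    : Run M (Stmt.for i e p) s (fun s' => Inv b s' ∧ s'.var i = b ∧
        s'.time ≤ s.time + (b - a) * (T + 1)) := by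
  refine (Run.for_inv (fun k s' => Inv k s' ∧ s'.time ≤ s.time + (k - a) * (T + 1)) a b hi hab hb
    ⟨h0, by simp⟩ he hp ?_).mono fun s' h => ⟨h.1.1, h.2, h.1.2⟩
  rintro k s' hk hkb ⟨hI, ht⟩ hf hik
  refine (hstep k s' hk hkb hI hf hik).mono fun s'' h => ⟨h.1, ?_⟩
  have h2 := h.2
  rw [show k + 1 - a = (k - a) + 1 by omega, add_mul]
  simp only [HState.set_time]
  omega

end Rules

end Kangaroo

/-! ### Compilation to the word RAM -/

namespace Kangaroo

set_option linter.unusedSectionVars false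

open WordRAM

section Compile

variable {V A : Type} [Fintype V] [Fintype A] [DecidableEq V] [DecidableEq A]

noncomputable def code (α : Type) [Fintype α] (a : α) : ℕ := (Fintype.equivFin α a).val

theorem code_injective (α : Type) [Fintype α] : Function.Injective (code α) := fun _ _ h =>
  (Fintype.equivFin α).injective (Fin.ext h)

theorem code_lt (α : Type) [Fintype α] (a : α) : code α a < Fintype.card α :=
  (Fintype.equivFin α a).isLt

/-- Register 0 stays zero and register 1 holds the base address of the arrays. Variables use the
even registers from 2 on, temporaries the odd ones from 3 on. -/
noncomputable def rvar (x : V) : ℕ := 2 * code V x + 2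

def rtmp (k : ℕ) : ℕ := 2 * k + 3

/-- Code that evaluates an expression into the temporary register number `k`. -/
noncomputable def compileE : Expr V A → ℕ → Program
  | .const c, k => .const (rtmp k) c
  | .var x, k => .op .add (rtmp k) (rvar x) 0
  | .arr a e, k => .seq (compileE e k) <|
      .seq (.const (rtmp (k + 1)) (Fintype.card A)) <|
      .seq (.op .mul (rtmp k) (rtmp k) (rtmp (k + 1))) <|
      .seq (.op .add (rtmp k) (rtmp k) 1) <|
      .seq (.const (rtmp (k + 1)) (code A a)) <|
      .seq (.op .add (rtmp k) (rtmp k) (rtmp (k + 1))) <|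
      .load (rtmp k) (rtmp k)
  | .io e, k => .seq (compileE e k) (.load (rtmp k) (rtmp k))
  | .add e f, k => .seq (compileE e k) (.seq (compileE f (k + 1))
      (.op .add (rtmp k) (rtmp k) (rtmp (k + 1))))
  | .sub e f, k => .seq (compileE e k) (.seq (compileE f (k + 1))
      (.ite .ult (rtmp k) (rtmp (k + 1)) (.const (rtmp k) 0)
        (.op .sub (rtmp k) (rtmp k) (rtmp (k + 1)))))
  | .mul e f, k => .seq (compileE e k) (.seq (compileE f (k + 1))
      (.op .mul (rtmp k) (rtmp k) (rtmp (k + 1))))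
  | .div e f, k => .seq (compileE e k) (.seq (compileE f (k + 1))
      (.op .div (rtmp k) (rtmp k) (rtmp (k + 1))))
  | .mod e f, k => .seq (compileE e k) (.seq (compileE f (k + 1))
      (.op .mod (rtmp k) (rtmp k) (rtmp (k + 1))))
  | .neg e, k => .seq (compileE e k) (.op .sub (rtmp k) 0 (rtmp k))
  | .lt e f, k => .seq (compileE e k) (.seq (compileE f (k + 1))
      (.ite .ult (rtmp k) (rtmp (k + 1)) (.const (rtmp k) 1) (.const (rtmp k) 0)))
  | .eq e f, k => .seq (compileE e k) (.seq (compileE f (k + 1))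
      (.ite .eq (rtmp k) (rtmp (k + 1)) (.const (rtmp k) 1) (.const (rtmp k) 0)))

/-- A bound for the time that the evaluation of an expression takes. -/
def Expr.cost : Expr V A → ℕ
  | .const _ => 1
  | .var _ => 1
  | .arr _ e => e.cost + 6
  | .io e => e.cost + 1
  | .add e f => e.cost + f.cost + 2
  | .sub e f => e.cost + f.cost + 2
  | .mul e f => e.cost + f.cost + 2
  | .div e f => e.cost + f.cost + 2
  | .mod e f => e.cost + f.cost + 2
  | .neg e => e.cost + 1
  | .lt e f => e.cost + f.cost + 2
  | .eq e f => e.cost + f.cost + 2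

noncomputable def compile : Stmt V A → Program
  | .set x e => .seq (compileE e 0) (.op .add (rvar x) (rtmp 0) 0)
  | .put a e f => .seq (compileE f 0) <| .seq (compileE e 1) <|
      .seq (.const (rtmp 2) (Fintype.card A)) <|
      .seq (.op .mul (rtmp 1) (rtmp 1) (rtmp 2)) <|
      .seq (.op .add (rtmp 1) (rtmp 1) 1) <|
      .seq (.const (rtmp 2) (code A a)) <|
      .seq (.op .add (rtmp 1) (rtmp 1) (rtmp 2)) <|
      .store (rtmp 1) (rtmp 0)
  | .output e f => .seq (compileE f 0) (.seq (compileE e 1) (.store (rtmp 1) (rtmp 0)))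
  | .seq p q => .seq (compile p) (compile q)
  | .ite e p q => .seq (compileE e 0) (.ite .ult 0 (rtmp 0) (compile p) (compile q))
  | .loop e p => .seq (compileE e 0)
      (.loop .ult 0 (rtmp 0) (.seq (compile p) (compileE e 0)))

/-- A bound for the time that a statement takes for each iteration of a loop. -/
def Stmt.cost : Stmt V A → ℕ
  | .set _ e => e.cost + 1
  | .put _ e f => e.cost + f.cost + 6
  | .output e f => e.cost + f.cost + 1
  | .seq p q => p.cost + q.cost
  | .ite e p q => e.cost + p.cost + q.cost + 1
  | .loop e p => e.cost + p.cost + 1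

variable {w : ℕ}

/-- The address of cell `i` of the array `a`. -/
noncomputable def addr (M : Mach) (a : A) (i : ℕ) : ℕ := M.B + Fintype.card A * i + code A a

/-- The machine state `σ` implements the state `s`. -/
structure Sim (M : Mach) (σ : State w) (s : HState V A) : Prop where
  zero : σ.reg 0 = 0
  base : (σ.reg 1).toNat = M.B
  var : ∀ x, (σ.reg (rvar x)).toNat = s.var x
  arr : ∀ a i, i < M.L → (σ.mem (BitVec.ofNat w (addr M a i))).toNat = s.arr a i
  io : ∀ i, i < M.B → (σ.mem (BitVec.ofNat w i)).toNat = s.io i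

/-- The words are long enough for the arrays. -/
structure Mach.Fits (M : Mach) (A : Type) [Fintype A] (w : ℕ) : Prop where
  hW : M.W = 2 ^ w
  hL : 1 < M.L
  mem : M.B + Fintype.card A * M.L ≤ 2 ^ w
  hLW : M.L ≤ 2 ^ w

theorem rvar_ne_rtmp (x : V) (k : ℕ) : rvar x ≠ rtmp k := by simp only [rvar, rtmp]; omega
theorem rvar_ne_zero (x : V) : rvar x ≠ 0 := by simp [rvar]
theorem rvar_ne_one (x : V) : rvar x ≠ 1 := by simp only [rvar]; omega
theorem rvar_inj {x y : V} : rvar x = rvar y ↔ x = y :=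
  ⟨fun h => code_injective V (by simp only [rvar] at h; omega), fun h => h ▸ rfl⟩

theorem Sim.setTmp {M : Mach} {σ : State w} {s : HState V A} (h : Sim M σ s) (k : ℕ)
    (v : BitVec w) : Sim M (σ.setReg (rtmp k) v) s := by
  refine ⟨?_, ?_, fun x => ?_, h.arr, h.io⟩
  · simpa [State.setReg, rtmp] using h.zero
  · have : (1 : ℕ) ≠ rtmp k := by simp only [rtmp]; omega
    simpa [State.setReg, this] using h.base
  · simpa [State.setReg, rvar_ne_rtmp] using h.var x

theorem addr_lt {M : Mach} (hM : M.Fits A w) (a : A) {i : ℕ} (hi : i < M.L) :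
    addr M a i < 2 ^ w := by
  have h1 := code_lt A a
  have h2 : Fintype.card A * i + Fintype.card A ≤ Fintype.card A * M.L := by
    calc _ = Fintype.card A * (i + 1) := by ring
      _ ≤ _ := Nat.mul_le_mul_left _ hi
  have := hM.mem
  simp only [addr]; omega

/-- Quotient and remainder by the number of arrays recover the index and the array. The arrays are
interleaved rather than consecutive, because then addresses do not involve `M.L`, which depends on κ
and is unknown to the program. -/
theorem addr_inj {M : Mach} {a b : A} {i j : ℕ} (h : addr M a i = addr M b j) :
    a = b ∧ i = j := by
  have h1 := code_lt A a
  have h2 := code_lt A b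
  simp only [addr] at h
  have h3 : Fintype.card A * i + code A a = Fintype.card A * j + code A b := by omega
  have hij : i = j := by
    have e1 := congrArg (· / Fintype.card A) h3
    simpa [Nat.mul_add_div (by omega : Fintype.card A > 0), Nat.div_eq_of_lt h1,
      Nat.div_eq_of_lt h2] using e1
  subst hij
  exact ⟨code_injective A (by omega), rfl⟩

theorem ofNat_ne {a b : ℕ} (ha : a < 2 ^ w) (hb : b < 2 ^ w) (h : a ≠ b) :
    BitVec.ofNat w a ≠ BitVec.ofNat w b := fun hab => h <| by
  have := congrArg BitVec.toNat hab
  simpa [Nat.mod_eq_of_lt ha, Nat.mod_eq_of_lt hb] using this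

theorem eq_ofNat_of_toNat {x : BitVec w} {a : ℕ} (h : x.toNat = a) : x = BitVec.ofNat w a := by
  rw [← h]; simp

/-- What the evaluation of an expression achieves. -/
def EvalTo (M : Mach) (p : Program) (k c : ℕ) (σ : State w) (s : HState V A) (v : ℕ) : Prop :=
  ∃ (t : ℕ) (σ' : State w), Exec p σ t σ' ∧ t ≤ c ∧ Sim M σ' s ∧ (σ'.reg (rtmp k)).toNat = v ∧
    ∀ j < k, σ'.reg (rtmp j) = σ.reg (rtmp j)

theorem EvalTo.last {M : Mach} {p : Program} {k c : ℕ} {σ : State w} {s : HState V A} {v u : ℕ}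
    (h : EvalTo M p k c σ s v) (q : Program) (d : ℕ)
    (hq : ∀ σ : State w, Sim M σ s → (σ.reg (rtmp k)).toNat = v →
      ∃ (t : ℕ) (x : BitVec w), t ≤ d ∧ Exec q σ t (σ.setReg (rtmp k) x) ∧ x.toNat = u) :
    EvalTo M (.seq p q) k (c + d) σ s u := by
  obtain ⟨t, σ', h1, h2, h3, h4, h5⟩ := h
  obtain ⟨t', x, h6, h7, h8⟩ := hq σ' h3 h4
  refine ⟨t + t', _, .seq h1 h7, by omega, h3.setTmp _ _, by simp [State.setReg, h8], ?_⟩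
  intro j hj
  have : rtmp j ≠ rtmp k := by simp only [rtmp]; omega
  simpa [State.setReg, this] using h5 j hj

/-- The temporaries form a stack: the second operand is evaluated one register higher, and
evaluation leaves all lower temporaries intact, so the first operand survives. -/
theorem EvalTo.binary {M : Mach} {p q : Program} {k c d : ℕ} {σ : State w} {s : HState V A}
    {v u r : ℕ} (hp : EvalTo M p k c σ s v)
    (hq : ∀ σ : State w, Sim M σ s → EvalTo M q (k + 1) d σ s u) (o : Program)
    (ho : ∀ σ : State w, Sim M σ s → (σ.reg (rtmp k)).toNat = v →
      (σ.reg (rtmp (k + 1))).toNat = u →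
      ∃ (t : ℕ) (x : BitVec w), t ≤ 2 ∧ Exec o σ t (σ.setReg (rtmp k) x) ∧ x.toNat = r) :
    EvalTo M (.seq p (.seq q o)) k (c + d + 2) σ s r := by
  obtain ⟨t, σ', h1, h2, h3, h4, h5⟩ := hp
  obtain ⟨t', σ'', h1', h2', h3', h4', h5'⟩ := hq σ' h3
  obtain ⟨t'', x, h6, h7, h8⟩ := ho σ'' h3' (by rw [h5' k (by omega), h4]) h4'
  refine ⟨t + (t' + t''), _, .seq h1 (.seq h1' h7), by omega, h3'.setTmp _ _,
    by simp [State.setReg, h8], ?_⟩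
  intro j hj
  have : rtmp j ≠ rtmp k := by simp only [rtmp]; omega
  simpa [State.setReg, this] using (h5' j (by omega)).trans (h5 j hj)

/-- Code that turns an index into an address. -/
theorem addr_exec {M : Mach} {σ : State w} {s : HState V A} (hσ : Sim M σ s)
    (a : A) {k i : ℕ} (hk : (σ.reg (rtmp k)).toNat = i) (q : Program) :
    ∃ σ₁ : State w, Sim M σ₁ s ∧ (∀ j < k, σ₁.reg (rtmp j) = σ.reg (rtmp j)) ∧
      σ₁.reg (rtmp k) = BitVec.ofNat w (addr M a i) ∧
      ∀ t σ', Exec q σ₁ t σ' → Exec (.seq (.const (rtmp (k + 1)) (Fintype.card A)) <|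
      .seq (.op .mul (rtmp k) (rtmp k) (rtmp (k + 1))) <|
      .seq (.op .add (rtmp k) (rtmp k) 1) <|
      .seq (.const (rtmp (k + 1)) (code A a)) <|
      .seq (.op .add (rtmp k) (rtmp k) (rtmp (k + 1))) q) σ (t + 5) σ' := by
  set σa := σ.setReg (rtmp (k + 1)) (BitVec.ofNat w (Fintype.card A)) with ha
  set σb := σa.setReg (rtmp k) (BinOp.mul.eval (σa.reg (rtmp k)) (σa.reg (rtmp (k + 1)))) with hb
  set σc := σb.setReg (rtmp k) (BinOp.add.eval (σb.reg (rtmp k)) (σb.reg 1)) with hc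
  set σd := σc.setReg (rtmp (k + 1)) (BitVec.ofNat w (code A a)) with hd
  set σe := σd.setReg (rtmp k) (BinOp.add.eval (σd.reg (rtmp k)) (σd.reg (rtmp (k + 1)))) with he
  refine ⟨σe, ((((hσ.setTmp (k + 1) _).setTmp k _).setTmp k _).setTmp (k + 1) _).setTmp k _,
    ?_, ?_, fun t σ' h => ?_⟩
  rotate_left 2
  · rw [show t + 5 = 1 + (1 + (1 + (1 + (1 + t)))) by ring]
    exact .seq (.const _ _ _) (.seq (.op _ _ _ _ _) (.seq (.op _ _ _ _ _)
      (.seq (.const _ _ _) (.seq (.op _ _ _ _ _) h))))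
  · intro j hj
    have h1 : rtmp j ≠ rtmp k := by simp only [rtmp]; omega
    have h2 : rtmp j ≠ rtmp (k + 1) := by simp only [rtmp]; omega
    simp [ha, hb, hc, hd, he, State.setReg, h1, h2]
  · have h1 : rtmp k ≠ rtmp (k + 1) := by simp only [rtmp]; omega
    have h3 : (1 : ℕ) ≠ rtmp k := by simp only [rtmp]; omega
    have h4 : (1 : ℕ) ≠ rtmp (k + 1) := by simp only [rtmp]; omega
    have hB : σ.reg 1 = BitVec.ofNat w M.B := eq_ofNat_of_toNat hσ.base
    have hi : σ.reg (rtmp k) = BitVec.ofNat w i := eq_ofNat_of_toNat hk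
    simp only [ha, hb, hc, hd, he, State.setReg, Function.update_self,
      Function.update_of_ne h1, BinOp.eval,
      Function.update_of_ne h3, Function.update_of_ne h4, hB, hi, addr]
    rw [← BitVec.ofNat_mul, ← BitVec.ofNat_add, ← BitVec.ofNat_add]
    congr 1; ring

/-- `Safe` keeps constants, sums and products below `M.L ≤ 2 ^ w`, so reduction modulo `2 ^ w` is
invisible. Differences are guarded by a comparison, quotients and remainders cannot overflow, and
`neg` has the modular value by definition. -/
theorem compileE_correct {M : Mach} (hM : M.Fits A w) {s : HState V A} (e : Expr V A) (k : ℕ)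
    (σ : State w) (hσ : Sim M σ s) (hs : e.Safe M s) :
    EvalTo M (compileE e k) k e.cost σ s (e.eval M s) := by
  have hw : M.L ≤ 2 ^ w := hM.hLW
  have hL := hM.hL
  induction e generalizing k σ with
  | const c =>
    refine ⟨1, _, .const _ _ _, le_rfl, hσ.setTmp _ _, ?_, fun j hj => ?_⟩
    · simp only [State.setReg, Function.update_self, BitVec.toNat_ofNat]
      exact Nat.mod_eq_of_lt (lt_of_lt_of_le hs hw)
    · have : rtmp j ≠ rtmp k := by simp only [rtmp]; omega
      simp [State.setReg, this]
  | var x =>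
    refine ⟨1, _, .op _ _ _ _ _, le_rfl, hσ.setTmp _ _, ?_, fun j hj => ?_⟩
    · simp [State.setReg, BinOp.eval, hσ.zero, hσ.var x, Expr.eval]
    · have : rtmp j ≠ rtmp k := by simp only [rtmp]; omega
      simp [State.setReg, this]
  | arr a e ih =>
    obtain ⟨t, σ', h1, h2, h3, h4, h5⟩ := ih k σ hσ hs.1
    obtain ⟨σ₁, g1, g2, g3, g4⟩ := addr_exec h3 a h4 (.load (rtmp k) (rtmp k))
    refine ⟨t + (1 + 5), _, .seq h1 (g4 _ _ (.load _ _ _)), by simp only [Expr.cost]; omega,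
      g1.setTmp _ _, ?_, fun j hj => ?_⟩
    · simp only [State.setReg, Function.update_self, g3, Expr.eval]
      exact g1.arr a _ hs.2
    · have : rtmp j ≠ rtmp k := by simp only [rtmp]; omega
      simpa [State.setReg, this] using (g2 j hj).trans (h5 j hj)
  | io e ih =>
    refine (ih k σ hσ hs.1).last _ 1 fun σ h3 h4 => ⟨1, _, le_rfl, .load _ _ _, ?_⟩
    rw [eq_ofNat_of_toNat h4]
    exact h3.io _ hs.2
  | add e f ihe ihf =>
    refine (ihe k σ hσ hs.1).binary (fun σ h => ihf (k + 1) σ h hs.2.1) _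
      fun σ _ h4 h5 => ⟨1, _, by omega, .op _ _ _ _ _, ?_⟩
    simp only [BinOp.eval, BitVec.toNat_add, h4, h5]
    exact Nat.mod_eq_of_lt (lt_of_lt_of_le hs.2.2 hw)
  | mul e f ihe ihf =>
    refine (ihe k σ hσ hs.1).binary (fun σ h => ihf (k + 1) σ h hs.2.1) _
      fun σ _ h4 h5 => ⟨1, _, by omega, .op _ _ _ _ _, ?_⟩
    simp only [BinOp.eval, BitVec.toNat_mul, h4, h5]
    exact Nat.mod_eq_of_lt (lt_of_lt_of_le hs.2.2 hw)
  | div e f ihe ihf =>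
    refine (ihe k σ hσ hs.1).binary (fun σ h => ihf (k + 1) σ h hs.2) _
      fun σ _ h4 h5 => ⟨1, _, by omega, .op _ _ _ _ _, ?_⟩
    simp only [BinOp.eval, BitVec.toNat_udiv, h4, h5, Expr.eval]
  | mod e f ihe ihf =>
    refine (ihe k σ hσ hs.1).binary (fun σ h => ihf (k + 1) σ h hs.2) _
      fun σ _ h4 h5 => ⟨1, _, by omega, .op _ _ _ _ _, ?_⟩
    simp only [BinOp.eval, BitVec.toNat_umod, h4, h5, Expr.eval]
  | sub e f ihe ihf =>
    refine (ihe k σ hσ hs.1).binary (fun σ h => ihf (k + 1) σ h hs.2) _ fun σ _ h4 h5 => ?_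
    by_cases hlt : e.eval M s < f.eval M s
    · refine ⟨2, _, le_rfl, .iteTrue ?_ (.const _ _ _), ?_⟩
      · simpa [Cmp.eval, BitVec.ult, h4, h5] using hlt
      · simp only [BitVec.toNat_ofNat, Nat.zero_mod, Expr.eval]; omega
    · refine ⟨2, _, le_rfl, .iteFalse ?_ (.op _ _ _ _ _), ?_⟩
      · simpa [Cmp.eval, BitVec.ult, h4, h5] using hlt
      · simp only [BinOp.eval, Expr.eval]
        rw [BitVec.toNat_sub_of_le (by rw [BitVec.le_def]; omega), h4, h5]
  | neg e ih =>
    refine (ih k σ hσ hs).last _ 1 fun σ h3 h4 => ⟨1, _, le_rfl, .op _ _ _ _ _, ?_⟩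
    simp only [BinOp.eval, h3.zero, Expr.eval, hM.hW, ← h4]
    simp
  | lt e f ihe ihf =>
    refine (ihe k σ hσ hs.1).binary (fun σ h => ihf (k + 1) σ h hs.2) _ fun σ _ h4 h5 => ?_
    by_cases hlt : e.eval M s < f.eval M s
    · refine ⟨2, _, le_rfl, .iteTrue ?_ (.const _ _ _), ?_⟩
      · simpa [Cmp.eval, BitVec.ult, h4, h5] using hlt
      · simp only [BitVec.toNat_ofNat, Expr.eval, hlt, if_true]
        exact Nat.mod_eq_of_lt (by omega)
    · refine ⟨2, _, le_rfl, .iteFalse ?_ (.const _ _ _), ?_⟩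
      · simpa [Cmp.eval, BitVec.ult, h4, h5] using hlt
      · simp [Expr.eval, hlt]
  | eq e f ihe ihf =>
    refine (ihe k σ hσ hs.1).binary (fun σ h => ihf (k + 1) σ h hs.2) _ fun σ _ h4 h5 => ?_
    by_cases hlt : e.eval M s = f.eval M s
    · refine ⟨2, _, le_rfl, .iteTrue ?_ (.const _ _ _), ?_⟩
      · simp [Cmp.eval, ← BitVec.toNat_inj, h4, h5, hlt]
      · simp only [BitVec.toNat_ofNat, Expr.eval, hlt, if_true]
        exact Nat.mod_eq_of_lt (by omega)
    · refine ⟨2, _, le_rfl, .iteFalse ?_ (.const _ _ _), ?_⟩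
      · simp [Cmp.eval, ← BitVec.toNat_inj, h4, h5, hlt]
      · simp [Expr.eval, hlt]

theorem Sim.set {M : Mach} {σ : State w} {s : HState V A} (h : Sim M σ s) (x : V)
    {v : BitVec w} {u : ℕ} (hv : v.toNat = u) : Sim M (σ.setReg (rvar x) v) (s.set x u) := by
  refine ⟨?_, ?_, fun y => ?_, h.arr, h.io⟩
  · simpa [State.setReg, (rvar_ne_zero x).symm] using h.zero
  · simpa [State.setReg, (rvar_ne_one x).symm] using h.base
  · by_cases hy : y = x
    · subst hy; simp [State.setReg, hv]
    · simpa [State.setReg, rvar_inj, hy] using h.var y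

theorem Sim.put {M : Mach} (hM : M.Fits A w) {σ : State w} {s : HState V A} (h : Sim M σ s)
    (a : A) {i : ℕ} (hi : i < M.L) {v : BitVec w} {u : ℕ} (hv : v.toNat = u) :
    Sim M (σ.setMem (BitVec.ofNat w (addr M a i)) v) (s.put a i u) := by
  refine ⟨h.zero, h.base, h.var, fun b j hj => ?_, fun j hj => ?_⟩
  · by_cases hb : b = a
    · subst hb
      by_cases hij : j = i
      · subst hij; simp [State.setMem, hv]
      · have := ofNat_ne (addr_lt hM b hj) (addr_lt hM b hi) fun hc => hij (addr_inj hc).2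
        simpa [State.setMem, this, hij] using h.arr b j hj
    · have := ofNat_ne (addr_lt hM b hj) (addr_lt hM a hi) fun hc => hb (addr_inj hc).1
      simpa [State.setMem, this, hb] using h.arr b j hj
  · have h1 := addr_lt hM a hi
    have h2 : M.B ≤ addr M a i := by simp only [addr]; omega
    have := ofNat_ne (w := w) (a := j) (by omega) h1 (by omega)
    simpa [State.setMem, this] using h.io j hj

theorem Sim.output {M : Mach} (hM : M.Fits A w) {σ : State w} {s : HState V A} (h : Sim M σ s)
    {i : ℕ} (hi : i < M.B) {v : BitVec w} {u : ℕ} (hv : v.toNat = u) :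
    Sim M (σ.setMem (BitVec.ofNat w i) v) (s.output i u) := by
  have hB : M.B ≤ 2 ^ w := (Nat.le_add_right _ _).trans hM.mem
  refine ⟨h.zero, h.base, h.var, fun b j hj => ?_, fun j hj => ?_⟩
  · have h1 := addr_lt hM b hj
    have h2 : M.B ≤ addr M b j := by simp only [addr]; omega
    have := ofNat_ne (w := w) (b := i) h1 (by omega) (by omega)
    simpa [State.setMem, this] using h.arr b j hj
  · by_cases hij : j = i
    · subst hij; simp [State.setMem, hv]
    · have := ofNat_ne (w := w) (a := j) (b := i) (by omega) (by omega) hij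
      simpa [State.setMem, this, hij] using h.io j hj

/-- In other words, t ≤ cost · (clock difference + 1). The form is stable under sequencing, because
both parts are charged to the sum of the differences and the 1 is needed only once; in a loop each
tick pays for one test and the straight-line part of one body. -/
theorem compile_correct {M : Mach} (hM : M.Fits A w) {p : Stmt V A} {s s' : HState V A}
    (hp : HExec M p s s') (σ : State w) (hσ : Sim M σ s) :
    ∃ (t : ℕ) (σ' : State w), Exec (compile p) σ t σ' ∧ Sim M σ' s' ∧
      t + p.cost * s.time ≤ p.cost * (s'.time + 1) := by
  induction hp generalizing σ with
  | @set x e s he =>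
    obtain ⟨t, σ', h1, h2, h3, h4, h5⟩ := compileE_correct hM e 0 σ hσ he
    refine ⟨t + 1, _, .seq h1 (.op _ _ _ _ _), h3.set x ?_, ?_⟩
    · simp [BinOp.eval, h3.zero, h4]
    · simp only [Stmt.cost, HState.set_time]; rw [mul_add]; omega
  | @put a e f s he hf hi =>
    obtain ⟨t, σ', h1, h2, h3, h4, h5⟩ := compileE_correct hM f 0 σ hσ hf
    obtain ⟨t', σ'', h1', h2', h3', h4', h5'⟩ := compileE_correct hM e 1 σ' h3 he
    obtain ⟨σ₁, g1, g2, g3, g4⟩ := addr_exec h3' a h4' (.store (rtmp 1) (rtmp 0))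
    refine ⟨t + (t' + (1 + 5)), _, .seq h1 (.seq h1' (g4 _ _ (.store _ _ _))), ?_, ?_⟩
    · rw [g3]
      refine g1.put hM a hi ?_
      rw [g2 0 (by omega), h5' 0 (by omega), h4]
    · simp only [Stmt.cost, HState.put_time]; rw [mul_add]; omega
  | @output e f s he hf hi =>
    obtain ⟨t, σ', h1, h2, h3, h4, h5⟩ := compileE_correct hM f 0 σ hσ hf
    obtain ⟨t', σ'', h1', h2', h3', h4', h5'⟩ := compileE_correct hM e 1 σ' h3 he
    refine ⟨t + (t' + 1), _, .seq h1 (.seq h1' (.store _ _ _)), ?_, ?_⟩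
    · rw [eq_ofNat_of_toNat h4']
      refine h3'.output hM hi ?_
      rw [h5' 0 (by omega), h4]
    · simp only [Stmt.cost, HState.output_time]; rw [mul_add]; omega
  | @seq p q s s' s'' hp hq ihp ihq =>
    obtain ⟨t, σ', h1, h2, h3⟩ := ihp σ hσ
    obtain ⟨t', σ'', h1', h2', h3'⟩ := ihq σ' h2
    refine ⟨t + t', σ'', .seq h1 h1', h2', ?_⟩
    have e1 := Nat.mul_le_mul_left p.cost hq.time_le
    have e2 := Nat.mul_le_mul_left q.cost hp.time_le
    simp only [Stmt.cost, mul_add, add_mul, mul_one] at *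
    omega
  | @iteTrue e p q s s' he hne hp ih =>
    obtain ⟨t, σ', h1, h2, h3, h4, h5⟩ := compileE_correct hM e 0 σ hσ he
    obtain ⟨t', σ'', h1', h2', h3'⟩ := ih σ' h3
    refine ⟨t + (t' + 1), σ'', .seq h1 (.iteTrue ?_ h1'), h2', ?_⟩
    · simp only [Cmp.eval, BitVec.ult, h3.zero, h4]; simp; omega
    · have e1 := Nat.mul_le_mul_left e.cost hp.time_le
      have e2 := Nat.mul_le_mul_left q.cost hp.time_le
      have e3 := hp.time_le
      simp only [Stmt.cost, mul_add, add_mul, mul_one, one_mul] at *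
      omega
  | @iteFalse e p q s s' he hne hp ih =>
    obtain ⟨t, σ', h1, h2, h3, h4, h5⟩ := compileE_correct hM e 0 σ hσ he
    obtain ⟨t', σ'', h1', h2', h3'⟩ := ih σ' h3
    refine ⟨t + (t' + 1), σ'', .seq h1 (.iteFalse ?_ h1'), h2', ?_⟩
    · simp only [Cmp.eval, BitVec.ult, h3.zero, h4]; simp; omega
    · have e1 := Nat.mul_le_mul_left e.cost hp.time_le
      have e2 := Nat.mul_le_mul_left p.cost hp.time_le
      have e3 := hp.time_le
      simp only [Stmt.cost, mul_add, add_mul, mul_one, one_mul] at *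
      omega
  | @loopTrue e p s s' s'' he hne hp hq ihp ihq =>
    obtain ⟨t, σ', h1, h2, h3, h4, h5⟩ := compileE_correct hM e 0 σ hσ he
    obtain ⟨t', σ'', h1', h2', h3'⟩ := ihp σ' ⟨h3.zero, h3.base, h3.var, h3.arr, h3.io⟩
    obtain ⟨t'', σ₃, h1'', h2'', h3''⟩ := ihq σ'' h2'
    simp only [compile] at h1''
    -- The run of the compiled loop for the remaining iterations starts with an evaluation of the
    -- test; that evaluation is regrouped as the end of the present loop body.
    cases h1'' with
    | @seq _ _ _ σ₄ _ ta tb ha hb =>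
      refine ⟨t + ((t' + ta) + tb + 1), σ₃, .seq h1 (.loopTrue ?_ (.seq h1' ha) hb), h2'', ?_⟩
      · simp only [Cmp.eval, BitVec.ult, h3.zero, h4]; simp; omega
      · have e0 := hp.time_le
        have e1 := Nat.mul_le_mul_left e.cost e0
        have e2 := Nat.mul_le_mul_left p.cost hq.time_le
        simp only [HState.tick_time, Stmt.cost, mul_add, add_mul, mul_one, one_mul] at *
        omega
  | @loopFalse e p s he hne =>
    obtain ⟨t, σ', h1, h2, h3, h4, h5⟩ := compileE_correct hM e 0 σ hσ he
    refine ⟨t + 1, σ', .seq h1 (.loopFalse ?_), h3, ?_⟩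
    · simp only [Cmp.eval, BitVec.ult, h3.zero, h4]; simp; omega
    · simp only [Stmt.cost, mul_add, mul_one]; omega

end Compile

end Kangaroo

/-! ### Prefixes of a string, read backwards -/

namespace Kangaroo

/-- The order of the prefixes of the string `X 1, X 2, …`, read backwards: `plt X d e` says that
`X d, X (d - 1), …, X 1` comes before `X e, X (e - 1), …, X 1`. -/
def plt (X : ℕ → ℕ) : ℕ → ℕ → Prop
  | _, 0 => False
  | 0, _ + 1 => True
  | d + 1, e + 1 => X (d + 1) < X (e + 1) ∨ X (d + 1) = X (e + 1) ∧ plt X d e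

/-- The length of the longest common suffix of the prefixes of lengths `d` and `e`. -/
def lcs (X : ℕ → ℕ) : ℕ → ℕ → ℕ
  | 0, _ => 0
  | _ + 1, 0 => 0
  | d + 1, e + 1 => if X (d + 1) = X (e + 1) then lcs X d e + 1 else 0

section Order

variable {X : ℕ → ℕ}

@[simp] theorem plt_zero_right (d : ℕ) : ¬ plt X d 0 := by cases d <;> simp [plt]

theorem plt_zero_left {e : ℕ} (h : 0 < e) : plt X 0 e := by
  cases e with
  | zero => omega
  | succ e => simp [plt]

theorem plt_irrefl (d : ℕ) : ¬ plt X d d := by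
  induction d with
  | zero => simp
  | succ d ih => simp [plt, ih]

theorem plt_trans {a b c : ℕ} (h₁ : plt X a b) (h₂ : plt X b c) : plt X a c := by
  induction a generalizing b c with
  | zero =>
    cases c with
    | zero => simp at h₂
    | succ c => simp [plt]
  | succ a ih =>
    cases b with
    | zero => simp at h₁
    | succ b =>
      cases c with
      | zero => simp at h₂
      | succ c =>
        simp only [plt] at *
        rcases h₁ with h₁ | ⟨h₁, h₁'⟩ <;> rcases h₂ with h₂ | ⟨h₂, h₂'⟩
        · left; omega
        · left; omega
        · left; omega
        · right; exact ⟨by omega, ih h₁' h₂'⟩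

theorem plt_asymm {a b : ℕ} (h₁ : plt X a b) : ¬ plt X b a := fun h => plt_irrefl a (plt_trans h₁ h)

theorem plt_total {a b : ℕ} (h : a ≠ b) : plt X a b ∨ plt X b a := by
  induction a generalizing b with
  | zero => left; exact plt_zero_left (by omega)
  | succ a ih =>
    cases b with
    | zero => right; exact plt_zero_left (by omega)
    | succ b =>
      simp only [plt]
      rcases lt_trichotomy (X (a + 1)) (X (b + 1)) with h1 | h1 | h1
      · simp [h1]
      · rcases ih (b := b) (by omega) with h2 | h2 <;> simp [h1, h2]
      · simp [h1]

/-- Unfolds the recursion into agreement at positions counted back from the two ends, the form in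
which comparisons and jumps use it. -/
theorem le_lcs_iff {k d e : ℕ} :
    k ≤ lcs X d e ↔ k ≤ d ∧ k ≤ e ∧ ∀ i < k, X (d - i) = X (e - i) := by
  induction d generalizing k e with
  | zero =>
    simp only [lcs]
    constructor
    · intro h
      have : k = 0 := by omega
      subst this; simp
    · exact fun h => h.1
  | succ d ih =>
    cases e with
    | zero =>
      simp only [lcs]
      constructor
      · intro h
        have : k = 0 := by omega
        subst this; simp
      · exact fun h => h.2.1
    | succ e =>
      simp only [lcs]
      cases k with
      | zero => simp
      | succ k =>
        split_ifs with h
        · simp only [add_le_add_iff_right, ih]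
          refine and_congr_right fun _ => and_congr_right fun _ => ⟨fun hk i hi => ?_, fun hk i hi => ?_⟩
          · cases i with
            | zero => simpa using h
            | succ i => simpa using hk i (by omega)
          · simpa using hk (i + 1) (by omega)
        · constructor
          · omega
          · intro hk; exact absurd (by simpa using hk.2.2 0 (by omega)) h

theorem lcs_comm (d e : ℕ) : lcs X d e = lcs X e d := by
  refine eq_of_forall_le_iff fun k => ?_
  rw [le_lcs_iff, le_lcs_iff]
  constructor
  · rintro ⟨h1, h2, h3⟩; exact ⟨h2, h1, fun i hi => (h3 i hi).symm⟩
  · rintro ⟨h1, h2, h3⟩; exact ⟨h2, h1, fun i hi => (h3 i hi).symm⟩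

theorem lcs_zero_left (e : ℕ) : lcs X 0 e = 0 := by simp [lcs]

theorem lcs_le_left (d e : ℕ) : lcs X d e ≤ d := (le_lcs_iff.1 le_rfl).1

theorem plt_congr {Y : ℕ → ℕ} {d e : ℕ} (hd : ∀ i ≤ d, X i = Y i) (he : ∀ i ≤ e, X i = Y i) :
    plt X d e ↔ plt Y d e := by
  induction d generalizing e with
  | zero => cases e <;> simp [plt]
  | succ d ih =>
    cases e with
    | zero => simp
    | succ e =>
      simp only [plt]
      rw [hd _ le_rfl, he _ le_rfl, ih (fun i hi => hd i (by omega)) (fun i hi => he i (by omega))]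

/-- As in a dictionary: if the outer two of three sorted words agree on k letters, the middle one
shares these letters, and agreement of neighbours is transitive. -/
theorem lcs_eq_min {a b c : ℕ} (h₁ : plt X a b) (h₂ : plt X b c) :
    lcs X a c = min (lcs X a b) (lcs X b c) := by
  induction a generalizing b c with
  | zero => simp [lcs]
  | succ a ih =>
    cases b with
    | zero => simp at h₁
    | succ b =>
      cases c with
      | zero => simp at h₂
      | succ c =>
        simp only [plt, lcs] at *
        rcases h₁ with h₁ | ⟨h₁, h₁'⟩ <;> rcases h₂ with h₂ | ⟨h₂, h₂'⟩
        · simp [h₁.ne, h₂.ne, (h₁.trans h₂).ne]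
        · simp [h₁.ne, ← h₂]
        · simp [h₂.ne, h₁]
        · simp [h₁, h₂, ih h₁' h₂']

/-- A string with positive characters, followed backwards by zeros. -/
structure IsStr (X : ℕ → ℕ) (N : ℕ) : Prop where
  zero : X 0 = 0
  pos : ∀ d, 1 ≤ d → d ≤ N → 1 ≤ X d

/-- Since `X 0 = 0` is smaller than all characters and subtraction truncates at 0, the recursive
step is valid for empty prefixes too. No case distinction at the ends of words remains. -/
theorem IsStr.plt_iff {N : ℕ} (hX : IsStr X N) {d e : ℕ} (hd : d ≤ N) (he : e ≤ N) :
    plt X d e ↔ X d < X e ∨ X d = X e ∧ plt X (d - 1) (e - 1) := by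
  cases e with
  | zero =>
    simp only [plt_zero_right, false_iff, hX.zero]
    simp
  | succ e =>
    cases d with
    | zero => simpa [plt, hX.zero] using Or.inl (Nat.pos_of_ne_zero (by have := hX.pos (e + 1) (by omega) he; omega))
    | succ d => simp [plt]

/-- Comparison of two-digit numbers. -/
theorem digit_lt_iff {B a b a' b' : ℕ} (hb : b < B) (hb' : b' < B) :
    a * B + b < a' * B + b' ↔ a < a' ∨ a = a' ∧ b < b' := by
  constructor
  · intro h
    by_contra hcon
    push Not at hcon
    rcases hcon.1.lt_or_eq with h1 | h1
    · have : (a' + 1) * B ≤ a * B := Nat.mul_le_mul_right _ h1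
      rw [add_mul] at this; omega
    · subst h1
      have := hcon.2 rfl
      omega
  · rintro (h | ⟨rfl, h⟩)
    · have : (a + 1) * B ≤ a' * B := Nat.mul_le_mul_right _ h
      rw [add_mul] at this; omega
    · omega

theorem digit_eq_iff {B a b a' b' : ℕ} (hb : b < B) (hb' : b' < B) :
    a * B + b = a' * B + b' ↔ a = a' ∧ b = b' := by
  have h1 := @digit_lt_iff B a b a' b' hb hb'
  have h2 := @digit_lt_iff B a' b' a b hb' hb
  constructor
  · intro h
    rw [h] at h1
    rw [h] at h2
    simp only [lt_self_iff_false, false_iff] at h1 h2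
    push Not at h1 h2
    have ha : a = a' := by omega
    have := h1.2 ha
    have := h2.2 ha.symm
    omega
  · rintro ⟨rfl, rfl⟩; rfl

/-- The last three characters of the prefix of length `d`, as a number. -/
def triple (X : ℕ → ℕ) (B d : ℕ) : ℕ := (X d * B + X (d - 1)) * B + X (d - 2)

variable {N B : ℕ}

/-- Three recursive steps at once; a prefix shorter than three characters is padded by `X 0 = 0`. -/
theorem IsStr.plt_iff_triple (hX : IsStr X N) (hB : ∀ d ≤ N, X d < B) {d e : ℕ} (hd : d ≤ N)
    (he : e ≤ N) : plt X d e ↔ triple X B d < triple X B e ∨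
      triple X B d = triple X B e ∧ plt X (d - 3) (e - 3) := by
  have h1 := hB (d - 1) (by omega)
  have h2 := hB (d - 2) (by omega)
  have h3 := hB (e - 1) (by omega)
  have h4 := hB (e - 2) (by omega)
  rw [triple, triple, digit_lt_iff h2 h4, digit_lt_iff h1 h3, digit_eq_iff h2 h4,
    digit_eq_iff h1 h3, hX.plt_iff hd he, hX.plt_iff (d := d - 1) (by omega) (by omega),
    hX.plt_iff (d := d - 1 - 1) (by omega) (by omega)]
  simp only [Nat.sub_sub]
  norm_num
  tauto

/-- The position in the reduced string of the prefix length `d`, where `d % 3 ≠ 0`. -/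
def samplePos (N d : ℕ) : ℕ := if d % 3 = 1 then d / 3 + 1 else (N + 2) / 3 + d / 3 + 1

/-- The inverse of `samplePos`, shifted by one. -/
def sampleAt (N i : ℕ) : ℕ :=
  if i < (N + 2) / 3 then 3 * i + 1 else 3 * (i - (N + 2) / 3) + 2

theorem sampleAt_mod (i : ℕ) : sampleAt N i % 3 ≠ 0 := by
  unfold sampleAt; split_ifs <;> omega

theorem samplePos_sampleAt (i : ℕ) : samplePos N (sampleAt N i) = i + 1 := by
  unfold samplePos sampleAt; split_ifs <;> omega

theorem sampleAt_le {i : ℕ} (hi : i < N - N / 3) : sampleAt N i ≤ N := by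
  unfold sampleAt; split_ifs <;> omega

theorem sampleAt_pos (i : ℕ) : 1 ≤ sampleAt N i := by
  unfold sampleAt; split_ifs <;> omega

theorem sampleAt_samplePos {d : ℕ} (hd : d % 3 ≠ 0) (h : d ≤ N) :
    sampleAt N (samplePos N d - 1) = d := by
  unfold samplePos sampleAt; split_ifs <;> omega

theorem samplePos_le {d : ℕ} (hd : d % 3 ≠ 0) (h : d ≤ N) : samplePos N d ≤ N - N / 3 := by
  unfold samplePos; split_ifs <;> omega

theorem samplePos_pos (d : ℕ) : 1 ≤ samplePos N d := by
  unfold samplePos; split_ifs <;> omega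

/-- Three characters back in X is one position back in the reduced string, since each residue class
is listed in increasing order. -/
theorem samplePos_sub {d : ℕ} (h : 3 ≤ d) : samplePos N d - 1 = samplePos N (d - 3) := by
  unfold samplePos; split_ifs <;> omega

/-- The reduced string has the order of the sampled prefixes. -/
theorem plt_reduced (hX : IsStr X N) (hB : ∀ d ≤ N, X d < B) {Y : ℕ → ℕ}
    (hY : IsStr Y (N - N / 3))
    (hlt : ∀ i < N - N / 3, ∀ j < N - N / 3, Y (i + 1) < Y (j + 1) ↔
      triple X B (sampleAt N i) < triple X B (sampleAt N j))
    {d e : ℕ} (hd : d ≤ N) (he : e ≤ N) (hd3 : d % 3 ≠ 0) (he3 : e % 3 ≠ 0) :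
    plt X d e ↔ plt Y (samplePos N d) (samplePos N e) := by
  induction d using Nat.strong_induction_on generalizing e with
  | _ d ih =>
    have hYlt : ∀ a b, a ≤ N → b ≤ N → a % 3 ≠ 0 → b % 3 ≠ 0 →
        (Y (samplePos N a) < Y (samplePos N b) ↔ triple X B a < triple X B b) := by
      intro a b ha hb ha3 hb3
      have h1 := samplePos_le ha3 ha
      have h2 := samplePos_le hb3 hb
      have h3 := samplePos_pos (N := N) a
      have h4 := samplePos_pos (N := N) b
      have := hlt (samplePos N a - 1) (by omega) (samplePos N b - 1) (by omega)
      rwa [sampleAt_samplePos ha3 ha, sampleAt_samplePos hb3 hb, Nat.sub_add_cancel h3,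
        Nat.sub_add_cancel h4] at this
    have hYeq : Y (samplePos N d) = Y (samplePos N e) ↔ triple X B d = triple X B e := by
      have h1 := hYlt d e hd he hd3 he3
      have h2 := hYlt e d he hd he3 hd3
      omega
    rw [hX.plt_iff_triple hB hd he, hY.plt_iff (samplePos_le hd3 hd) (samplePos_le he3 he),
      hYlt d e hd he hd3 he3, hYeq]
    refine or_congr_right (and_congr_right fun heq => ?_)
    have h1 := hB (d - 1) (by omega)
    have h2 := hB (d - 2) (by omega)
    have h3 := hB (e - 1) (by omega)
    have h4 := hB (e - 2) (by omega)
    rw [triple, triple, digit_eq_iff h2 h4, digit_eq_iff h1 h3] at heq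
    obtain ⟨⟨-, h5⟩, h6⟩ := heq
    -- Equal triples have their zeros at the same places. So either both prefixes have length at
    -- least 3, or they have the same length 1 or 2. In particular a comparison is settled before it
    -- could run from the part of residue 2 into the part of residue 1, and no separator is needed.
    have key : ∀ a b : ℕ, a ≤ N → b ≤ N → X a = X b → a = 0 → b = 0 := by
      intro a b _ hb hab ha
      by_contra hcon
      have := hX.pos b (by omega) hb
      rw [ha, hX.zero] at hab
      omega
    have k1 := key (d - 1) (e - 1) (by omega) (by omega) h5
    have k2 := key (e - 1) (d - 1) (by omega) (by omega) h5.symm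
    have k3 := key (d - 2) (e - 2) (by omega) (by omega) h6
    have k4 := key (e - 2) (d - 2) (by omega) (by omega) h6.symm
    by_cases hd4 : 3 ≤ d
    · have he4 : 3 ≤ e := by omega
      rw [samplePos_sub hd4, samplePos_sub he4]
      exact ih (d - 3) (by omega) (by omega) (by omega) (by omega) (by omega)
    · have : d = e := by omega
      subst this
      simp [plt_irrefl]

end Order

/-- `v` is the minimum of `f` over the interval `[l, r)`. -/
def IsMin (f : ℕ → ℕ) (l r v : ℕ) : Prop :=
  (∃ i, l ≤ i ∧ i < r ∧ f i = v) ∧ ∀ i, l ≤ i → i < r → v ≤ f i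

section IsMin

variable {f : ℕ → ℕ}

theorem IsMin.single (i : ℕ) : IsMin f i (i + 1) (f i) :=
  ⟨⟨i, le_rfl, by omega, rfl⟩, fun j h1 h2 => by rw [show j = i by omega]⟩

theorem IsMin.union {l r l' r' v v' : ℕ} (h : IsMin f l r v) (h' : IsMin f l' r' v')
    (h1 : l ≤ l') (h2 : l' ≤ r) (h3 : r ≤ r') : IsMin f l r' (min v v') := by
  obtain ⟨⟨i, hi1, hi2, hi3⟩, hi⟩ := h
  obtain ⟨⟨j, hj1, hj2, hj3⟩, hj⟩ := h'
  refine ⟨?_, fun k hk1 hk2 => ?_⟩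
  · rcases le_total v v' with hv | hv
    · exact ⟨i, hi1, by omega, by omega⟩
    · exact ⟨j, by omega, by omega, by omega⟩
  · by_cases hk : k < r
    · have := hi k hk1 hk; omega
    · have := hj k (by omega) hk2; omega

theorem IsMin.unique {l r v v' : ℕ} (h : IsMin f l r v) (h' : IsMin f l r v') : v = v' := by
  obtain ⟨⟨i, hi1, hi2, hi3⟩, hi⟩ := h
  obtain ⟨⟨j, hj1, hj2, hj3⟩, hj⟩ := h'
  have := hi j hj1 hj2
  have := hj i hi1 hi2
  omega

theorem IsMin.congr {g : ℕ → ℕ} {l r v : ℕ} (h : IsMin f l r v)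
    (hfg : ∀ i, l ≤ i → i < r → g i = f i) : IsMin g l r v := by
  obtain ⟨⟨i, hi1, hi2, hi3⟩, hi⟩ := h
  exact ⟨⟨i, hi1, hi2, by rw [hfg i hi1 hi2, hi3]⟩, fun j h1 h2 => by
    rw [hfg j h1 h2]; exact hi j h1 h2⟩

end IsMin

/-- `S 1, …, S N` lists the prefixes in increasing order. -/
structure IsSA (X : ℕ → ℕ) (N : ℕ) (S : ℕ → ℕ) : Prop where
  zero : S 0 = 0
  pos : ∀ t, 1 ≤ t → t ≤ N → 1 ≤ S t
  le : ∀ t, 1 ≤ t → t ≤ N → S t ≤ N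
  chain : ∀ t, 1 ≤ t → t < N → plt X (S t) (S (t + 1))

/-! ### The sorted order of the prefixes -/

namespace IsSA

variable {X S : ℕ → ℕ} {N : ℕ}

theorem le' (h : IsSA X N S) {t : ℕ} (ht : t ≤ N) : S t ≤ N := by
  rcases Nat.eq_zero_or_pos t with rfl | h0
  · rw [h.zero]; omega
  · exact h.le t h0 ht

theorem chain' (h : IsSA X N S) {t : ℕ} (ht : t < N) : plt X (S t) (S (t + 1)) := by
  rcases Nat.eq_zero_or_pos t with rfl | h0
  · rw [h.zero]; exact plt_zero_left (h.pos 1 le_rfl ht)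
  · exact h.chain t h0 ht

theorem plt_of_lt (h : IsSA X N S) {a b : ℕ} (hab : a < b) (hb : b ≤ N) : plt X (S a) (S b) := by
  induction b with
  | zero => omega
  | succ b ih =>
    rcases Nat.lt_succ_iff_lt_or_eq.1 hab with h1 | rfl
    · exact plt_trans (ih h1 (by omega)) (h.chain' (by omega))
    · exact h.chain' (by omega)

theorem plt_iff (h : IsSA X N S) {a b : ℕ} (ha : a ≤ N) (hb : b ≤ N) :
    plt X (S a) (S b) ↔ a < b := by
  refine ⟨fun h1 => ?_, fun h1 => h.plt_of_lt h1 hb⟩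
  by_contra hcon
  rcases (not_lt.1 hcon).lt_or_eq with h2 | rfl
  · exact plt_asymm h1 (h.plt_of_lt h2 ha)
  · exact plt_irrefl _ h1

theorem inj (h : IsSA X N S) {a b : ℕ} (ha : a ≤ N) (hb : b ≤ N) (hab : S a = S b) : a = b := by
  by_contra hcon
  rcases lt_or_gt_of_ne hcon with h1 | h1
  · exact plt_irrefl _ (hab ▸ h.plt_of_lt h1 hb)
  · exact plt_irrefl _ (hab ▸ h.plt_of_lt h1 ha)

/-- Pigeonhole: the chain is strictly increasing, so N + 1 different values fill {0, …, N}. Hence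
`IsSA` need not demand a permutation. -/
theorem surj (h : IsSA X N S) {d : ℕ} (hd : d ≤ N) : ∃ t ≤ N, S t = d := by
  have := Finset.surj_on_of_inj_on_of_card_le (s := Finset.range (N + 1))
    (t := Finset.range (N + 1)) (fun t _ => S t)
    (fun t ht => by
      have := h.le' (t := t) (by simpa [Nat.lt_succ_iff] using ht)
      simp only [Finset.mem_range]; omega)
    (fun a b ha hb hab => h.inj (by simpa [Nat.lt_succ_iff] using ha)
      (by simpa [Nat.lt_succ_iff] using hb) hab) le_rfl d
    (by simp only [Finset.mem_range]; omega)
  obtain ⟨t, ht, h2⟩ := this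
  exact ⟨t, by simpa [Nat.lt_succ_iff] using ht, h2.symm⟩

theorem surj' (h : IsSA X N S) {d : ℕ} (hd : d ≤ N) (h1 : 1 ≤ d) : ∃ t, 1 ≤ t ∧ t ≤ N ∧ S t = d := by
  obtain ⟨t, ht, rfl⟩ := h.surj hd
  refine ⟨t, ?_, ht, rfl⟩
  by_contra hcon
  rw [show t = 0 by omega, h.zero] at h1
  omega

/-- The longest common suffix is the minimum over an interval of neighbours. -/
theorem lcs_isMin (h : IsSA X N S) {a b : ℕ} (hab : a < b) (hb : b ≤ N) :
    IsMin (fun t => lcs X (S (t - 1)) (S t)) (a + 1) (b + 1) (lcs X (S a) (S b)) := by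
  induction b with
  | zero => omega
  | succ b ih =>
    rcases Nat.lt_succ_iff_lt_or_eq.1 hab with h1 | rfl
    · have := (ih h1 (by omega)).union (IsMin.single (f := fun t => lcs X (S (t - 1)) (S t)) (b + 1))
        (by omega) (by omega) (by omega)
      simpa [lcs_eq_min (h.plt_of_lt h1 (by omega)) (h.chain' (show b < N by omega))] using this
    · exact IsMin.single (f := fun t => lcs X (S (t - 1)) (S t)) (a + 1)

/-- The key to Kasai's algorithm. If d and its predecessor end in the same character, dropping it
keeps their order, so some prefix before d − 1 shares one character less with it. The immediate
predecessor of d − 1 shares at least as much, by `lcs_eq_min`. If the last characters differ, the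
left side is 0. -/
theorem lcs_pred (h : IsSA X N S) {R : ℕ → ℕ} (hR : ∀ t ≤ N, R (S t) = t) {d : ℕ} (h1 : 1 ≤ d)
    (hd : d ≤ N) : lcs X d (S (R d - 1)) ≤ lcs X (d - 1) (S (R (d - 1) - 1)) + 1 := by
  obtain ⟨t, ht1, ht, rfl⟩ := h.surj' hd h1
  rw [hR t ht]
  have hp : plt X (S (t - 1)) (S t) := h.plt_of_lt (by omega) ht
  generalize hdd : S t = d at *
  generalize hee : S (t - 1) = e at *
  have hle : e ≤ N := by rw [← hee]; exact h.le' (by omega)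
  rcases Nat.eq_zero_or_pos e with rfl | he
  · rw [lcs_comm, lcs_zero_left]; omega
  obtain ⟨d, rfl⟩ : ∃ k, d = k + 1 := ⟨d - 1, by omega⟩
  obtain ⟨e, rfl⟩ : ∃ k, e = k + 1 := ⟨e - 1, by omega⟩
  simp only [plt, lcs, Nat.add_sub_cancel] at *
  split_ifs with heq
  · simp only [heq.symm, lt_self_iff_false, false_or, true_and, add_le_add_iff_right] at hp ⊢
    obtain ⟨a, ha, rfl⟩ := h.surj (d := d) (by omega)
    obtain ⟨b, hb, rfl⟩ := h.surj (d := e) (by omega)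
    rw [hR a ha]
    have hlt := (h.plt_iff hb ha).1 hp
    rcases (show b ≤ a - 1 by omega).lt_or_eq with h3 | rfl
    · rw [lcs_comm, lcs_eq_min (h.plt_of_lt h3 (by omega)) (h.plt_of_lt (show a - 1 < a by omega) ha),
        lcs_comm (S a)]
      exact min_le_right _ _
    · exact le_rfl
  · omega

end IsSA

end Kangaroo

/-! ### Radix sort -/

namespace Kangaroo

set_option linter.unusedSimpArgs false

inductive Var where
  | n | m | nq | tot | str
  | i | k | acc | tmp | len | base | dv
  | sz | red | lvl | off | c | pc | j | t | d | e | f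
  | h | b | pw | nb | p | bs
  | ip | cn | st | x | y | v
  | row | col | cnt | qx | qy | l | r | lb | rb | a
  deriving DecidableEq

instance : Fintype Var := Fintype.ofList
  [.n, .m, .nq, .tot, .str, .i, .k, .acc, .tmp, .len, .base, .dv, .sz, .red, .lvl, .off, .c, .pc,
    .j, .t, .d, .e, .f, .h, .b, .pw, .nb, .p, .bs, .ip, .cn, .st, .x, .y, .v, .row, .col, .cnt,
    .qx, .qy, .l, .r, .lb, .rb, .a] fun z => by cases z <;> simp

/-- The arrays indexed by `lev` exist twice, `false` for the string of characters and `true` for the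
string of window names. The other arrays are reused or shared. -/
inductive Arr where
  | list | code | cnt | tmp | X | lens | rs | sab | sa | nm | dict | lsb | pow | log
  | rk (lev : Bool) | hh (lev : Bool) | mask (lev : Bool) | sp (lev : Bool)
  deriving DecidableEq, Fintype

abbrev St := HState Var Arr
abbrev Ex := Expr Var Arr
abbrev Prog := Stmt Var Arr

/-! ### Stable counting sort as a permutation -/

section CountingSort

variable (key : ℕ → ℕ) (len : ℕ)

/-- The position of item `i` after sorting by `key`. -/
def sortPos (i : ℕ) : ℕ :=
  Nat.count (fun j => key j < key i) len + Nat.count (fun j => key j = key i) i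

variable {key len}

theorem count_lt_succ (k n : ℕ) : Nat.count (fun j => key j < k + 1) n =
    Nat.count (fun j => key j < k) n + Nat.count (fun j => key j = k) n := by
  induction n with
  | zero => simp
  | succ n ih =>
    simp only [Nat.count_succ, ih]
    split_ifs <;> omega

theorem count_lt_mono {k k' : ℕ} (h : k ≤ k') (n : ℕ) :
    Nat.count (fun j => key j < k) n ≤ Nat.count (fun j => key j < k') n := by
  induction n with
  | zero => simp
  | succ n ih =>
    simp only [Nat.count_succ]
    split_ifs <;> omega

theorem sortPos_lt {i j : ℕ} (hi : i < len)
    (h : key i < key j ∨ key i = key j ∧ i < j) : sortPos key len i < sortPos key len j := by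
  unfold sortPos
  rcases h with h | ⟨h, hij⟩
  · have h1 := count_lt_mono (key := key) (show key i + 1 ≤ key j from h) len
    rw [count_lt_succ] at h1
    have h2 : Nat.count (fun j => key j = key i) (i + 1) ≤ Nat.count (fun j => key j = key i) len :=
      Nat.count_monotone _ hi
    rw [Nat.count_succ] at h2
    simp only [if_true] at h2
    omega
  · rw [h]
    have h2 : Nat.count (fun l => key l = key j) (i + 1) ≤ Nat.count (fun l => key l = key j) j :=
      Nat.count_monotone _ hij
    rw [Nat.count_succ] at h2
    simp only [h, if_true] at h2
    omega

theorem sortPos_lt_len {i : ℕ} (hi : i < len) : sortPos key len i < len := by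
  unfold sortPos
  have h1 : Nat.count (fun j => key j = key i) (i + 1) ≤ Nat.count (fun j => key j = key i) len :=
    Nat.count_monotone _ hi
  rw [Nat.count_succ] at h1
  simp only [if_true] at h1
  have h2 := count_lt_succ (key := key) (key i) len
  have h3 := Nat.count_le (p := fun j => key j < key i + 1) (n := len)
  omega

theorem sortPos_inj {i j : ℕ} (hi : i < len) (hj : j < len)
    (h : sortPos key len i = sortPos key len j) : i = j := by
  by_contra hcon
  rcases lt_trichotomy (key i) (key j) with h1 | h1 | h1
  · have := sortPos_lt hi (Or.inl h1); omega
  · rcases lt_or_gt_of_ne hcon with h2 | h2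
    · have := sortPos_lt hi (Or.inr ⟨h1, h2⟩); omega
    · have := sortPos_lt hj (Or.inr ⟨h1.symm, h2⟩); omega
  · have := sortPos_lt hj (Or.inl h1); omega

/-- `sortPos` is injective from {0, …, len − 1} to itself, hence bijective; σ is its inverse, and
the order of the values follows from `sortPos_lt`. -/
theorem exists_sort (key : ℕ → ℕ) (len : ℕ) : ∃ σ : ℕ → ℕ,
    (∀ i < len, σ i < len ∧ sortPos key len (σ i) = i) ∧
    (∀ i j, i < j → j < len → key (σ i) < key (σ j) ∨ key (σ i) = key (σ j) ∧ σ i < σ j) := by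
  have hs : ∀ i, i < len → ∃ j, j < len ∧ sortPos key len j = i := by
    intro i hi
    obtain ⟨j, hj, h⟩ := Finset.surj_on_of_inj_on_of_card_le (s := Finset.range len)
      (t := Finset.range len) (fun t _ => sortPos key len t)
      (fun t ht => by simpa using sortPos_lt_len (by simpa using ht))
      (fun a b ha hb hab => sortPos_inj (by simpa using ha) (by simpa using hb) hab) le_rfl i
      (by simpa using hi)
    exact ⟨j, by simpa using hj, h.symm⟩
  choose! σ hσ using hs
  refine ⟨σ, hσ, fun i j hij hj => ?_⟩
  have h1 := hσ i (by omega)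
  have h2 := hσ j hj
  have hne : σ i ≠ σ j := fun h => by rw [h] at h1; omega
  by_contra hcon
  have : key (σ j) < key (σ i) ∨ key (σ j) = key (σ i) ∧ σ j < σ i := by omega
  have := sortPos_lt h2.1 this
  omega

end CountingSort

open Kangaroo.Expr Kangaroo.Stmt Var

variable {M : Mach}

def keyE : Ex := .arr .code (.arr .list i) / dv % base

/-- Prefix sums turn the frequencies into starting positions. During the fourth loop `cnt` holds for
every key the next free position, which for item i is `sortPos key l i`. -/
def sortPass : Prog :=
  (.set i 0 ;; .for i base (.put .cnt i 0)) ;;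
  (.set i 0 ;; .for i len (.set k keyE ;; .put .cnt k (.arr .cnt k + 1))) ;;
  (.set acc 0 ;; .set i 0 ;;
    .for i base (.set tmp (.arr .cnt i) ;; .put .cnt i acc ;; .set acc (acc + tmp))) ;;
  (.set i 0 ;; .for i len (.set k keyE ;; .put .tmp (.arr .cnt k) (.arr .list i) ;;
    .put .cnt k (.arr .cnt k + 1))) ;;
  (.set i 0 ;; .for i len (.put .list i (.arr .tmp i)))

/-- What the loops of `sortPass` assume and preserve. -/
structure SortPre (M : Mach) (s : St) (key : ℕ → ℕ) (l b : ℕ) : Prop where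
  len : s.var .len = l
  base : s.var .base = b
  hl : 4 * (l + b) + 4 < M.L
  list : ∀ i < l, s.arr .list i < M.L
  key : ∀ i < l, s.arr .code (s.arr .list i) / s.var .dv % s.var .base = key i

theorem SortPre.frame {s s' : St} {key : ℕ → ℕ} {l b : ℕ} (h : SortPre M s key l b)
    {p : Prog} (hf : Frame p s s') (h1 : p.wv .len = false) (h2 : p.wv .base = false)
    (h3 : p.wv .dv = false) (h4 : p.wa .list = false) (h5 : p.wa .code = false) :
    SortPre M s' key l b := by
  obtain ⟨g1, g2, g3, g4, g5⟩ := h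
  refine ⟨?_, ?_, g3, ?_, ?_⟩
  · rw [hf.var _ h1, g1]
  · rw [hf.var _ h2, g2]
  · rw [hf.arr _ h4]; exact g4
  · rw [hf.arr _ h4, hf.arr _ h5, hf.var _ h2, hf.var _ h3]; exact g5

theorem sortPass_spec {s : St} {key : ℕ → ℕ} {l b : ℕ} (h : SortPre M s key l b) (hb : 0 < b) :
    Run M sortPass s (fun s' => (∀ i < l, s'.arr .list (sortPos key l i) = s.arr .list i) ∧
      s'.time ≤ s.time + 3 * l + 2 * b) := by
  have hkb : ∀ i < l, key i < b := fun i hi => by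
    rw [← h.key i hi, h.base]; exact Nat.mod_lt _ hb
  have hL := h.hl
  refine Run.seq (R := fun s₁ => ((∀ k < b, s₁.arr .cnt k = 0) ∧ s₁.time ≤ s.time + b) ∧
    Frame _ s s₁) (Run.frame ?_) ?_
  · rw [run_seq, run_set]
    refine ⟨by simp; omega, ?_⟩
    refine (Run.for (fun k s' => ∀ j < k, s'.arr .cnt j = 0) 0 b 0 (by simp) (by omega) (by omega)
      (by simp) (fun s' hf => ?_) rfl ?_).mono ?_
    · simp [hf.var base rfl, h.base]
    · intro k s' _ hk hI hf hik
      rw [run_put]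
      simp only [eval_var, safe_var, eval_ofNat, safe_ofNat, HState.tick_var, hik, true_and]
      refine ⟨by omega, by omega, ?_, by simp⟩
      intro j hj
      simp only [HState.put_arr, HState.set_arr, if_true, HState.tick_arr, Function.update_apply]
      split_ifs with hjk
      · rfl
      · exact hI j (by omega)
    · rintro s' ⟨h1, -, h2⟩
      exact ⟨h1, by simpa using h2⟩
  rintro s₁ ⟨⟨hz, ht1⟩, hf1⟩
  have p1 := h.frame hf1 rfl rfl rfl rfl rfl
  refine Run.seq (R := fun s₂ => ((∀ k < b, s₂.arr .cnt k = Nat.count (fun j => key j = k) l) ∧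
    s₂.time ≤ s₁.time + l) ∧ Frame _ s₁ s₂) (Run.frame ?_) ?_
  · rw [run_seq, run_set]
    refine ⟨by simp; omega, ?_⟩
    refine (Run.for (fun k s' => ∀ j < b, s'.arr .cnt j = Nat.count (fun i => key i = j) k) 0 l 0
      (by simp) (by omega) (by omega) (by simpa using hz) (fun s' hf => ?_) rfl ?_).mono ?_
    · simp [hf.var len rfl, p1.len]
    · intro k s' _ hk hI hf hik
      have p2 := p1.list k hk
      have hkey := p1.key k hk
      have e1 : s'.arr .code = s₁.arr .code := hf.arr .code rfl
      have e2 : s'.arr .list = s₁.arr .list := hf.arr .list rfl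
      have e3 : s'.var .dv = s₁.var .dv := hf.var .dv rfl
      have e4 : s'.var .base = s₁.var .base := hf.var .base rfl
      have hc := Nat.count_le (p := fun i => key i = key k) (n := k)
      have hkk := hkb k hk
      rw [run_seq, run_set, run_put]
      simp [keyE, e1, e2, e3, e4, hik, hkey, hI _ hkk]
      refine ⟨by omega, by omega, by omega, ?_⟩
      intro j hj
      rw [Nat.count_succ, Function.update_apply]
      split_ifs with h1 h2 h2
      · rw [h1]
      · exact absurd h1.symm h2
      · exact absurd h2.symm h1
      · simp [hI j hj]
    · rintro s' ⟨h1, -, h2⟩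
      exact ⟨h1, by simpa using h2⟩
  rintro s₂ ⟨⟨hcnt, ht2⟩, hf2⟩
  have p2 := p1.frame hf2 rfl rfl rfl rfl rfl
  refine Run.seq (R := fun s₃ => ((∀ k < b, s₃.arr .cnt k = Nat.count (fun j => key j < k) l) ∧
    s₃.time ≤ s₂.time + b) ∧ Frame _ s₂ s₃) (Run.frame ?_) ?_
  · rw [run_seq, run_set]
    refine ⟨by simp; omega, ?_⟩
    rw [run_seq, run_set]
    refine ⟨by simp; omega, ?_⟩
    refine (Run.for (fun k s' => s'.var acc = Nat.count (fun j => key j < k) l ∧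
      (∀ j < k, s'.arr .cnt j = Nat.count (fun i => key i < j) l) ∧
      (∀ j < b, k ≤ j → s'.arr .cnt j = Nat.count (fun i => key i = j) l)) 0 b 0
      (by simp) (by omega) (by omega) (by simpa using hcnt) (fun s' hf => ?_) rfl ?_).mono ?_
    · simp [hf.var base rfl, p2.base]
    · rintro k s' _ hk ⟨hI1, hI2, hI3⟩ hf hik
      have h1 := count_lt_succ (key := key) k l
      have h2 := Nat.count_le (p := fun i => key i < k + 1) (n := l)
      rw [run_seq, run_set, run_seq, run_put, run_set]
      simp [hik, hI1, hI3 k hk le_rfl, h1, -Order.lt_add_one_iff]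
      and_intros
      any_goals omega
      · intro j hj
        rw [Function.update_apply]
        split_ifs with hjk
        · rw [hjk]
        · exact hI2 j (by omega)
      · intro j hj hkj
        rw [Function.update_of_ne (by omega)]
        exact hI3 j hj (by omega)
    · rintro s' ⟨⟨-, h1, -⟩, -, h2⟩
      exact ⟨h1, by simpa using h2⟩
  rintro s₃ ⟨⟨hst, ht3⟩, hf3⟩
  have p3 := p2.frame hf3 rfl rfl rfl rfl rfl
  refine Run.seq (R := fun s₄ => ((∀ i < l, s₄.arr .tmp (sortPos key l i) = s₃.arr .list i) ∧
    s₄.time ≤ s₃.time + l) ∧ Frame _ s₃ s₄) (Run.frame ?_) ?_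
  · rw [run_seq, run_set]
    refine ⟨by simp; omega, ?_⟩
    refine (Run.for (fun k s' => (∀ j < b, s'.arr .cnt j = Nat.count (fun i => key i < j) l +
        Nat.count (fun i => key i = j) k) ∧
      (∀ i < k, s'.arr .tmp (sortPos key l i) = s₃.arr .list i)) 0 l 0
      (by simp) (by omega) (by omega) (by simpa using hst) (fun s' hf => ?_) rfl ?_).mono ?_
    · simp [hf.var len rfl, p3.len]
    · rintro k s' _ hk ⟨hI1, hI2⟩ hf hik
      have p2 := p3.list k hk
      have hkey := p3.key k hk
      have e1 : s'.arr .code = s₃.arr .code := hf.arr .code rfl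
      have e2 : s'.arr .list = s₃.arr .list := hf.arr .list rfl
      have e3 : s'.var .dv = s₃.var .dv := hf.var .dv rfl
      have e4 : s'.var .base = s₃.var .base := hf.var .base rfl
      have hkk := hkb k hk
      have hpos := sortPos_lt_len (key := key) hk
      have hpe : Nat.count (fun i => key i < key k) l +
        Nat.count (fun i => key i = key k) k = sortPos key l k := rfl
      rw [run_seq, run_set, run_seq, run_put, run_put]
      simp [keyE, e1, e2, e3, e4, hik, hkey, hI1 _ hkk, hpe]
      and_intros
      any_goals omega
      · intro j hj
        rw [Nat.count_succ, Function.update_apply]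
        split_ifs with h1 h2 h2
        · rw [h1, ← hpe]; ring
        · exact absurd h1.symm h2
        · exact absurd h2.symm h1
        · simp [hI1 j hj]
      · intro j hj
        rw [Function.update_apply]
        split_ifs with h1
        · rw [sortPos_inj (by omega) hk h1]
        · refine hI2 j (lt_of_le_of_ne (by omega) ?_)
          rintro rfl
          exact h1 rfl
    · rintro s' ⟨⟨-, h1⟩, -, h2⟩
      exact ⟨h1, by simpa using h2⟩
  rintro s₄ ⟨⟨htmp, ht4⟩, hf4⟩
  have p4 := p3.frame hf4 rfl rfl rfl rfl rfl
  have e4 : s₃.arr .list = s.arr .list := by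
    rw [hf3.arr .list rfl, hf2.arr .list rfl, hf1.arr .list rfl]
  rw [run_seq, run_set]
  refine ⟨by simp; omega, ?_⟩
  refine (Run.for (fun k s' => ∀ j < k, s'.arr .list j = s₄.arr .tmp j) 0 l 0
    (by simp) (by omega) (by omega) (by simp) (fun s' hf => ?_) rfl ?_).mono ?_
  · simp [hf.var len rfl, p4.len]
  · intro k s' _ hk hI hf hik
    have e1 : s'.arr .tmp = s₄.arr .tmp := hf.arr .tmp rfl
    rw [run_put]
    simp [hik, e1]
    refine ⟨by omega, ?_⟩
    intro j hj
    rw [Function.update_apply]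
    split_ifs with h1
    · rw [h1]
    · exact hI j (by omega)
  · rintro s' ⟨h1, -, h2⟩
    simp at h2
    refine ⟨fun i hi => ?_, by omega⟩
    rw [h1 _ (sortPos_lt_len hi), htmp i hi, e4]

/-- The list `f'` is a rearrangement of the list `f`. -/
def IsPerm (l : ℕ) (f f' : ℕ → ℕ) : Prop :=
  ∃ σ : ℕ → ℕ, (∀ i < l, σ i < l) ∧ (∀ i < l, ∀ j < l, σ i = σ j → i = j) ∧
    ∀ i < l, f' i = f (σ i)

theorem IsPerm.trans {l : ℕ} {f f' f'' : ℕ → ℕ} (h : IsPerm l f f') (h' : IsPerm l f' f'') :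
    IsPerm l f f'' := by
  obtain ⟨σ, h1, h2, h3⟩ := h
  obtain ⟨τ, h4, h5, h6⟩ := h'
  exact ⟨σ ∘ τ, fun i hi => h1 _ (h4 i hi), fun i hi j hj hij =>
    h5 i hi j hj (h2 _ (h4 i hi) _ (h4 j hj) hij), fun i hi => by
    rw [h6 i hi, h3 _ (h4 i hi)]; rfl⟩

theorem IsPerm.forall {l : ℕ} {f f' : ℕ → ℕ} (h : IsPerm l f f') {P : ℕ → Prop}
    (hP : ∀ i < l, P (f i)) : ∀ i < l, P (f' i) := by
  obtain ⟨σ, h1, h2, h3⟩ := h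
  intro i hi
  rw [h3 i hi]
  exact hP _ (h1 i hi)

theorem IsPerm.inj {l : ℕ} {f f' : ℕ → ℕ} (h : IsPerm l f f')
    (hf : ∀ i < l, ∀ j < l, f i = f j → i = j) : ∀ i < l, ∀ j < l, f' i = f' j → i = j := by
  obtain ⟨σ, h1, h2, h3⟩ := h
  intro i hi j hj hij
  rw [h3 i hi, h3 j hj] at hij
  exact h2 i hi j hj (hf _ (h1 i hi) _ (h1 j hj) hij)

theorem IsPerm.surj {l : ℕ} {f f' : ℕ → ℕ} (h : IsPerm l f f') {i : ℕ} (hi : i < l) :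
    ∃ j < l, f' j = f i := by
  obtain ⟨σ, h1, h2, h3⟩ := h
  obtain ⟨j, hj, h4⟩ := Finset.surj_on_of_inj_on_of_card_le (s := Finset.range l)
    (t := Finset.range l) (fun t _ => σ t)
    (fun t ht => by simpa using h1 t (by simpa using ht))
    (fun a b ha hb hab => h2 a (by simpa using ha) b (by simpa using hb) hab) le_rfl i
    (by simpa using hi)
  exact ⟨j, by simpa using hj, by rw [h3 j (by simpa using hj), h4]⟩

/-- A round of radix sort, least significant digit first: x % (D * b) is the digit x / D % b in
front of x % D, and stability preserves the order by x % D among equal digits. -/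
theorem sortPass_mod {s : St} {l b D : ℕ} (hlen : s.var .len = l) (hbase : s.var .base = b)
    (hL : 4 * (l + b) + 4 < M.L) (hlist : ∀ i < l, s.arr .list i < M.L) (hb : 0 < b)
    (hdv : s.var .dv = D)
    (hD : ∀ i j, i < j → j < l →
      s.arr .code (s.arr .list i) % D ≤ s.arr .code (s.arr .list j) % D) :
    Run M sortPass s (fun s' => (IsPerm l (s.arr .list) (s'.arr .list) ∧
      (∀ i j, i < j → j < l →
        s.arr .code (s'.arr .list i) % (D * b) ≤ s.arr .code (s'.arr .list j) % (D * b)) ∧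
      s'.time ≤ s.time + 3 * l + 2 * b) ∧ Frame sortPass s s') := by
  refine Run.frame ((sortPass_spec (key := fun i => s.arr .code (s.arr .list i) / D % b)
    ⟨hlen, hbase, hL, hlist, fun i _ => by rw [hdv, hbase]⟩ hb).mono ?_)
  rintro s' ⟨h1, h2⟩
  obtain ⟨σ, h3, h4⟩ := exists_sort (fun i => s.arr .code (s.arr .list i) / D % b) l
  have h5 : ∀ i < l, s'.arr .list i = s.arr .list (σ i) := fun i hi => by
    rw [← h1 _ (h3 i hi).1, (h3 i hi).2]
  refine ⟨⟨σ, fun i hi => (h3 i hi).1, fun i hi j hj hij => ?_, h5⟩, fun i j hij hj => ?_, h2⟩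
  · rw [← (h3 i hi).2, ← (h3 j hj).2, hij]
  · rw [h5 i (by omega), h5 j hj, Nat.mod_mul, Nat.mod_mul]
    rcases h4 i j hij hj with h6 | ⟨h6, h7⟩
    · have h8 := Nat.mul_le_mul_left D (show _ + 1 ≤ _ from h6)
      rw [mul_add, mul_one] at h8
      have h9 : D ≠ 0 := by
        rintro rfl; simp at h6
      have := Nat.mod_lt (s.arr .code (s.arr .list (σ i))) (Nat.pos_of_ne_zero h9)
      omega
    · have := hD (σ i) (σ j) h7 (h3 j hj).1
      rw [h6]
      omega

/-- The place values are 1, b and b², one for each character of a triple. -/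
def sortCode : Prog :=
  (.set dv 1 ;; sortPass) ;; (.set dv (dv * base) ;; sortPass) ;; (.set dv (dv * base) ;; sortPass)

theorem sortCode_spec {s : St} {l b : ℕ} (hlen : s.var .len = l) (hbase : s.var .base = b)
    (hL : 4 * (l + b) + 4 < M.L) (hbL : b * b < M.L) (hlist : ∀ i < l, s.arr .list i < M.L)
    (hb : 0 < b) (hc : ∀ i < l, s.arr .code (s.arr .list i) < b * b * b) :
    Run M sortCode s (fun s' => (IsPerm l (s.arr .list) (s'.arr .list) ∧
      (∀ i j, i < j → j < l →
        s.arr .code (s'.arr .list i) ≤ s.arr .code (s'.arr .list j)) ∧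
      s'.time ≤ s.time + 9 * l + 6 * b) ∧ Frame sortCode s s') := by
  refine Run.frame ?_
  rw [sortCode, run_seq, run_seq, run_set]
  refine ⟨by simp; omega, ?_⟩
  refine (sortPass_mod (D := 1) (by simpa) (by simpa) hL (by simpa) hb (by simp)
    (by simp [Nat.mod_one])).mono ?_
  rintro s₁ ⟨⟨hp1, hs1, ht1⟩, hf1⟩
  have a1 : s₁.arr .code = s.arr .code := hf1.arr .code rfl
  simp only [eval_ofNat, HState.set_arr, HState.set_time, one_mul] at hp1 hs1 ht1
  rw [run_seq, run_seq, run_set]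
  have v1 : s₁.var dv = 1 := by rw [hf1.var dv rfl]; simp
  have v2 : s₁.var base = b := by rw [hf1.var base rfl]; simpa
  have v3 : s₁.var len = l := by rw [hf1.var len rfl]; simpa
  refine ⟨by simp [v1, v2]; omega, ?_⟩
  refine (sortPass_mod (D := b) (by simpa) (by simpa) hL
    (by simpa using hp1.forall (P := fun x => x < M.L) hlist) hb
    (by simp [v1, v2]) (by simpa [a1] using hs1)).mono ?_
  rintro s₂ ⟨⟨hp2, hs2, ht2⟩, hf2⟩
  have a2 : s₂.arr .code = s₁.arr .code := hf2.arr .code rfl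
  simp only [HState.set_arr, HState.set_time, a1] at hp2 hs2 ht2
  have v1' : s₂.var dv = b := by rw [hf2.var dv rfl]; simp [v1, v2]
  have v2' : s₂.var base = b := by rw [hf2.var base rfl]; simpa
  have v3' : s₂.var len = l := by rw [hf2.var len rfl]; simpa
  have hp12 := hp1.trans hp2
  rw [run_seq, run_set]
  refine ⟨by simp [v1', v2']; omega, ?_⟩
  refine (sortPass_mod (D := b * b) (by simpa) (by simpa) hL
    (by simpa using hp12.forall (P := fun x => x < M.L) hlist) hb
    (by simp [v1', v2']) (by simpa [a1, a2] using hs2)).mono ?_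
  rintro s₃ ⟨⟨hp3, hs3, ht3⟩, hf3⟩
  simp only [HState.set_arr, HState.set_time, a1, a2] at hp3 hs3 ht3
  have hp := hp12.trans hp3
  refine ⟨hp, fun i j hij hj => ?_, by omega⟩
  have := hs3 i j hij hj
  have hc' := hp.forall (P := fun x => s.arr .code x < b * b * b) hc
  rwa [Nat.mod_eq_of_lt (hc' i (by omega)), Nat.mod_eq_of_lt (hc' j hj)] at this

/-! ### Suffix sorting: reduction to the sampled positions -/

theorem digit_lt {a b A B : ℕ} (ha : a < A) (hb : b < B) : a * B + b < A * B := by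
  have : (a + 1) * B ≤ A * B := Nat.mul_le_mul_right _ ha
  rw [add_mul] at this; omega

/-- The string of the current level, which starts behind the offset `o`. -/
def strAt (s : St) (o : ℕ) : ℕ → ℕ := fun d => s.arr .X (o + d)

/-- Item i + 1 is the prefix `sampleAt N i`, so the items are numbered like the positions of the
reduced string, where 0 is the sentinel. -/
def sampleCodes : Prog :=
  .set i 0 ;; .for i len (
    .ite (.lt i ((sz + 2) / 3)) (.set d (3 * i + 1)) (.set d (3 * (i - (sz + 2) / 3) + 2)) ;;
    .put .list i (i + 1) ;;
    .put .code (i + 1) ((.arr .X (off + d) * base + .arr .X (off + (d - 1))) * base +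
      .arr .X (off + (d - 2))))

theorem sampleCodes_spec {s : St} {N o l : ℕ} (hsz : s.var sz = N) (ho : s.var off = o)
    (hl : s.var len = l) (hbase : s.var base = N + 1) (hlN : l = N - N / 3)
    (hX : ∀ d ≤ N, strAt s o d < N + 1)
    (hL : (N + 1) * (N + 1) * (N + 1) + o + 3 * N + 10 < M.L) :
    Run M sampleCodes s (fun s' => ((∀ i < l, s'.arr .list i = i + 1) ∧
      (∀ i < l, s'.arr .code (i + 1) = triple (strAt s o) (N + 1) (sampleAt N i)) ∧
      s'.time ≤ s.time + l) ∧ Frame sampleCodes s s') := by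
  refine Run.frame ?_
  rw [sampleCodes, run_seq, run_set]
  refine ⟨by simp; omega, ?_⟩
  refine (Run.for (fun k s' => (∀ i < k, s'.arr .list i = i + 1) ∧
      (∀ i < k, s'.arr .code (i + 1) = triple (strAt s o) (N + 1) (sampleAt N i))) 0 l 0
      (by simp) (by omega) (by omega) (by simp) (fun s' hf => ?_) rfl ?_).mono ?_
  · simp [hf.var len rfl, hl]
  · rintro k s' _ hk ⟨h1, h2⟩ hf hik
    have e1 : s'.arr .X = s.arr .X := by rw [hf.arr .X rfl]; simp
    have e2 : s'.var sz = N := by rw [hf.var sz rfl]; simpa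
    have e3 : s'.var off = o := by rw [hf.var off rfl]; simpa
    have e4 : s'.var base = N + 1 := by rw [hf.var base rfl]; simpa
    refine Run.seq (R := fun s₁ => s₁ = s'.tick.set d (sampleAt N k)) ?_ ?_
    · rw [run_ite, run_set, run_set]
      by_cases hk' : k < (N + 2) / 3 <;> simp [hik, e2, hk', sampleAt] <;> omega
    rintro s₁ rfl
    have h3 : sampleAt N k ≤ N := sampleAt_le (by omega)
    have x0 := hX _ h3
    have x1 := hX (sampleAt N k - 1) (by omega)
    have x2 := hX (sampleAt N k - 2) (by omega)
    have t2 := digit_lt x0 x1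
    have t1 := digit_lt t2 x2
    rw [run_seq, run_put, run_put]
    simp only [strAt] at x0 x1 x2 t1 t2
    simp [hik, e1, e3, e4]
    have t3 := Nat.le_mul_of_pos_right ((N + 1) * (N + 1)) (show 0 < N + 1 by omega)
    and_intros
    any_goals omega
    · intro j hj
      rw [Function.update_apply]
      split_ifs with hjk
      · rw [hjk]
      · exact h1 j (by omega)
    · intro j hj
      rw [Function.update_apply]
      split_ifs with hjk
      · rw [show j = k by omega]; rfl
      · exact h2 j (by omega)
  · rintro s' ⟨h1, -, h2⟩
    exact ⟨h1.1, h1.2, by simpa using h2⟩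

/-- In the sorted list equal codes are adjacent, so counting the changes of code ranks them. The
ranks are written straight into the place of the reduced string. The previous code starts as 0,
which is no code, so the first rank is 1. -/
def naming : Prog :=
  .set pc 0 ;; .set c 0 ;; .put .X (off + str) 0 ;; .set i 0 ;; .for i len (
    .set e (.arr .list i) ;;
    .set c (c + (1 - .eq (.arr .code e) pc)) ;;
    .set pc (.arr .code e) ;;
    .put .X (off + str + e) c)

theorem naming_spec {s : St} {o S l : ℕ} (ho : s.var off = o) (hS : s.var str = S)
    (hl : s.var len = l)
    (hperm : IsPerm l (fun i => i + 1) (s.arr .list))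
    (hpos : ∀ i < l, 1 ≤ s.arr .code (i + 1))
    (hsort : ∀ i j, i < j → j < l →
        s.arr .code (s.arr .list i) ≤ s.arr .code (s.arr .list j))
    (hL : o + S + 2 * l + 10 < M.L) :
    Run M naming s (fun s' => (
      (strAt s' (o + S) 0 = 0 ∧ (∀ i < l, 1 ≤ strAt s' (o + S) (i + 1)) ∧
      (∀ i < l, strAt s' (o + S) (i + 1) ≤ l) ∧
      (∀ i < l, ∀ j < l, strAt s' (o + S) (i + 1) < strAt s' (o + S) (j + 1) ↔
        s.arr .code (i + 1) < s.arr .code (j + 1)) ∧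
      (∀ x < o + S, s'.arr .X x = s.arr .X x) ∧
      s'.time ≤ s.time + l)) ∧ Frame naming s s') := by
  refine Run.frame ?_
  have hpos' := hperm.forall (P := fun x => 1 ≤ s.arr .code x) hpos
  have hle' : ∀ i < l, 1 ≤ s.arr .list i ∧ s.arr .list i ≤ l :=
    hperm.forall (P := fun x => 1 ≤ x ∧ x ≤ l) (fun i hi => by omega)
  have hinj := hperm.inj (fun i _ j _ h => by omega)
  rw [naming, run_seq, run_set, run_seq, run_set, run_seq, run_put, run_seq, run_set]
  simp only [eval_add, eval_var, safe_add, safe_var, eval_ofNat, safe_ofNat, HState.set_var,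
    ho, hS, reduceCtorEq, if_false, true_and]
  refine ⟨by omega, by omega, by omega, by omega, by omega, by omega, ?_⟩
  -- `c` and `pc` are the name and the code of the last item handled, or both 0 at the start. Every
  -- handled item compares with `c` by name exactly as with `pc` by code, which is what the next
  -- item needs.
  refine (Run.for (fun k s' => strAt s' (o + S) 0 = 0 ∧
      (∀ i < k, 1 ≤ strAt s' (o + S) (s.arr .list i) ∧
        strAt s' (o + S) (s.arr .list i) ≤ s'.var c ∧
        s.arr .code (s.arr .list i) ≤ s'.var pc ∧
        (strAt s' (o + S) (s.arr .list i) < s'.var c ↔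
          s.arr .code (s.arr .list i) < s'.var pc)) ∧
      (∀ i < k, ∀ j < k, strAt s' (o + S) (s.arr .list i) < strAt s' (o + S) (s.arr .list j) ↔
        s.arr .code (s.arr .list i) < s.arr .code (s.arr .list j)) ∧
      s'.var c ≤ k ∧ (∀ j, k ≤ j → j < l → s'.var pc ≤ s.arr .code (s.arr .list j)) ∧
      (s'.var c = 0 → s'.var pc = 0) ∧
      (∀ x < o + S, s'.arr .X x = s.arr .X x)) 0 l 0
      (by simp) (by omega) (by omega) ?_ (fun s' hf => ?_) rfl ?_).mono ?_
  · simp only [strAt, HState.set_var, HState.set_arr, HState.put_var, HState.put_arr]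
    simp
    intro x hx
    rw [Function.update_of_ne (by omega)]
  · simp [hf.var len rfl, hl]
  · rintro k s' _ hk ⟨h1, h2, h3, h4, h5, h6, h7⟩ hf hik
    have e1 : s'.arr .list = s.arr .list := by rw [hf.arr .list rfl]; simp
    have e2 : s'.arr .code = s.arr .code := by rw [hf.arr .code rfl]; simp
    have e3 : s'.var off = o := by rw [hf.var off rfl]; simpa
    have e4 : s'.var str = S := by rw [hf.var str rfl]; simpa
    have g1 := hle' k hk
    have g2 := hpos' k hk
    have g3 := h5 k le_rfl hk
    have hcode : s.arr .list k < M.L := by omega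
    rw [run_seq, run_set, run_seq, run_set, run_seq, run_set, run_put]
    simp only [eval_add, eval_var, safe_add, safe_var, eval_ofNat, safe_ofNat, HState.set_var,
      HState.tick_var, HState.set_arr, HState.tick_arr, eval_arr, safe_arr, eval_sub, safe_sub,
      eval_eq, safe_eq, hik, e1, e2, e3, e4, reduceCtorEq, if_false, true_and, and_true, if_true]
    set c' := s'.var c + (1 - if s.arr .code (s.arr .list k) = s'.var pc then 1 else 0) with hc'
    have hc1 : s'.var c ≤ c' ∧ c' ≤ s'.var c + 1 ∧ (s'.var c < c' ↔
        s'.var pc < s.arr .code (s.arr .list k)) := by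
      rw [hc']; split_ifs <;> omega
    have hY : ∀ x, strAt ((((((s'.tick.set e (s.arr .list k)).set c c').set pc
        (s.arr .code (s.arr .list k))).put .X (o + S + s.arr .list k) c').set i (k + 1))) (o + S) x
        = if x = s.arr .list k then c' else strAt s' (o + S) x := by
      intro x
      simp [strAt, Function.update_apply]
    refine ⟨by omega, by omega, by omega, by omega, by omega, ⟨?_, ?_, ?_, ?_, ?_, ?_, ?_⟩, ?_⟩
    · rw [hY, if_neg (by omega)]; exact h1
    · intro i hi
      rw [hY]
      simp only [HState.set_var, HState.put_var, reduceCtorEq, if_false, if_true]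
      by_cases hik' : i = k
      · subst hik'
        rw [if_pos rfl]; omega
      · rw [if_neg (fun h => hik' (hinj i (by omega) k hk h))]
        have := h2 i (by omega)
        omega
    · intro i hi j hj
      rw [hY, hY]
      by_cases hik' : i = k
      · subst hik'
        rw [if_pos rfl]
        by_cases hjk' : j = i
        · subst hjk'; simp
        · rw [if_neg (fun h => hjk' (hinj j (by omega) i hk h))]
          have := h2 j (by omega)
          omega
      · rw [if_neg (fun h => hik' (hinj i (by omega) k hk h))]
        have := h2 i (by omega)
        by_cases hjk' : j = k
        · subst hjk'
          rw [if_pos rfl]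
          omega
        · rw [if_neg (fun h => hjk' (hinj j (by omega) k hk h))]
          exact h3 i (by omega) j (by omega)
    · simp; omega
    · intro j hj hjl
      simp only [HState.set_var, HState.put_var, reduceCtorEq, if_false, if_true]
      exact hsort k j (by omega) hjl
    · simp only [HState.set_var, HState.put_var, reduceCtorEq, if_false, if_true]
      intro h; omega
    · intro x hx
      simp only [HState.put_arr, HState.set_arr, HState.tick_arr, if_true]
      rw [Function.update_of_ne (by omega)]
      exact h7 x hx
    · simp
  · rintro s' ⟨⟨h1, h2, h3, h4, h5, h6, h7⟩, -, h8⟩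
    refine ⟨h1, fun i hi => ?_, fun i hi => ?_, fun i hi j hj => ?_, h7, by simpa using h8⟩
    · obtain ⟨j, hj, hji⟩ := hperm.surj hi
      have := h2 j hj
      rw [hji] at this; exact this.1
    · obtain ⟨j, hj, hji⟩ := hperm.surj hi
      have := h2 j hj
      rw [hji] at this; exact this.2.1.trans h4
    · obtain ⟨i', hi', hi''⟩ := hperm.surj hi
      obtain ⟨j', hj', hj''⟩ := hperm.surj hj
      have := h3 i' hi' j' hj'
      rwa [hi'', hj''] at this

/-- One step of the recursion: the string of the next level is stored behind the current one. -/
def descend : Prog :=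
  (.set red (sz - sz / 3) ;; .set base (sz + 1) ;; .set len red) ;; sampleCodes ;; sortCode ;;
  naming ;; .put .lens lvl sz ;; .set lvl (lvl + 1) ;; .set off (off + str) ;; .set sz red

/-- The reduced string is no longer than N − N/3 and its characters are ranks, so it satisfies the
same hypotheses. The cube in `hL` accommodates codes of three digits to base N + 1. The three loops
take 11 (N − N/3) + 6 (N + 1) iterations, at most 19 N as N ≥ 3. -/
theorem descend_spec {s : St} {N o S : ℕ} (hsz : s.var sz = N) (ho : s.var off = o)
    (hS : s.var str = S) (hN : 3 ≤ N)
    (hX : IsStr (strAt s o) N) (hXN : ∀ d ≤ N, strAt s o d ≤ N)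
    (hL : (N + 1) * (N + 1) * (N + 1) + o + S + 9 * N + s.var lvl + 10 < M.L) :
    Run M descend s (fun s' => (IsStr (strAt s' (o + S)) (N - N / 3) ∧
      (∀ d ≤ N - N / 3, strAt s' (o + S) d ≤ N - N / 3) ∧
      (∀ d e, d ≤ N → e ≤ N → d % 3 ≠ 0 → e % 3 ≠ 0 →
        (plt (strAt s o) d e ↔ plt (strAt s' (o + S)) (samplePos N d) (samplePos N e))) ∧
      (∀ x < o + S, s'.arr .X x = s.arr .X x) ∧
      s'.arr .lens = Function.update (s.arr .lens) (s.var lvl) N ∧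
      s'.var lvl = s.var lvl + 1 ∧ s'.var off = o + S ∧ s'.var sz = N - N / 3 ∧
      s'.time ≤ s.time + 19 * N) ∧ Frame descend s s') := by
  refine Run.frame ?_
  rw [descend]
  refine Run.seq (R := fun s₁ => s₁ = ((s.set red (N - N / 3)).set base (N + 1)).set len (N - N / 3))
    ?_ ?_
  · rw [run_seq, run_set, run_seq, run_set, run_set]
    simp [hsz]; omega
  rintro s₁ rfl
  refine Run.seq (sampleCodes_spec (N := N) (o := o) (l := N - N / 3) (by simpa) (by simpa)
    (by simp) (by simp) rfl
    (by intro d hd; have := hXN d hd; simp only [strAt, HState.set_arr] at *; omega)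
    (by omega)) ?_
  rintro s₂ ⟨⟨h1, h2, ht2⟩, hf2⟩
  have hl2 : s₂.var len = N - N / 3 := by rw [hf2.var len rfl]; simp
  have hb2 : s₂.var base = N + 1 := by rw [hf2.var base rfl]; simp
  have hXe : ∀ t : St, t.arr .X = s.arr .X → ∀ o, strAt t o = strAt s o := fun t ht o => by
    funext d; simp only [strAt, ht]
  rw [hXe _ (by simp)] at h2
  have hB : ∀ d ≤ N, strAt s o d < N + 1 := fun d hd => by have := hXN d hd; omega
  have t0 : N + 1 ≤ (N + 1) * (N + 1) := Nat.le_mul_of_pos_right _ (by omega)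
  have t3 := Nat.le_mul_of_pos_right ((N + 1) * (N + 1)) (show 0 < N + 1 by omega)
  refine Run.seq (sortCode_spec (l := N - N / 3) (b := N + 1) hl2 hb2 (by omega) (by omega)
    (fun i hi => by rw [h1 i hi]; omega) (by omega) (fun i hi => ?_)) ?_
  · rw [h1 i hi, h2 i hi]
    exact digit_lt (digit_lt (hB _ (sampleAt_le hi)) (hB _ ((Nat.sub_le _ _).trans (sampleAt_le hi))))
      (hB _ ((Nat.sub_le _ _).trans (sampleAt_le hi)))
  rintro s₃ ⟨⟨h3, h4, ht3⟩, hf3⟩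
  have e3 : s₃.arr .code = s₂.arr .code := hf3.arr .code rfl
  rw [← e3] at h4 h2
  have hXe3 : s₃.arr .X = s.arr .X := by rw [hf3.arr .X rfl, hf2.arr .X rfl]; simp
  refine Run.seq (naming_spec (o := o) (S := S) (l := N - N / 3) ?_ ?_ ?_ ?_ (fun i hi => ?_) h4
    (by omega)) ?_
  · rw [hf3.var off rfl, hf2.var off rfl]; simpa
  · rw [hf3.var str rfl, hf2.var str rfl]; simpa
  · rw [hf3.var len rfl, hl2]
  · obtain ⟨σ, g1, g2, g3⟩ := h3
    exact ⟨σ, g1, g2, fun i hi => by rw [g3 i hi, h1 _ (g1 i hi)]⟩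
  · rw [h2 i hi]
    have := hX.pos _ (sampleAt_pos (N := N) i) (sampleAt_le hi)
    exact Nat.add_pos_left (Nat.mul_pos (Nat.add_pos_left (Nat.mul_pos this (Nat.succ_pos _)) _)
      (Nat.succ_pos _)) _
  rintro s₄ ⟨⟨k1, k2, k3, k4, k5, ht4⟩, hf4⟩
  rw [hXe3] at k5
  have v1 : s₄.var lvl = s.var lvl := by
    rw [hf4.var lvl rfl, hf3.var lvl rfl, hf2.var lvl rfl]; simp
  have v2 : s₄.var off = o := by rw [hf4.var off rfl, hf3.var off rfl, hf2.var off rfl]; simpa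
  have v3 : s₄.var str = S := by rw [hf4.var str rfl, hf3.var str rfl, hf2.var str rfl]; simpa
  have v4 : s₄.var red = N - N / 3 := by
    rw [hf4.var red rfl, hf3.var red rfl, hf2.var red rfl]; simp
  have v5 : s₄.var sz = N := by rw [hf4.var sz rfl, hf3.var sz rfl, hf2.var sz rfl]; simpa
  have a1 : s₄.arr .lens = s.arr .lens := by
    rw [hf4.arr .lens rfl, hf3.arr .lens rfl, hf2.arr .lens rfl]; simp
  rw [run_seq, run_put, run_seq, run_set, run_seq, run_set, run_set]
  simp only [eval_add, eval_var, safe_add, safe_var, eval_ofNat, safe_ofNat, HState.set_var,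
    HState.put_var, v1, v2, v3, v4, v5, reduceCtorEq, if_false, true_and, if_true,
    HState.set_arr, HState.put_arr, a1, HState.set_time, HState.put_time]
  have hstr : ∀ x, strAt (((((s₄.put .lens (s.var lvl) N).set lvl (s.var lvl + 1)).set off
      (o + S))).set sz (N - N / 3)) x = strAt s₄ x := fun x => by funext d; simp [strAt]
  rw [hstr]
  have hY : IsStr (strAt s₄ (o + S)) (N - N / 3) := ⟨k1, fun d h1 h2 => by
    have := k2 (d - 1) (by omega)
    rwa [Nat.sub_add_cancel h1] at this⟩
  simp only [HState.set_time] at ht2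
  refine ⟨by omega, by omega, by omega, hY, fun d hd => ?_, ?_, k5, by omega⟩
  · rcases Nat.eq_zero_or_pos d with rfl | h0
    · rw [k1]; omega
    · have := k3 (d - 1) (by omega)
      rwa [Nat.sub_add_cancel h0] at this
  · intro d e hd he hd3 he3
    refine plt_reduced hX hB hY (fun i hi j hj => ?_) hd he hd3 he3
    rw [k4 i hi j hj, h2 i hi, h2 j hj]

/-! ### Suffix sorting: merging -/

/-! ### Comparing prefixes by the ranks of the sampled ones -/

section Compare

variable {X r : ℕ → ℕ} {N : ℕ}

/-- `r` ranks the sampled prefixes and the empty one. -/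
def IsRank (X r : ℕ → ℕ) (N : ℕ) : Prop :=
  (∀ a ≤ N, (a = 0 ∨ a % 3 ≠ 0) → r a < N + 1) ∧
  ∀ a b, a ≤ N → b ≤ N → (a = 0 ∨ a % 3 ≠ 0) → (b = 0 ∨ b % 3 ≠ 0) → (plt X a b ↔ r a < r b)

/-- For lengths congruent to 0 or 2 modulo 3: dropping one character leaves sampled prefixes, of
residue 2 or 1. -/
theorem plt_iff_rank_one (hX : IsStr X N) (hr : IsRank X r N)
    {d e : ℕ} (hd : d ≤ N) (he : e ≤ N) (hd1 : d - 1 = 0 ∨ (d - 1) % 3 ≠ 0)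
    (he1 : e - 1 = 0 ∨ (e - 1) % 3 ≠ 0) :
    plt X d e ↔ X d * (N + 1) + r (d - 1) < X e * (N + 1) + r (e - 1) := by
  rw [hX.plt_iff hd he, digit_lt_iff (hr.1 _ (by omega) hd1) (hr.1 _ (by omega) he1),
    hr.2 _ _ (by omega) (by omega) hd1 he1]

/-- For comparing residue 0 with residue 1: one character is not enough, but dropping two leaves
residues 1 and 2, or the empty prefix when the length was 1. -/
theorem plt_iff_rank_two (hX : IsStr X N) (hXN : ∀ d ≤ N, X d < N + 1) (hr : IsRank X r N)
    {d e : ℕ} (hd : d ≤ N) (he : e ≤ N) (hd1 : d - 2 = 0 ∨ (d - 2) % 3 ≠ 0)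
    (he1 : e - 2 = 0 ∨ (e - 2) % 3 ≠ 0) :
    plt X d e ↔ (X d * (N + 1) + X (d - 1)) * (N + 1) + r (d - 2) <
      (X e * (N + 1) + X (e - 1)) * (N + 1) + r (e - 2) := by
  have h1 := hXN (d - 1) (by omega)
  have h2 := hXN (e - 1) (by omega)
  rw [digit_lt_iff (hr.1 _ (by omega) hd1) (hr.1 _ (by omega) he1), digit_lt_iff h1 h2,
    digit_eq_iff h1 h2, ← hr.2 _ _ (by omega) (by omega) hd1 he1, hX.plt_iff hd he,
    hX.plt_iff (d := d - 1) (by omega) (by omega)]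
  simp only [Nat.sub_sub]
  norm_num
  tauto

end Compare

/-- The sorted sampled prefixes are copied to `sab` because merging overwrites `sa`. -/
def sampleRanks : Prog :=
  .put .rs 0 0 ;; .set t 1 ;; .for t (red + 1) (
    .set p (.arr .sa t - 1) ;;
    .ite (.lt p ((sz + 2) / 3)) (.set d (3 * p + 1)) (.set d (3 * (p - (sz + 2) / 3) + 2)) ;;
    .put .rs d t ;; .put .sab t d)

theorem sampleRanks_spec {s : St} {N l : ℕ} {Z : ℕ → ℕ} (hZ : s.arr .sa = Z)
    (hsz : s.var sz = N) (hl : s.var red = l) (hlN : l = N - N / 3)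
    (hZl : ∀ t, 1 ≤ t → t ≤ l → 1 ≤ Z t ∧ Z t ≤ l)
    (hinj : ∀ t u, 1 ≤ t → t ≤ l → 1 ≤ u → u ≤ l → Z t = Z u → t = u)
    (hL : 3 * N + 10 < M.L) :
    Run M sampleRanks s (fun s' => (s'.arr .rs 0 = 0 ∧
      (∀ t, 1 ≤ t → t ≤ l → s'.arr .rs (sampleAt N (Z t - 1)) = t ∧
        s'.arr .sab t = sampleAt N (Z t - 1)) ∧
      s'.time ≤ s.time + l) ∧ Frame sampleRanks s s') := by
  refine Run.frame ?_
  rw [sampleRanks, run_seq, run_put, run_seq, run_set]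
  refine ⟨by simp; omega, by simp; omega, by simp; omega, by simp; omega, ?_⟩
  refine (Run.for (fun k s' => s'.arr .rs 0 = 0 ∧ ∀ t, 1 ≤ t → t < k →
      s'.arr .rs (sampleAt N (Z t - 1)) = t ∧ s'.arr .sab t = sampleAt N (Z t - 1)) 1 (l + 1) 0
      (by simp) (by omega) (by omega) ⟨by simp, by omega⟩ (fun s' hf => ?_) rfl ?_).mono ?_
  · have : s'.var red = l := by rw [hf.var red rfl]; simpa
    simp [this]; omega
  · rintro k s' hk0 hk ⟨h1, h2⟩ hf hik
    have e1 : s'.arr .sa = Z := by rw [hf.arr .sa rfl]; simpa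
    have e2 : s'.var sz = N := by rw [hf.var sz rfl]; simpa
    have hz := hZl k hk0 (by omega)
    rw [run_seq, run_set]
    refine ⟨by simp [hik, e1]; omega, ?_⟩
    refine Run.seq (R := fun s₁ => s₁ = (s'.tick.set p (Z k - 1)).set d (sampleAt N (Z k - 1)))
      ?_ ?_
    · rw [run_ite, run_set, run_set]
      by_cases hk' : Z k - 1 < (N + 2) / 3 <;> simp [hik, e1, e2, hk', sampleAt] <;> omega
    rintro s₁ rfl
    have h3 : sampleAt N (Z k - 1) ≤ N := sampleAt_le (by omega)
    have h4 := sampleAt_pos (N := N) (Z k - 1)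
    rw [run_seq, run_put, run_put]
    simp [hik]
    refine ⟨by omega, by omega, ⟨?_, fun t ht htk => ?_⟩⟩
    · rw [Function.update_of_ne (by omega)]; exact h1
    · by_cases hteq : t = k
      · subst hteq; simp
      · rw [Function.update_of_ne, Function.update_of_ne hteq]
        · exact h2 t ht (by omega)
        · intro hc
          have := congrArg (samplePos N) hc
          rw [samplePos_sampleAt, samplePos_sampleAt] at this
          have hzt := hZl t ht (by omega)
          exact hteq (hinj t k ht (by omega) hk0 (by omega) (by omega))
  · rintro s' ⟨h1, -, h2⟩
    exact ⟨h1.1, fun t ht htl => h1.2 t ht (by omega), by simpa using h2⟩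

/-- A prefix whose length is divisible by 3 is determined in the order by its last character and the
rank of the rest, which is sampled; two digits suffice. -/
def unsampled : Prog :=
  .set len (sz / 3) ;; .set i 0 ;; .for i len (
    .put .list i (3 * i + 3) ;;
    .put .code (3 * i + 3) (.arr .X (off + (3 * i + 3)) * base + .arr .rs (3 * i + 2)))

theorem unsampled_spec {s : St} {N o : ℕ} (hsz : s.var sz = N) (ho : s.var off = o)
    (hbase : s.var base = N + 1) (hX : ∀ d ≤ N, strAt s o d < N + 1)
    (hr : ∀ a ≤ N, (a = 0 ∨ a % 3 ≠ 0) → s.arr .rs a < N + 1)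
    (hL : (N + 1) * (N + 1) + o + 3 * N + 10 < M.L) :
    Run M unsampled s (fun s' => ((∀ i < N / 3, s'.arr .list i = 3 * i + 3) ∧
      (∀ i < N / 3, s'.arr .code (3 * i + 3) =
        strAt s o (3 * i + 3) * (N + 1) + s.arr .rs (3 * i + 3 - 1)) ∧
      s'.var len = N / 3 ∧ s'.time ≤ s.time + N / 3) ∧ Frame unsampled s s') := by
  refine Run.frame ?_
  rw [unsampled, run_seq, run_set, run_seq, run_set]
  refine ⟨by simp; omega, by simp; omega, ?_⟩
  refine (Run.for (fun k s' => (∀ i < k, s'.arr .list i = 3 * i + 3) ∧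
      (∀ i < k, s'.arr .code (3 * i + 3) =
        strAt s o (3 * i + 3) * (N + 1) + s.arr .rs (3 * i + 3 - 1)) ∧ s'.var len = N / 3) 0 (N / 3) 0
      (by simp) (by omega) (by omega) (by simp [hsz]) (fun s' hf => ?_) rfl ?_).mono ?_
  · have : s'.var len = N / 3 := by rw [hf.var len rfl]; simp [hsz]
    simp [this]
  · rintro k s' _ hk ⟨h1, h2, h3⟩ hf hik
    have e1 : s'.arr .X = s.arr .X := by rw [hf.arr .X rfl]; simp
    have e2 : s'.arr .rs = s.arr .rs := by rw [hf.arr .rs rfl]; simp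
    have e3 : s'.var off = o := by rw [hf.var off rfl]; simpa
    have e4 : s'.var base = N + 1 := by rw [hf.var base rfl]; simpa
    have x0 := hX (3 * k + 3) (by omega)
    have x1 := hr (3 * k + 2) (by omega) (by omega)
    have t1 := digit_lt x0 x1
    simp only [strAt] at x0 x1 t1
    rw [run_seq, run_put, run_put]
    simp [hik, e1, e2, e3, e4]
    and_intros
    any_goals omega
    · intro j hj
      rw [Function.update_apply]
      split_ifs with hjk
      · rw [hjk]
      · exact h1 j (by omega)
    · intro j hj
      rw [Function.update_apply]
      split_ifs with hjk
      · rw [show j = k by omega]; rfl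
      · exact h2 j (by omega)
  · rintro s' ⟨⟨h1, h2, h3⟩, -, h4⟩
    exact ⟨h1, h2, h3, by simpa using h4⟩

/-- `f` tells whether the next prefix is taken from the unsampled list, indexed from 0 by `i`, or
from `sab`, indexed from 1 by `j`. The residue of the sampled candidate decides whether one or two
characters precede the comparison of ranks. -/
def merge : Prog :=
  .set i 0 ;; .set j 1 ;; .set t 1 ;; .for t (sz + 1) (
    .set d (.arr .list i) ;; .set e (.arr .sab j) ;;
    .ite (.lt red j) (.set f 1) (.ite (.lt i len)
      (.ite (.eq (e % 3) 1)
        (.set f (.lt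
          ((.arr .X (off + d) * base + .arr .X (off + (d - 1))) * base + .arr .rs (d - 2))
          ((.arr .X (off + e) * base + .arr .X (off + (e - 1))) * base + .arr .rs (e - 2))))
        (.set f (.lt (.arr .X (off + d) * base + .arr .rs (d - 1))
          (.arr .X (off + e) * base + .arr .rs (e - 1)))))
      (.set f 0)) ;;
    .ite f (.put .sa t d ;; .set i (i + 1)) (.put .sa t e ;; .set j (j + 1)))

theorem merge_spec {s : St} {N o l : ℕ} {X : ℕ → ℕ} (hX : IsStr X N) (hXN : ∀ d ≤ N, X d < N + 1)
    (hXs : strAt s o = X) (hr : IsRank X (s.arr .rs) N)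
    (hsz : s.var sz = N) (ho : s.var off = o) (hsub : s.var red = l) (hlN : l = N - N / 3)
    (hbase : s.var base = N + 1) (hlen : s.var len = N / 3) (hsa : s.arr .sa 0 = 0)
    (hlist : ∀ i < N / 3, s.arr .list i % 3 = 0 ∧ 1 ≤ s.arr .list i ∧ s.arr .list i ≤ N)
    (hlistc : ∀ i, i + 1 < N / 3 → plt X (s.arr .list i) (s.arr .list (i + 1)))
    (hsab : ∀ t, 1 ≤ t → t ≤ l → s.arr .sab t % 3 ≠ 0 ∧ s.arr .sab t ≤ N)
    (hsabc : ∀ t, 1 ≤ t → t < l → plt X (s.arr .sab t) (s.arr .sab (t + 1)))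
    (hL : (N + 1) * (N + 1) * (N + 1) + o + 3 * N + 10 < M.L) :
    Run M merge s (fun s' => (IsSA X N (s'.arr .sa) ∧ s'.time ≤ s.time + N) ∧
      Frame merge s s') := by
  refine Run.frame ?_
  rw [merge, run_seq, run_set, run_seq, run_set, run_seq, run_set]
  refine ⟨by simp; omega, by simp; omega, by simp; omega, ?_⟩
  -- The last clause says that the latest prefix written precedes both candidates, so the output
  -- stays sorted whichever of them is chosen. The two counters add up to k because `j` and `t`
  -- start at 1.
  refine (Run.for (fun k s' => s'.var i + s'.var j = k ∧ s'.var i ≤ N / 3 ∧ 1 ≤ s'.var j ∧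
      s'.var j ≤ l + 1 ∧ s'.arr .sa 0 = 0 ∧
      (∀ t, 1 ≤ t → t < k → 1 ≤ s'.arr .sa t ∧ s'.arr .sa t ≤ N) ∧
      (∀ t, 1 ≤ t → t + 1 < k → plt X (s'.arr .sa t) (s'.arr .sa (t + 1))) ∧
      (∀ t, 1 ≤ t → t + 1 = k → (s'.var i < N / 3 → plt X (s'.arr .sa t) (s.arr .list (s'.var i))) ∧
        (s'.var j ≤ l → plt X (s'.arr .sa t) (s.arr .sab (s'.var j))))) 1 (N + 1) 0
      (by simp) (by omega) (by omega) ?_ (fun s' hf => ?_) rfl ?_).mono ?_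
  · simp [hsa]; exact ⟨fun t _ _ => by omega, fun t _ _ => by omega⟩
  · have : s'.var sz = N := by rw [hf.var sz rfl]; simpa
    simp [this]; omega
  · rintro k s' hk0 hk ⟨h1, h2, h3, h4, h5, h6, h7, h8⟩ hf hik
    have e1 : s'.arr .X = s.arr .X := by rw [hf.arr .X rfl]; simp
    have e2 : s'.arr .rs = s.arr .rs := by rw [hf.arr .rs rfl]; simp
    have e3 : s'.var off = o := by rw [hf.var off rfl]; simpa
    have e4 : s'.var base = N + 1 := by rw [hf.var base rfl]; simpa
    have e5 : s'.var red = l := by rw [hf.var red rfl]; simpa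
    have e6 : s'.var len = N / 3 := by rw [hf.var len rfl]; simpa
    have e7 : s'.arr .list = s.arr .list := by rw [hf.arr .list rfl]; simp
    have e8 : s'.arr .sab = s.arr .sab := by rw [hf.arr .sab rfl]; simp
    have hXa : ∀ a, s.arr .X (o + a) = X a := fun a => by rw [← hXs]; rfl
    generalize hii : s'.var i = ii at *
    generalize hjj : s'.var j = jj at *
    generalize hdd : s.arr .list ii = dd at *
    generalize hee : s.arr .sab jj = ee at *
    rw [run_seq, run_set, run_seq, run_set]
    refine ⟨by simp [hii]; omega, by simp [hjj]; omega, ?_⟩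
    simp only [eval_arr, eval_var, HState.tick_var, HState.tick_arr, HState.set_var, HState.set_arr,
      hii, hjj, e7, e8, hdd, hee, reduceCtorEq, if_false]
    refine Run.seq (R := fun s₁ => ∃ g, s₁ = ((s'.tick.set d dd).set e ee).set f g ∧
      (g ≠ 0 → ii < N / 3 ∧ (jj ≤ l → plt X dd ee)) ∧
      (g = 0 → jj ≤ l ∧ (ii < N / 3 → plt X ee dd))) ?_ ?_
    · rw [run_ite]
      refine ⟨by simp, fun hc => ?_, fun hc => ?_⟩
      · have : l < jj := by by_contra h; simp [hjj, e5, h] at hc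
        rw [run_set]
        refine ⟨by simp; omega, 1, by simp, fun _ => ?_, by simp⟩
        omega
      have hjl : jj ≤ l := by by_contra h; simp [hjj, e5] at hc; omega
      rw [run_ite]
      refine ⟨by simp, fun hc => ?_, fun hc => ?_⟩
      · have hil : ii < N / 3 := by by_contra h; simp [hii, e6, h] at hc
        have p1 := hlist ii hil
        have p2 := hsab jj h3 hjl
        rw [hdd] at p1
        rw [hee] at p2
        have x0 := hXN dd (by omega)
        have x1 := hXN ee (by omega)
        have x2 := hXN (dd - 1) (by omega)
        have x3 := hXN (ee - 1) (by omega)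
        have y1 := digit_lt x0 x2
        have y2 := digit_lt x1 x3
        have t3 := Nat.le_mul_of_pos_right ((N + 1) * (N + 1)) (show 0 < N + 1 by omega)
        rw [run_ite]
        refine ⟨by simp; omega, fun hm => ?_, fun hm => ?_⟩
        · have hm' : ee % 3 = 1 := by by_contra h; simp [h] at hm
          have r1 := hr.1 (dd - 2) (by omega) (by omega)
          have r2 := hr.1 (ee - 2) (by omega) (by omega)
          have z1 := digit_lt y1 r1
          have z2 := digit_lt y2 r2
          have hiff := plt_iff_rank_two hX hXN hr p1.2.2 p2.2 (by omega) (by omega)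
          rw [run_set]
          simp only [eval_arr, eval_var, HState.tick_var, HState.tick_arr, HState.set_var,
            HState.set_arr, eval_lt, eval_add, eval_mul, eval_sub, safe_lt, safe_add, safe_mul,
            safe_arr, safe_sub, safe_var, safe_ofNat, eval_ofNat, e1, e2, e3, e4, hXa,
            reduceCtorEq, if_false, if_true, true_and, and_true]
          refine ⟨by omega, _, rfl, ?_, ?_⟩
          · split_ifs with h
            · exact fun _ => ⟨hil, fun _ => hiff.2 h⟩
            · simp
          · split_ifs with h
            · simp
            -- The candidates differ, having different residues modulo 3, so failure of one
            -- comparison yields the reverse one.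
            · refine fun _ => ⟨hjl, fun _ => (plt_total fun hc => ?_).resolve_right
                (fun hc => h (hiff.1 hc))⟩
              omega
        · have hm' : ee % 3 ≠ 1 := by intro h; simp [h] at hm
          have r1 := hr.1 (dd - 1) (by omega) (by omega)
          have r2 := hr.1 (ee - 1) (by omega) (by omega)
          have z1 := digit_lt x0 r1
          have z2 := digit_lt x1 r2
          have hiff := plt_iff_rank_one hX hr p1.2.2 p2.2 (by omega) (by omega)
          rw [run_set]
          simp only [eval_arr, eval_var, HState.tick_var, HState.tick_arr, HState.set_var,
            HState.set_arr, eval_lt, eval_add, eval_mul, eval_sub, safe_lt, safe_add, safe_mul,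
            safe_arr, safe_sub, safe_var, safe_ofNat, eval_ofNat, e1, e2, e3, e4, hXa,
            reduceCtorEq, if_false, if_true, true_and, and_true]
          refine ⟨by omega, _, rfl, ?_, ?_⟩
          · split_ifs with h
            · exact fun _ => ⟨hil, fun _ => hiff.2 h⟩
            · simp
          · split_ifs with h
            · simp
            · refine fun _ => ⟨hjl, fun _ => (plt_total fun hc => ?_).resolve_right
                (fun hc => h (hiff.1 hc))⟩
              omega
      · have hil : ¬ ii < N / 3 := by intro h; simp [hii, e6, h] at hc
        rw [run_set]
        refine ⟨by simp; omega, 0, by simp, by simp, fun _ => ⟨hjl, fun h => absurd h hil⟩⟩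
    rintro s₁ ⟨g, rfl, hg1, hg0⟩
    rw [run_ite]
    refine ⟨by simp, fun hc => ?_, fun hc => ?_⟩
    · obtain ⟨q1, q2⟩ := hg1 (by simpa using hc)
      have p1 := hlist ii q1
      rw [hdd] at p1
      rw [run_seq, run_put, run_set]
      simp only [eval_arr, eval_var, HState.tick_var, HState.tick_arr, HState.set_var, hik, hii,
        HState.set_arr, eval_add, safe_add, safe_var, safe_ofNat, eval_ofNat, HState.put_var,
        HState.put_arr, reduceCtorEq, if_false, if_true, true_and, and_true, HState.set_time,
        HState.put_time, HState.tick_time, hjj]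
      refine ⟨by omega, by omega, ⟨by omega, by omega, h3, h4, ?_, ?_, ?_, ?_⟩, by omega⟩
      · rw [Function.update_of_ne (by omega)]; exact h5
      · intro t ht htk
        rw [Function.update_apply]
        split_ifs with h
        · omega
        · exact h6 t ht (by omega)
      · intro t ht htk
        rw [Function.update_of_ne (by omega), Function.update_apply]
        split_ifs with h
        · exact (h8 t ht h).1 q1
        · exact h7 t ht (by omega)
      · intro t ht htk
        rw [show t = k by omega, Function.update_self]
        refine ⟨fun hi => ?_, fun h => hee ▸ q2 h⟩
        have := hlistc ii hi
        rwa [hdd] at this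
    · obtain ⟨q1, q2⟩ := hg0 (by simpa using hc)
      have p1 := hsab jj h3 q1
      rw [hee] at p1
      rw [run_seq, run_put, run_set]
      simp only [eval_arr, eval_var, HState.tick_var, HState.tick_arr, HState.set_var, hik, hii,
        HState.set_arr, eval_add, safe_add, safe_var, safe_ofNat, eval_ofNat, HState.put_var,
        HState.put_arr, reduceCtorEq, if_false, if_true, true_and, and_true, HState.set_time,
        HState.put_time, HState.tick_time, hjj]
      refine ⟨by omega, by omega, ⟨by omega, by omega, by omega, by omega, ?_, ?_, ?_, ?_⟩, by omega⟩
      · rw [Function.update_of_ne (by omega)]; exact h5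
      · intro t ht htk
        rw [Function.update_apply]
        split_ifs with h
        · omega
        · exact h6 t ht (by omega)
      · intro t ht htk
        rw [Function.update_of_ne (by omega), Function.update_apply]
        split_ifs with h
        · exact (h8 t ht h).2 q1
        · exact h7 t ht (by omega)
      · intro t ht htk
        rw [show t = k by omega, Function.update_self]
        refine ⟨fun h => hdd ▸ q2 h, fun hi => ?_⟩
        have := hsabc jj h3 hi
        rwa [hee] at this
  · rintro s' ⟨⟨-, -, -, -, h5, h6, h7, -⟩, -, h8⟩
    exact ⟨⟨h5, fun t h1 h2 => (h6 t h1 (by omega)).1, fun t h1 h2 => (h6 t h1 (by omega)).2,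
      fun t h1 h2 => h7 t h1 (by omega)⟩, by simpa using h8⟩

/-- The reduced string `Y` orders the sampled prefixes of `X`. -/
def Reduces (X Y : ℕ → ℕ) (N : ℕ) : Prop :=
  ∀ d e, d ≤ N → e ≤ N → d % 3 ≠ 0 → e % 3 ≠ 0 →
    (plt X d e ↔ plt Y (samplePos N d) (samplePos N e))

theorem Reduces.congr {X Y X' Y' : ℕ → ℕ} {N : ℕ} (h : Reduces X Y N)
    (hX : ∀ d ≤ N, X' d = X d) (hY : ∀ d ≤ N - N / 3, Y' d = Y d) : Reduces X' Y' N := by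
  intro d e hd he hd3 he3
  have h1 := samplePos_le hd3 hd
  have h2 := samplePos_le he3 he
  rw [plt_congr (Y := X) (fun i hi => hX i (by omega)) (fun i hi => hX i (by omega)),
    h d e hd he hd3 he3,
    plt_congr (Y := Y) (fun i hi => hY i (by omega)) (fun i hi => hY i (by omega))]

/-- A string of length `N` with positive characters that are at most `N`. -/
structure IsRanked (X : ℕ → ℕ) (N : ℕ) : Prop extends IsStr X N where
  le : ∀ d ≤ N, X d ≤ N

theorem IsRanked.congr {X X' : ℕ → ℕ} {N : ℕ} (h : IsRanked X N) (hX : ∀ d ≤ N, X' d = X d) :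
    IsRanked X' N := by
  refine ⟨⟨by rw [hX 0 (by omega), h.zero], fun d h1 h2 => ?_⟩, fun d h1 => ?_⟩
  · rw [hX d h2]; exact h.pos d h1 h2
  · rw [hX d h1]; exact h.le d h1

/-- Restores the variables that `descend` changed, then turns the order in `sa`, that of the next
deeper level, into the order of the present level. -/
def ascend : Prog :=
  (.set lvl (lvl - 1) ;; .set red sz ;; .set sz (.arr .lens lvl) ;; .set off (off - str) ;;
    .set base (sz + 1)) ;; sampleRanks ;; unsampled ;; sortCode ;; merge

theorem ascend_spec {s : St} {N o S ℓ : ℕ} (hlvl : s.var lvl = ℓ + 1) (hlens : s.arr .lens ℓ = N)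
    (hsz : s.var sz = N - N / 3) (ho : s.var off = o + S) (hS : s.var str = S)
    (hX : IsRanked (strAt s o) N) (hred : Reduces (strAt s o) (strAt s (o + S)) N)
    (hsa : IsSA (strAt s (o + S)) (N - N / 3) (s.arr .sa))
    (hL : (N + 1) * (N + 1) * (N + 1) + o + 9 * N + ℓ + 20 < M.L) :
    Run M ascend s (fun s' => (IsSA (strAt s o) N (s'.arr .sa) ∧ s'.var lvl = ℓ ∧
      s'.var sz = N ∧ s'.var off = o ∧ s'.time ≤ s.time + (11 * N + 6)) ∧ Frame ascend s s') := by
  refine Run.frame ?_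
  rw [ascend]
  refine Run.seq (R := fun s₁ => s₁ =
    ((((s.set lvl ℓ).set red (N - N / 3)).set sz N).set off o).set base (N + 1)) ?_ ?_
  · rw [run_seq, run_set, run_seq, run_set, run_seq, run_set, run_seq, run_set, run_set]
    simp [hlvl, hlens, hsz, ho, hS]
    omega
  rintro s₁ rfl
  generalize hZ : s.arr .sa = Z at *
  generalize hlen : N - N / 3 = l at *
  have hZ0 : ∀ t, 1 ≤ t → t ≤ l → 1 ≤ Z t ∧ Z t ≤ l := fun t h1 h2 => ⟨hsa.pos t h1 h2, hsa.le t h1 h2⟩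
  refine Run.seq (sampleRanks_spec (N := N) (l := l) (Z := Z) (by simpa) (by simp) (by simp)
    hlen.symm hZ0 (fun t u _ h2 _ h4 h => hsa.inj h2 h4 h) (by omega)) ?_
  rintro s₂ ⟨⟨hrs0, hrs, ht2⟩, hf2⟩
  have hXe : ∀ t : St, t.arr .X = s.arr .X → ∀ o, strAt t o = strAt s o := fun t ht o => by
    funext d; simp only [strAt, ht]
  have hX2 : s₂.arr .X = s.arr .X := by rw [hf2.arr .X rfl]; simp
  have hXN : ∀ d ≤ N, strAt s o d < N + 1 := fun d hd => by have := hX.le d hd; omega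
  have hsamp : ∀ a ≤ N, a % 3 ≠ 0 → ∃ t, 1 ≤ t ∧ t ≤ l ∧ sampleAt N (Z t - 1) = a ∧
      Z t = samplePos N a := by
    intro a ha ha3
    obtain ⟨t, h1, h2, h3⟩ := hsa.surj' (d := samplePos N a)
      (by rw [← hlen]; exact samplePos_le ha3 ha) (samplePos_pos a)
    exact ⟨t, h1, h2, by rw [h3, sampleAt_samplePos ha3 ha], h3⟩
  have hrank : IsRank (strAt s o) (s₂.arr .rs) N := by
    refine ⟨fun a ha h => ?_, fun a b ha hb h h' => ?_⟩
    · rcases h with rfl | h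
      · omega
      · obtain ⟨t, h1, h2, h3, -⟩ := hsamp a ha h
        rw [← h3, (hrs t h1 h2).1]; omega
    · by_cases ha0 : a = 0
      · subst ha0
        by_cases hb0 : b = 0
        · subst hb0; simp
        · obtain ⟨t, h1, h2, h3, -⟩ := hsamp b hb (by omega)
          have := (hrs t h1 h2).1
          rw [h3] at this
          rw [hrs0, this]
          simp [plt_zero_left (show 0 < b by omega)]; omega
      · obtain ⟨t, h1, h2, h3, h4⟩ := hsamp a ha (by omega)
        have ht := (hrs t h1 h2).1
        rw [h3] at ht
        by_cases hb0 : b = 0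
        · subst hb0; simp [hrs0]
        · obtain ⟨u, g1, g2, g3, g4⟩ := hsamp b hb (by omega)
          have hu := (hrs u g1 g2).1
          rw [g3] at hu
          rw [ht, hu, hred a b ha hb (by omega) (by omega), ← h4, ← g4, hsa.plt_iff h2 g2]
  have t0 : N + 1 ≤ (N + 1) * (N + 1) := Nat.le_mul_of_pos_right _ (by omega)
  have t3 := Nat.le_mul_of_pos_right ((N + 1) * (N + 1)) (show 0 < N + 1 by omega)
  refine Run.seq (unsampled_spec (N := N) (o := o) (by rw [hf2.var sz rfl]; simp)
    (by rw [hf2.var off rfl]; simp) (by rw [hf2.var base rfl]; simp)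
    (by rw [hXe _ hX2]; exact hXN) hrank.1 (by omega)) ?_
  rintro s₃ ⟨⟨hlist, hcode, hl3, ht3⟩, hf3⟩
  rw [hXe _ hX2] at hcode
  have h3N : ∀ i < N / 3, 3 * i + 3 ≤ N := fun i hi => by omega
  refine Run.seq (sortCode_spec (l := N / 3) (b := N + 1) hl3
    (by rw [hf3.var base rfl, hf2.var base rfl]; simp) (by omega) (by omega)
    (fun i hi => by rw [hlist i hi]; omega) (by omega) (fun i hi => ?_)) ?_
  · rw [hlist i hi, hcode i hi]
    have := digit_lt (hXN _ (h3N i hi)) (hrank.1 (3 * i + 3 - 1) (by omega) (by omega))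
    omega
  rintro s₄ ⟨⟨hperm, hsort, ht4⟩, hf4⟩
  have hX4 : s₄.arr .X = s.arr .X := by rw [hf4.arr .X rfl, hf3.arr .X rfl, hX2]
  have hrs4 : s₄.arr .rs = s₂.arr .rs := by rw [hf4.arr .rs rfl, hf3.arr .rs rfl]
  have hsab4 : s₄.arr .sab = s₂.arr .sab := by rw [hf4.arr .sab rfl, hf3.arr .sab rfl]
  have hP := hperm.forall (P := fun x => x % 3 = 0 ∧ 1 ≤ x ∧ x ≤ N ∧
    s₃.arr .code x = strAt s o x * (N + 1) + s₂.arr .rs (x - 1)) (fun i hi => by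
      have := hcode i hi
      rw [hlist i hi]
      exact ⟨by omega, by omega, by omega, this⟩)
  have hinj := hperm.inj (fun i hi j hj h => by rw [hlist i hi, hlist j hj] at h; omega)
  refine (merge_spec (N := N) (o := o) (l := l) (X := strAt s o) hX.toIsStr hXN (hXe _ hX4 _)
    (by rw [hrs4]; exact hrank) ?_ ?_ ?_ hlen.symm ?_ ?_ ?_ ?_ ?_ ?_ ?_ (by omega)).mono ?_
  · rw [hf4.var sz rfl, hf3.var sz rfl, hf2.var sz rfl]; simp
  · rw [hf4.var off rfl, hf3.var off rfl, hf2.var off rfl]; simp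
  · rw [hf4.var red rfl, hf3.var red rfl, hf2.var red rfl]; simp
  · rw [hf4.var base rfl, hf3.var base rfl, hf2.var base rfl]; simp
  · rw [hf4.var Var.len rfl, hl3]
  · rw [hf4.arr .sa rfl, hf3.arr .sa rfl, hf2.arr .sa rfl]; simp [hZ, hsa.zero]
  · intro i hi
    obtain ⟨p1, p2, p3, -⟩ := hP i hi
    exact ⟨p1, p2, p3⟩
  · intro i hi
    obtain ⟨p1, p2, p3, p4⟩ := hP i (by omega)
    obtain ⟨q1, q2, q3, q4⟩ := hP (i + 1) hi
    have h5 := hsort i (i + 1) (by omega) hi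
    rw [p4, q4] at h5
    refine (plt_total fun h => ?_).resolve_right fun h => ?_
    · have := hinj i (by omega) (i + 1) hi h; omega
    · rw [plt_iff_rank_one hX.toIsStr hrank q3 p3 (by omega) (by omega)] at h
      omega
  · intro t h1 h2
    rw [hsab4, (hrs t h1 h2).2]
    exact ⟨sampleAt_mod _, sampleAt_le (by have := hZ0 t h1 h2; omega)⟩
  · intro t h1 h2
    rw [hsab4, (hrs t h1 (by omega)).2, (hrs (t + 1) (by omega) h2).2]
    have z1 := hZ0 t h1 (by omega)
    have z2 := hZ0 (t + 1) (by omega) h2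
    rw [hred _ _ (sampleAt_le (by omega)) (sampleAt_le (by omega)) (sampleAt_mod _) (sampleAt_mod _),
      samplePos_sampleAt, samplePos_sampleAt, Nat.sub_add_cancel z1.1, Nat.sub_add_cancel z2.1]
    exact hsa.chain t h1 h2
  · rintro s₅ ⟨⟨h1, ht5⟩, hf5⟩
    simp only [HState.set_time] at ht2
    refine ⟨h1, ?_, ?_, ?_, by omega⟩
    · rw [hf5.var lvl rfl, hf4.var lvl rfl, hf3.var lvl rfl, hf2.var lvl rfl]; simp
    · rw [hf5.var sz rfl, hf4.var sz rfl, hf3.var sz rfl, hf2.var sz rfl]; simp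
    · rw [hf5.var off rfl, hf4.var off rfl, hf3.var off rfl, hf2.var off rfl]; simp

/-- The length of the string of level `j`. -/
def lvlLen (N j : ℕ) : ℕ := (fun N => N - N / 3)^[j] N

theorem lvlLen_succ (N j : ℕ) : lvlLen N (j + 1) = lvlLen N j - lvlLen N j / 3 :=
  Function.iterate_succ_apply' _ _ _

theorem lvlLen_le (N j : ℕ) : lvlLen N j ≤ N := by
  induction j with
  | zero => exact le_rfl
  | succ j ih => rw [lvlLen_succ]; omega

/-- The strings of the levels up to `ℓ`. -/
structure Levels (s : St) (N ℓ : ℕ) : Prop where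
  lvl : s.var lvl = ℓ
  off : s.var off = ℓ * (N + 1)
  sz : s.var sz = lvlLen N ℓ
  str : s.var str = N + 1
  ranked : ∀ j ≤ ℓ, IsRanked (strAt s (j * (N + 1))) (lvlLen N j)
  red : ∀ j < ℓ, Reduces (strAt s (j * (N + 1))) (strAt s ((j + 1) * (N + 1))) (lvlLen N j)
  lens : ∀ j < ℓ, s.arr .lens j = lvlLen N j
  ge : ∀ j < ℓ, 3 ≤ lvlLen N j
  cnt : ℓ + lvlLen N ℓ ≤ N

/-- The recursion is unrolled into one loop going down and one going up, with the string of level j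
kept at offset j (N + 1) of `X`. A length k ≥ 3 shrinks to k − k/3 ≥ 2, so starting from N ≥ 2 the
descent always ends with exactly two characters, which are sorted by hand. -/
def suffixSort : Prog :=
  (.set lvl 0 ;; .set off 0 ;; .set sz tot) ;;
  .loop (.lt 2 sz) descend ;;
  (.put .sa 0 0 ;; .ite (.lt (.arr .X (off + 2)) (.arr .X (off + 1)))
    (.put .sa 1 2 ;; .put .sa 2 1) (.put .sa 1 1 ;; .put .sa 2 2)) ;;
  .loop (.lt 0 lvl) ascend

theorem suffixSort_spec {s : St} {N : ℕ} (htot : s.var tot = N) (hS : s.var str = N + 1)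
    (hN : 2 ≤ N) (hX : IsRanked (s.arr .X) N)
    (hL : (N + 1) * (N + 1) * (N + 1) + N * (N + 1) + 12 * N + 40 < M.L) :
    Run M suffixSort s (fun s' => (IsSA (s.arr .X) N (s'.arr .sa) ∧
      (∀ d ≤ N, s'.arr .X d = s.arr .X d) ∧
      s'.time ≤ s.time + 200 * N) ∧ Frame suffixSort s s') := by
  refine Run.frame ?_
  have hcube : ∀ j, (lvlLen N j + 1) * (lvlLen N j + 1) * (lvlLen N j + 1) ≤
      (N + 1) * (N + 1) * (N + 1) := fun j => by
    have := lvlLen_le N j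
    gcongr
  have hsq : ∀ ℓ, ℓ + 0 ≤ N → ℓ * (N + 1) ≤ N * (N + 1) := fun ℓ h => Nat.mul_le_mul_right _ (by omega)
  have hmul : ∀ j ℓ, j ≤ ℓ → j * (N + 1) ≤ ℓ * (N + 1) := fun j ℓ h => Nat.mul_le_mul_right _ h
  rw [suffixSort]
  refine Run.seq (R := fun s₁ => s₁ = ((s.set lvl 0).set off 0).set sz N) ?_ ?_
  · rw [run_seq, run_set, run_seq, run_set, run_set]
    simp [htot]; omega
  rintro s₁ rfl
  refine Run.seq (R := fun s₂ => ∃ ℓ, Levels s₂ N ℓ ∧ lvlLen N ℓ = 2 ∧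
    (∀ d ≤ N, s₂.arr .X d = s.arr .X d) ∧ s₂.time ≤ s.time + 100 * (N - 2)) ?_ ?_
  -- A level of length k ≥ 3 costs at most 19 k + 1 and loses k/3 ≥ k/5 characters (the worst case
  -- is k = 5), so 100 iterations per lost character pay for the descent.
  · refine Run.loop (fun s₂ => ∃ ℓ, Levels s₂ N ℓ ∧ 2 ≤ lvlLen N ℓ ∧
      (∀ d ≤ N, s₂.arr .X d = s.arr .X d) ∧ s₂.time ≤ s.time + 100 * (N - lvlLen N ℓ))
      (fun s₂ => s₂.var sz) ?_ ?_ ?_ ?_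
    · refine ⟨0, ⟨by simp, by simp, by simp [lvlLen], by simpa, ?_, by omega, by omega, by omega,
        by simp [lvlLen]⟩, by simpa [lvlLen], by simp, by simp [lvlLen]⟩
      intro j hj
      have : j = 0 := by omega
      subst this
      refine hX.congr fun d hd => ?_
      simp [strAt]
    · intro s₂ _; simp; omega
    · rintro s₂ ⟨ℓ, hl, h2, hX0, ht⟩ hc
      have h3 : 3 ≤ lvlLen N ℓ := by by_contra h; simp [hl.sz] at hc; omega
      have hle := lvlLen_le N ℓ
      have e1 := hcube ℓ
      have e2 := hsq ℓ (by have := hl.cnt; omega)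
      have e3 := hl.cnt
      have hr := hl.ranked ℓ le_rfl
      refine (descend_spec (M := M) (s := s₂.tick) (N := lvlLen N ℓ) (o := ℓ * (N + 1)) (S := N + 1) (by simpa using hl.sz)
        (by simpa using hl.off) (by simpa using hl.str) h3 hr.toIsStr hr.le
        (by simp [hl.lvl]; omega)).mono ?_
      rintro s₃ ⟨⟨g1, g2, g3, g4, g5, g6, g7, g8, ht3⟩, hf⟩
      simp only [HState.tick_var, HState.tick_arr, HState.tick_time] at g4 g5 g6 ht3
      have hlen : lvlLen N (ℓ + 1) = lvlLen N ℓ - lvlLen N ℓ / 3 := lvlLen_succ N ℓ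
      have hoff : ℓ * (N + 1) + (N + 1) = (ℓ + 1) * (N + 1) := by ring
      rw [hoff] at g1 g2 g3 g4 g7
      have hsame : ∀ j ≤ ℓ, ∀ d ≤ lvlLen N j, strAt s₃ (j * (N + 1)) d = strAt s₂ (j * (N + 1)) d := by
        intro j hj d hd
        have := lvlLen_le N j
        have := hmul j ℓ hj
        exact g4 _ (by omega)
      refine ⟨⟨ℓ + 1, ⟨by rw [g6, hl.lvl], g7, by rw [g8, hlen], ?_, ?_, ?_, ?_, ?_, ?_⟩,
        by omega, ?_, ?_⟩, ?_⟩
      · rw [hf.var .str rfl]; exact hl.str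
      · intro j hj
        rcases Nat.lt_or_ge ℓ j with h | h
        · have : j = ℓ + 1 := by omega
          subst this
          rw [hlen]
          exact ⟨g1, g2⟩
        · exact (hl.ranked j h).congr (hsame j h)
      · intro j hj
        rcases Nat.lt_or_ge j ℓ with h | h
        · refine (hl.red j h).congr (hsame j (by omega)) ?_
          rw [← lvlLen_succ]
          exact hsame (j + 1) h
        · have : j = ℓ := by omega
          subst this
          exact Reduces.congr (Y := strAt s₃ ((j + 1) * (N + 1))) g3 (hsame j le_rfl) fun _ _ => rfl
      · intro j hj
        rw [g5, hl.lvl, Function.update_apply]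
        split_ifs with h
        · rw [h]
        · exact hl.lens j (by omega)
      · intro j hj
        rcases Nat.lt_or_ge j ℓ with h | h
        · exact hl.ge j h
        · rwa [show j = ℓ by omega]
      · omega
      · intro d hd
        rw [g4 d (by rw [← hoff]; omega), hX0 d hd]
      · omega
      · rw [g8, hl.sz]; omega
    · rintro s₂ ⟨ℓ, hl, h2, hX0, ht⟩ hc
      have h3 : lvlLen N ℓ ≤ 2 := by by_contra h; simp [hl.sz] at hc; omega
      have : lvlLen N ℓ = 2 := by omega
      rw [this] at ht
      exact ⟨ℓ, hl, this, hX0, ht⟩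
  rintro s₂ ⟨ℓ, hl, hl2, hX2, ht2⟩
  have hℓ := hl.cnt
  have hℓ2 := hsq ℓ (by omega)
  refine Run.seq (R := fun s₃ => (IsSA (strAt s₂ (ℓ * (N + 1))) 2 (s₃.arr .sa) ∧
    s₃.time = s₂.time) ∧ Frame _ s₂ s₃) (Run.frame ?_) ?_
  · have hr := hl.ranked ℓ le_rfl
    rw [hl2] at hr
    have hp : ∀ d e, d ≤ 2 → e ≤ 2 → _ := fun d e hd he => hr.plt_iff (d := d) (e := e) hd he
    have e1 : ∀ d, s₂.arr .X (ℓ * (N + 1) + d) = strAt s₂ (ℓ * (N + 1)) d := fun _ => rfl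
    have hsa : ∀ a b : ℕ, (a = 1 ∧ b = 2 ∨ a = 2 ∧ b = 1) → plt (strAt s₂ (ℓ * (N + 1))) a b →
        ∀ f : ℕ → ℕ, f 0 = 0 → f 1 = a → f 2 = b →
        IsSA (strAt s₂ (ℓ * (N + 1))) 2 f := by
      intro a b hab h f h0 h1 h2
      refine ⟨h0, fun t ht ht2 => ?_, fun t ht ht2 => ?_, fun t ht ht2 => ?_⟩
      · interval_cases t <;> omega
      · interval_cases t <;> omega
      · interval_cases t
        rw [h1, h2]; exact h
    rw [run_seq, run_put, run_ite, run_seq, run_put, run_put, run_seq, run_put, run_put]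
    simp only [eval_arr, eval_var, HState.put_var, HState.put_arr, HState.put_time, hl.off,
      eval_lt, eval_add, safe_lt, safe_add, safe_arr, safe_var, safe_ofNat, eval_ofNat, e1,
      reduceCtorEq, if_false, if_true, true_and, and_true]
    refine ⟨by omega, by omega, by omega, by omega, fun hc => ⟨by omega, by omega, by omega,
      by omega, by omega, by omega, ?_⟩, fun hc => ⟨by omega, by omega, by omega, by omega, by omega,
      by omega, ?_⟩⟩
    · have h : strAt s₂ (ℓ * (N + 1)) 2 < strAt s₂ (ℓ * (N + 1)) 1 := by
        by_contra h; simp [h] at hc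
      refine hsa 2 1 (by omega) ?_ _ ?_ ?_ ?_
      · rw [hp 2 1 (by omega) (by omega)]; exact Or.inl h
      all_goals simp
    · have h : ¬ strAt s₂ (ℓ * (N + 1)) 2 < strAt s₂ (ℓ * (N + 1)) 1 := by
        intro h; simp [h] at hc
      refine hsa 1 2 (by omega) ?_ _ ?_ ?_ ?_
      · rw [hp 1 2 (by omega) (by omega)]
        rcases (not_lt.1 h).lt_or_eq with h | h
        · exact Or.inl h
        · exact Or.inr ⟨h, plt_zero_left (by omega)⟩
      all_goals simp
  rintro s₃ ⟨⟨hsa, ht3⟩, hf3⟩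
  have hXe3 : s₃.arr .X = s₂.arr .X := hf3.arr .X rfl
  have hle3 : s₃.arr .lens = s₂.arr .lens := hf3.arr .lens rfl
  have hXe : ∀ t : St, t.arr .X = s₂.arr .X → ∀ o, strAt t o = strAt s₂ o := fun t ht o => by
    funext d; simp only [strAt, ht]
  -- The ascent to length k costs at most 11 k + 7 ≤ 100 (k/3), again with integer division, so 100
  -- times the current length bounds the time so far.
  refine Run.loop (fun s' => ∃ j ≤ ℓ, s'.var lvl = j ∧ s'.var off = j * (N + 1) ∧
      s'.var sz = lvlLen N j ∧ s'.var str = N + 1 ∧ s'.arr .X = s₂.arr .X ∧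
      s'.arr .lens = s₂.arr .lens ∧ IsSA (strAt s₂ (j * (N + 1))) (lvlLen N j) (s'.arr .sa) ∧
      s'.time ≤ s₂.time + 100 * (lvlLen N j)) (fun s' => s'.var lvl) ?_ ?_ ?_ ?_
  · refine ⟨ℓ, le_rfl, ?_, ?_, ?_, ?_, hXe3, hle3, ?_, by omega⟩
    · rw [hf3.var lvl rfl, hl.lvl]
    · rw [hf3.var off rfl, hl.off]
    · rw [hf3.var sz rfl, hl.sz]
    · rw [hf3.var str rfl, hl.str]
    · rw [hl2]; exact hsa
  · intro s' _; simp; omega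
  · rintro s' ⟨j, hj, v1, v2, v3, v4, a1, a2, hs, ht⟩ hc
    obtain ⟨j, rfl⟩ : ∃ i, j = i + 1 := ⟨j - 1, by
      have : j ≠ 0 := by rintro rfl; simp [v1] at hc
      omega⟩
    have e1 := hcube j
    have e2 := hsq j (by omega)
    have e3 := lvlLen_le N j
    have e4 := hl.ge j hj
    have hlen : lvlLen N (j + 1) = lvlLen N j - lvlLen N j / 3 := lvlLen_succ N j
    have hoff : j * (N + 1) + (N + 1) = (j + 1) * (N + 1) := by ring
    refine (ascend_spec (N := lvlLen N j) (o := j * (N + 1)) (S := N + 1) (ℓ := j) (by simpa using v1)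
      (by simp [a2, hl.lens j hj]) (by simp [v3, hlen]) (by simp [v2, hoff]) (by simpa using v4)
      ?_ ?_ ?_ (by omega)).mono ?_
    · rw [hXe s'.tick a1]; exact hl.ranked j (by omega)
    · rw [hXe s'.tick a1, hXe s'.tick a1, hoff]; exact hl.red j hj
    · rw [hXe s'.tick a1, hoff, ← hlen]; exact hs
    · rintro s'' ⟨⟨g1, g2, g3, g4, ht'⟩, hf⟩
      rw [hXe s'.tick a1] at g1
      simp only [HState.tick_time] at ht'
      refine ⟨⟨j, by omega, g2, g4, g3, ?_, ?_, ?_, g1, by omega⟩, by omega⟩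
      · rw [hf.var str rfl]; exact v4
      · rw [hf.arr .X rfl]; exact a1
      · rw [hf.arr .lens rfl]; exact a2
  · rintro s' ⟨j, hj, v1, v2, v3, v4, a1, a2, hs, ht⟩ hc
    have : j = 0 := by by_contra h; simp [v1] at hc; omega
    subst this
    have h0 : ∀ d ≤ N, strAt s₂ (0 * (N + 1)) d = s.arr .X d := fun d hd => by
      rw [← hX2 d hd]; simp [strAt]
    refine ⟨⟨hs.zero, hs.pos, hs.le, fun t h1 h2 => ?_⟩, fun d hd => ?_, ?_⟩
    · have g1 := hs.le t h1 (le_of_lt h2)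
      have g2 := hs.le (t + 1) (by omega) h2
      have := hs.chain t h1 h2
      rwa [plt_congr (Y := s.arr .X) (fun i hi => h0 i (by
        exact hi.trans g1)) (fun i hi => h0 i (hi.trans g2))] at this
    · rw [a1, hX2 d hd]
    · have : lvlLen N 0 = N := rfl
      omega

/-! ### Longest common suffixes of neighbours -/

def inverse (lev : Bool) : Prog :=
  .put (.rk lev) 0 0 ;; .set t 1 ;; .for t (tot + 1) (.put (.rk lev) (.arr .sa t) t)

theorem inverse_spec (lev : Bool) {s : St} {N : ℕ} {X : ℕ → ℕ} (htot : s.var tot = N)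
    (hsa : IsSA X N (s.arr .sa)) (hL : N + 2 < M.L) :
    Run M (inverse lev) s (fun s' => ((∀ t ≤ N, s'.arr (.rk lev) (s.arr .sa t) = t) ∧
      s'.time ≤ s.time + N) ∧ Frame (inverse lev) s s') := by
  refine Run.frame ?_
  rw [inverse, run_seq, run_put, run_seq, run_set]
  refine ⟨by simp; omega, by simp; omega, by simp; omega, by simp; omega, ?_⟩
  refine (Run.for (fun k s' => ∀ t < k, s'.arr (.rk lev) (s.arr .sa t) = t) 1 (N + 1) 0
    (by simp) (by omega) (by omega) ?_ (fun s' hf => ?_) rfl ?_).mono ?_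
  · intro t ht
    rw [show t = 0 by omega, hsa.zero]; simp
  · have : s'.var tot = N := by rw [hf.var tot rfl]; simpa
    simp [this]; omega
  · rintro k s' hk0 hk h1 hf hik
    have e1 : s'.arr .sa = s.arr .sa := by rw [hf.arr .sa rfl]; simp
    have := hsa.le k hk0 (by omega)
    rw [run_put]
    simp [hik, e1]
    refine ⟨by omega, by omega, fun t ht => ?_⟩
    by_cases htk : t = k
    · rw [htk]; simp
    · rw [Function.update_of_ne fun h => htk (hsa.inj (by omega) (by omega) h)]
      exact h1 t (by omega)
  · rintro s' ⟨h1, -, h2⟩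
    exact ⟨fun t ht => h1 t (by omega), by simpa using h2⟩

/-- No bounds are tested: for d ≠ e one prefix is exhausted before the other, and then the sentinel
`X 0 = 0` differs from a genuine character. -/
def extend : Prog :=
  .loop (.eq (.arr .X (d - h)) (.arr .X (e - h))) (.set h (h + 1))

/-- The prefixes are treated by decreasing length, because by `IsSA.lcs_pred` the value h − 1 is a
safe start for the next shorter prefix. -/
def kasai (lev : Bool) : Prog :=
  .set h 0 ;; .set i 0 ;; .for i tot (
    .set d (tot - i) ;; .set e (.arr .sa (.arr (.rk lev) d - 1)) ;;
    extend ;;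
    .put (.hh lev) (.arr (.rk lev) d) h ;; .set h (h - 1))

theorem kasai_spec (lev : Bool) {s : St} {N : ℕ} {X : ℕ → ℕ} (htot : s.var tot = N)
    (hXs : ∀ d ≤ N, s.arr .X d = X d) (hX : IsStr X N)
    (hsa : IsSA X N (s.arr .sa)) (hrk : ∀ t ≤ N, s.arr (.rk lev) (s.arr .sa t) = t)
    (hL : 3 * N + 10 < M.L) :
    Run M (kasai lev) s (fun s' => ((∀ t, 1 ≤ t → t ≤ N →
        s'.arr (.hh lev) t = lcs X (s.arr .sa (t - 1)) (s.arr .sa t)) ∧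
      s'.time ≤ s.time + 3 * N) ∧ Frame (kasai lev) s s') := by
  refine Run.frame ?_
  generalize hS : s.arr .sa = S at *
  generalize hR : s.arr (.rk lev) = R at *
  rw [kasai, run_seq, run_set, run_seq, run_set]
  refine ⟨by simp; omega, by simp; omega, ?_⟩
  -- Amortization with potential h: each iteration of `extend` raises h by one, each round lowers it
  -- by at most one, and h ≤ N throughout.
  refine (Run.for_inv (fun k s' => (∀ d, N - k < d → d ≤ N →
        s'.arr (.hh lev) (R d) = lcs X d (S (R d - 1))) ∧
      (k < N → s'.var .h ≤ lcs X (N - k) (S (R (N - k) - 1))) ∧ s'.var .h ≤ N ∧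
      s'.time ≤ s.time + 2 * k + s'.var .h) 0 N
    (by simp) (by omega) (by omega) ?_ (fun s' hf => ?_) rfl ?_).mono ?_
  · simp; intro d h1 h2; omega
  · have : s'.var tot = N := by rw [hf.var tot rfl]; simpa
    simp [this]
  · rintro k s' _ hk ⟨h1, h2, h3, h4⟩ hf hik
    have e1 : s'.arr .sa = S := by rw [hf.arr .sa rfl]; simpa
    have e2 : s'.arr .X = s.arr .X := by rw [hf.arr .X rfl]; simp
    have e3 : s'.arr (.rk lev) = R := by rw [hf.arr (.rk lev) rfl]; simpa
    have e4 : s'.var tot = N := by rw [hf.var tot rfl]; simpa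
    obtain ⟨t, ht1, ht, htd⟩ := hsa.surj' (d := N - k) (by omega) (by omega)
    have hRd : R (N - k) = t := by rw [← htd, hrk t ht]
    have hee : S (t - 1) ≤ N := hsa.le' (by omega)
    have hne : S (t - 1) ≠ N - k := by
      rw [← htd]; intro hc
      have := hsa.inj (by omega) ht hc; omega
    have h2' := h2 hk
    rw [run_seq, run_set, run_seq, run_set]
    simp only [eval_arr, eval_var, HState.tick_var, HState.tick_arr, HState.set_var,
      HState.set_arr, eval_sub, safe_sub, safe_arr, safe_var, safe_ofNat, eval_ofNat, e1, e3, e4,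
      hik, hRd, reduceCtorEq, if_false, if_true, true_and, and_true]
    rw [hRd] at h2'
    refine ⟨by omega, ?_⟩
    refine Run.seq (R := fun s₁ => (s₁.var .h = lcs X (N - k) (S (t - 1)) ∧
      s₁.time ≤ s.time + 2 * k + 1 + s₁.var .h) ∧
      Frame extend ((s'.tick.set d (N - k)).set e (S (t - 1))) s₁) (Run.frame ?_) ?_
    · refine Run.loop_frame (fun s₁ => s₁.var .h ≤ lcs X (N - k) (S (t - 1)) ∧
        s₁.time ≤ s.time + 2 * k + 1 + s₁.var .h) (fun s₁ => lcs X (N - k) (S (t - 1)) - s₁.var .h)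
        ?_ ?_ ?_ ?_
      · simp; omega
      · rintro s₁ - hf₁
        have v1 : s₁.var d = N - k := by rw [hf₁.var d rfl]; simp
        have v2 : s₁.var e = S (t - 1) := by rw [hf₁.var e rfl]; simp
        simp [v1, v2]; omega
      · rintro s₁ ⟨g1, g2⟩ hf₁ hc
        have v1 : s₁.var d = N - k := by rw [hf₁.var d rfl]; simp
        have v2 : s₁.var e = S (t - 1) := by rw [hf₁.var e rfl]; simp
        have a1 : s₁.arr .X = s.arr .X := by rw [hf₁.arr .X rfl]; simp [e2]
        have hle := le_lcs_iff.1 g1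
        have hc' : X (N - k - s₁.var .h) = X (S (t - 1) - s₁.var .h) := by
          by_contra hcon
          simp [v1, v2, a1, hXs (N - k - s₁.var .h) (by omega),
            hXs (S (t - 1) - s₁.var .h) (by omega), hcon] at hc
        have hpos : ∀ a b, a ≤ N → b ≤ N → X a = X b → a = 0 → b = 0 := by
          intro a b _ hb hab ha
          by_contra hcon
          have := hX.pos b (by omega) hb
          rw [ha, hX.zero] at hab; omega
        have p1 := hpos _ _ (by omega) (by omega) hc'
        have p2 := hpos _ _ (by omega) (by omega) hc'.symm
        have hle' : s₁.var .h + 1 ≤ lcs X (N - k) (S (t - 1)) := by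
          refine le_lcs_iff.2 ⟨by omega, by omega, fun i hi => ?_⟩
          by_cases hih : i = s₁.var .h
          · rw [hih]; exact hc'
          · exact hle.2.2 i (by omega)
        rw [run_set]
        simp
        omega
      · rintro s₁ ⟨g1, g2⟩ hf₁ hc
        have v1 : s₁.var d = N - k := by rw [hf₁.var d rfl]; simp
        have v2 : s₁.var e = S (t - 1) := by rw [hf₁.var e rfl]; simp
        have a1 : s₁.arr .X = s.arr .X := by rw [hf₁.arr .X rfl]; simp [e2]
        refine ⟨?_, g2⟩
        by_contra hcon
        have hlt : s₁.var .h < lcs X (N - k) (S (t - 1)) := by omega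
        have := (le_lcs_iff.1 (le_refl (lcs X (N - k) (S (t - 1))))).2.2 _ hlt
        simp [v1, v2, a1, hXs (N - k - s₁.var .h) (by omega),
          hXs (S (t - 1) - s₁.var .h) (by omega), this] at hc
    rintro s₁ ⟨⟨g1, g2⟩, hf₁⟩
    have v1 : s₁.var d = N - k := by rw [hf₁.var d rfl]; simp
    have a3 : s₁.arr (.rk lev) = R := by rw [hf₁.arr (.rk lev) rfl]; simp [e3]
    have a4 : s₁.arr (.hh lev) = s'.arr (.hh lev) := by rw [hf₁.arr (.hh lev) rfl]; simp
    have hle := lcs_le_left (X := X) (N - k) (S (t - 1))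
    rw [run_seq, run_put, run_set]
    simp only [eval_arr, eval_var, HState.put_var, HState.put_arr, HState.set_var,
      HState.set_arr, eval_sub, safe_sub, safe_arr, safe_var, safe_ofNat, eval_ofNat, a3, a4, v1,
      hRd, reduceCtorEq, if_false, if_true, true_and, and_true, HState.set_time, HState.put_time]
    refine ⟨by omega, by omega, by omega, fun x hx1 hx2 => ?_, fun hk' => ?_, by omega, by omega⟩
    · by_cases hx : x = N - k
      · subst hx; rw [hRd, Function.update_self, g1]
      · rw [Function.update_of_ne]
        · exact h1 x (by omega) hx2
        · obtain ⟨u, hu, rfl⟩ := hsa.surj hx2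
          rw [hrk u hu]; rintro rfl
          exact hx htd
    · have := hsa.lcs_pred hrk (d := N - k) (by omega) (by omega)
      rw [hRd, ← g1, Nat.sub_sub] at this
      omega
  · rintro s' ⟨⟨h1, -, h3, h4⟩, -⟩
    refine ⟨fun t ht1 ht2 => ?_, by omega⟩
    have := h1 (S t) (by have := hsa.pos t ht1 ht2; omega) (hsa.le t ht1 ht2)
    rwa [hrk t ht2, lcs_comm] at this

/-! ### Range minima -/

/-- The exponent B found here is ⌊log₂ N⌋, later the length of a block. Masks of B bits are less
than 2 ^ B ≤ N, so tables indexed by masks have linear size. -/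
def powers : Prog :=
  .set b 0 ;; .set pw 1 ;; .put .pow 0 1 ;;
  .loop (.lt (pw * 2) (tot + 1)) (.set b (b + 1) ;; .set pw (pw * 2) ;; .put .pow b pw)

theorem powers_spec {s : St} {N : ℕ} (htot : s.var tot = N) (hN : 1 ≤ N) (hL : 2 * N + 2 < M.L) :
    Run M powers s (fun s' => ((∃ B, s'.var b = B ∧ s'.var pw = 2 ^ B ∧ 2 ^ B ≤ N ∧
      N < 2 ^ (B + 1) ∧ (∀ k ≤ B, s'.arr .pow k = 2 ^ k) ∧ s'.time ≤ s.time + N) ∧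
      Frame powers s s')) := by
  refine Run.frame ?_
  rw [powers, run_seq, run_set, run_seq, run_set, run_seq, run_put]
  refine ⟨by simp; omega, by simp; omega, by simp; omega, by simp; omega, by simp; omega, ?_⟩
  refine Run.loop_frame (fun s' => ∃ B, s'.var b = B ∧ s'.var pw = 2 ^ B ∧ 2 ^ B ≤ N ∧
      (∀ k ≤ B, s'.arr .pow k = 2 ^ k) ∧ s'.time = s.time + B)
    (fun s' => N - s'.var b) ?_ ?_ ?_ ?_
  · exact ⟨0, by simp; omega⟩
  · rintro s' ⟨B, h1, h2, h3, h4, h5⟩ hf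
    have : s'.var tot = N := by rw [hf.var tot rfl]; simpa
    simp [this, h2]
    omega
  · rintro s' ⟨B, h1, h2, h3, h4, h5⟩ hf hc
    have : s'.var tot = N := by rw [hf.var tot rfl]; simpa
    have hc' : 2 ^ B * 2 ≤ N := by
      by_contra hcon
      simp [this, h2] at hc; omega
    have hB : B < 2 ^ B := Nat.lt_two_pow_self
    rw [run_seq, run_set, run_seq, run_set, run_put]
    simp only [eval_add, eval_mul, eval_var, safe_add, safe_mul, safe_var, eval_ofNat, safe_ofNat,
      HState.set_var, HState.tick_var, HState.set_arr, HState.tick_arr, HState.put_var,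
      HState.put_arr, HState.put_time, HState.set_time, HState.tick_time, h1, h2, reduceCtorEq,
      if_true, if_false, true_and, and_true]
    refine ⟨by omega, by omega, by omega, ⟨B + 1, rfl, by ring, by rw [pow_succ]; omega,
      fun k hk => ?_, by omega⟩, by omega⟩
    rw [Function.update_apply]
    split_ifs with hkB
    · rw [hkB]; ring
    · exact h4 k (by omega)
  · rintro s' ⟨B, h1, h2, h3, h4, h5⟩ hf hc
    have : s'.var tot = N := by rw [hf.var tot rfl]; simpa
    have hB : B < 2 ^ B := Nat.lt_two_pow_self
    refine ⟨B, h1, h2, h3, ?_, h4, by omega⟩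
    by_contra hcon
    rw [pow_succ] at hcon
    simp [this, h2] at hc; omega

def bitTables : Prog :=
  .set i 1 ;; .for i pw (.ite (i % 2) (.put .lsb i 0) (.put .lsb i (.arr .lsb (i / 2) + 1))) ;;
  .put .log 0 0 ;; .put .log 1 0 ;;
  .set i 2 ;; .for i (tot + 1) (.put .log i (.arr .log (i / 2) + 1))

/-- `p` is the position of the lowest bit of `x`. -/
def IsLsb (x p : ℕ) : Prop := x.testBit p = true ∧ ∀ q < p, x.testBit q = false

theorem IsLsb.odd {x : ℕ} (h : x % 2 = 1) : IsLsb x 0 :=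
  ⟨by simp [Nat.testBit_zero, h], by simp⟩

theorem IsLsb.even {x p : ℕ} (h : x % 2 = 0) (hp : IsLsb (x / 2) p) : IsLsb x (p + 1) := by
  refine ⟨by rw [Nat.testBit_succ]; exact hp.1, fun q hq => ?_⟩
  cases q with
  | zero => simp [Nat.testBit_zero, h]
  | succ q => rw [Nat.testBit_succ]; exact hp.2 q (by omega)

theorem IsLsb.lt {x p B : ℕ} (h : IsLsb x p) (hx : x < 2 ^ B) : p < B := by
  by_contra hcon
  have := Nat.testBit_lt_two_pow (hx.trans_le (Nat.pow_le_pow_right two_pos (not_lt.1 hcon)))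
  rw [h.1] at this
  simp at this

theorem bitTables_spec {s : St} {N B : ℕ} (htot : s.var tot = N) (hN : 2 ≤ N)
    (hpw : s.var pw = 2 ^ B) (hB : 2 ^ B ≤ N) (hL : 2 * N + 2 < M.L) :
    Run M bitTables s (fun s' => ((∀ x, 1 ≤ x → x < 2 ^ B → IsLsb x (s'.arr .lsb x)) ∧
      (∀ x ≤ N, s'.arr .log x = Nat.log 2 x) ∧ s'.time ≤ s.time + 2 * N) ∧
      Frame bitTables s s') := by
  refine Run.frame ?_
  have hB1 : 1 ≤ 2 ^ B := Nat.one_le_two_pow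
  have hBB : B < 2 ^ B := Nat.lt_two_pow_self
  rw [bitTables, run_seq, run_set]
  refine ⟨by simp; omega, ?_⟩
  refine Run.seq (Run.frame (Run.for (fun k s' => ∀ x, 1 ≤ x → x < k → IsLsb x (s'.arr .lsb x))
    1 (2 ^ B) 0 (by simp) hB1 (by omega) (by intro x; omega) (fun s' hf => ?_) rfl ?_)) ?_
  · have : s'.var pw = 2 ^ B := by rw [hf.var pw rfl]; simpa
    simp [this]
  · rintro k s' hk0 hk h1 hf hik
    rw [run_ite, run_put, run_put]
    simp only [eval_add, eval_mod, eval_div, eval_arr, eval_var, safe_add, safe_mod, safe_div,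
      safe_var, safe_arr, eval_ofNat, safe_ofNat,
      HState.set_var, HState.tick_var, HState.set_arr, HState.tick_arr, HState.put_var,
      HState.put_arr, HState.put_time, HState.set_time, HState.tick_time, hik, reduceCtorEq,
      if_true, if_false, true_and, and_true]
    refine ⟨by omega, fun hodd => ⟨by omega, by omega, fun x hx0 hx => ?_, by omega⟩, fun heven => ?_⟩
    · rw [Function.update_apply]
      split_ifs with hxk
      · exact IsLsb.odd (by omega)
      · exact h1 x hx0 (by omega)
    · have h2 := h1 (k / 2) (by omega) (by omega)
      have h3 := h2.lt (B := B) (by omega)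
      refine ⟨⟨by omega, by omega, by omega⟩, by omega, fun x hx0 hx => ?_, by omega⟩
      rw [Function.update_apply]
      split_ifs with hxk
      · rw [hxk]; exact IsLsb.even heven h2
      · exact h1 x hx0 (by omega)
  rintro s₁ ⟨⟨h1, -, ht1⟩, hf1⟩
  have v1 : s₁.var tot = N := by rw [hf1.var tot rfl]; simpa
  rw [run_seq, run_put, run_seq, run_put, run_seq, run_set]
  refine ⟨by simp; omega, by simp; omega, by simp; omega, by simp; omega, by simp; omega,
    by simp; omega, by simp; omega, ?_⟩
  refine ((Run.for (fun k s' => ∀ x < k, s'.arr .log x = Nat.log 2 x)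
    2 (N + 1) 0 (by simp) (by omega) (by omega) ?_ (fun s' hf => ?_) rfl ?_).frame).mono ?_
  · intro x hx
    interval_cases x <;> simp
  · have : s'.var tot = N := by rw [hf.var tot rfl]; simpa
    simp [this]; omega
  · rintro k s' hk0 hk h2 hf hik
    have e := h2 (k / 2) (by omega)
    have e2 := Nat.log_le_self 2 (k / 2)
    rw [run_put]
    simp only [eval_add, eval_mod, eval_div, eval_arr, eval_var, safe_add, safe_mod, safe_div,
      safe_var, safe_arr, eval_ofNat, safe_ofNat,
      HState.set_var, HState.tick_var, HState.set_arr, HState.tick_arr, HState.put_var,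
      HState.put_arr, HState.put_time, HState.set_time, HState.tick_time, hik, reduceCtorEq,
      if_true, if_false, true_and, and_true, e]
    refine ⟨⟨by omega, by omega, by omega⟩, by omega, fun x hx => ?_, by omega⟩
    rw [Function.update_apply]
    split_ifs with hxk
    · rw [hxk, Nat.log_of_one_lt_of_le (by omega) hk0]
    · exact h2 x (by omega)
  · rintro s' ⟨⟨h2, -, ht2⟩, hf2⟩
    simp at ht1 ht2
    refine ⟨?_, fun x hx => h2 x (by omega), by omega⟩
    rw [hf2.arr .lsb rfl]
    simpa using h1

/-- Bit `k` of `m` tells whether `H (o + k)` is less than all `H j` with `o + k < j < r`. -/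
def IsMask (H : ℕ → ℕ) (o r m : ℕ) : Prop :=
  ∀ k, m.testBit k = true ↔ o + k < r ∧ ∀ j, o + k < j → j < r → H (o + k) < H j

/-! ### Bit masks for minima inside a block -/

section Mask

variable {H : ℕ → ℕ}

theorem IsMask.lt {o r m : ℕ} (h : IsMask H o r m) : m < 2 ^ (r - o) := by
  refine Nat.lt_pow_two_of_testBit m fun i hi => ?_
  by_contra hcon
  have := ((h i).1 (by simpa using hcon)).1
  omega

/-- The marked positions are the strict minima of the suffixes, and the values of H increase along
them. Every j in [l, r) is dominated by a marked position not before j, so the first marked position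
from l on carries the minimum. -/
theorem IsMask.isMin {o r l m p : ℕ} (h : IsMask H o r m) (hl : o ≤ l)
    (hp : IsLsb (m / 2 ^ (l - o)) p) : IsMin H l r (H (l + p)) := by
  have hbit : ∀ k, (m / 2 ^ (l - o)).testBit k = m.testBit (l - o + k) := fun k => by
    rw [← Nat.shiftRight_eq_div_pow, Nat.testBit_shiftRight]
  have h1 := hp.1
  rw [hbit, h] at h1
  rw [show o + (l - o + p) = l + p by omega] at h1
  -- Induction on the distance to the right end: if j is not marked, some later position has a value
  -- at most H j.
  have key : ∀ i j, i + j + 1 = r → l ≤ j → ∃ q, j ≤ l + q ∧ m.testBit (l - o + q) = true ∧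
      H (l + q) ≤ H j := by
    intro i
    induction i using Nat.strong_induction_on with
    | _ i ih =>
      intro j hij hlj
      by_cases hb : m.testBit (j - o) = true
      · refine ⟨j - l, by omega, ?_, ?_⟩
        · rwa [show l - o + (j - l) = j - o by omega]
        · rw [show l + (j - l) = j by omega]
      · rw [h, not_and, show o + (j - o) = j by omega] at hb
        have hb := hb (by omega)
        push Not at hb
        obtain ⟨j', h2, h3, h4⟩ := hb
        obtain ⟨q, h5, h6, h7⟩ := ih (r - 1 - j') (by omega) j' (by omega) (by omega)
        exact ⟨q, by omega, h6, h7.trans h4⟩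
  refine ⟨⟨l + p, by omega, h1.1, rfl⟩, fun j hj1 hj2 => ?_⟩
  obtain ⟨q, h5, h6, h7⟩ := key (r - 1 - j) j (by omega) hj1
  have hpq : p ≤ q := by
    by_contra hcon
    have := hp.2 q (by omega)
    rw [hbit, h6] at this
    simp at this
  rcases hpq.eq_or_lt with rfl | hpq
  · exact h7
  · have h8 := (h _).1 h6
    have := h1.2 (l + q) (by omega) (by omega)
    omega

theorem IsMask.ne_zero {o r l m : ℕ} (h : IsMask H o r m) (hl : o ≤ l) (hr : l < r) :
    m / 2 ^ (l - o) ≠ 0 := by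
  have h1 : m.testBit (r - 1 - o) = true := by
    rw [h]; exact ⟨by omega, fun j _ _ => by omega⟩
  have h2 := Nat.ge_two_pow_of_testBit h1
  have h3 : 2 ^ (l - o) ≤ 2 ^ (r - 1 - o) := Nat.pow_le_pow_right two_pos (by omega)
  have := Nat.div_pos (h3.trans h2) (by positivity)
  omega

theorem testBit_log {a : ℕ} (ha : a ≠ 0) : a.testBit (Nat.log 2 a) = true := by
  have h1 : 2 ^ Nat.log 2 a ≤ a := Nat.pow_log_le_self 2 ha
  have h2 : a < 2 ^ (Nat.log 2 a + 1) := Nat.lt_pow_succ_log_self (by norm_num) a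
  generalize Nat.log 2 a = t at *
  obtain ⟨v, rfl⟩ := Nat.exists_eq_add_of_le h1
  rw [Nat.testBit_two_pow_add_eq, Nat.testBit_lt_two_pow (by rw [pow_succ] at h2; omega)]
  rfl

theorem testBit_sub_log {a k : ℕ} (ha : a ≠ 0) :
    (a - 2 ^ Nat.log 2 a).testBit k = true ↔ a.testBit k = true ∧ k ≠ Nat.log 2 a := by
  have h1 : 2 ^ Nat.log 2 a ≤ a := Nat.pow_log_le_self 2 ha
  have h2 : a < 2 ^ (Nat.log 2 a + 1) := Nat.lt_pow_succ_log_self (by norm_num) a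
  generalize Nat.log 2 a = t at *
  obtain ⟨v, rfl⟩ := Nat.exists_eq_add_of_le h1
  have hv : v < 2 ^ t := by rw [pow_succ] at h2; omega
  rw [Nat.add_sub_cancel_left]
  rcases lt_trichotomy k t with hk | rfl | hk
  · rw [Nat.testBit_two_pow_add_gt hk]
    simp [hk.ne]
  · simp [Nat.testBit_lt_two_pow hv]
  · have hlt : 2 ^ t + v < 2 ^ k :=
      h2.trans_le (Nat.pow_le_pow_right two_pos hk)
    rw [Nat.testBit_lt_two_pow hlt, Nat.testBit_lt_two_pow (by omega)]
    simp

theorem testBit_add_two_pow {a q k : ℕ} (ha : a < 2 ^ q) :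
    (a + 2 ^ q).testBit k = true ↔ a.testBit k = true ∨ k = q := by
  rw [add_comm]
  rcases lt_trichotomy k q with hk | rfl | hk
  · rw [Nat.testBit_two_pow_add_gt hk]
    simp [hk.ne]
  · simp [Nat.testBit_two_pow_add_eq, Nat.testBit_lt_two_pow ha]
  · have hlt : 2 ^ q + a < 2 ^ k := by
      have : 2 ^ (q + 1) ≤ 2 ^ k := Nat.pow_le_pow_right two_pos hk
      rw [pow_succ] at this; omega
    rw [Nat.testBit_lt_two_pow hlt, Nat.testBit_lt_two_pow (by omega)]
    simp [hk.ne']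

/-- The number of ones among the lowest `B` bits of `a`. -/
def ones (B a : ℕ) : ℕ := ((Finset.range B).filter (fun k => a.testBit k = true)).card

theorem ones_zero (B : ℕ) : ones B 0 = 0 := by simp [ones]

theorem ones_sub_log {B a : ℕ} (ha : a ≠ 0) (hB : a < 2 ^ B) :
    ones B (a - 2 ^ Nat.log 2 a) + 1 = ones B a := by
  have h1 : Nat.log 2 a < B := Nat.log_lt_of_lt_pow ha hB
  have : (Finset.range B).filter (fun k => (a - 2 ^ Nat.log 2 a).testBit k = true) =
      ((Finset.range B).filter (fun k => a.testBit k = true)).erase (Nat.log 2 a) := by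
    ext k
    simp only [Finset.mem_filter, Finset.mem_erase, testBit_sub_log ha]
    tauto
  rw [ones, this, Finset.card_erase_add_one, ones]
  simp only [Finset.mem_filter, Finset.mem_range, h1, true_and]
  exact testBit_log ha

theorem ones_add_two_pow {B a q : ℕ} (ha : a < 2 ^ q) : ones B (a + 2 ^ q) ≤ ones B a + 1 := by
  have : (Finset.range B).filter (fun k => (a + 2 ^ q).testBit k = true) ⊆
      insert q ((Finset.range B).filter (fun k => a.testBit k = true)) := by
    intro k
    simp only [Finset.mem_filter, Finset.mem_insert, testBit_add_two_pow ha]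
    tauto
  exact (Finset.card_le_card this).trans (Finset.card_insert_le _ _)

end Mask

/-- The mask acts as a stack whose top is its highest bit. The product is the conjunction of "not
empty" and "the top value is not below the new one". -/
def popMask (lev : Bool) : Prog :=
  .loop (.lt 0 a * (1 - .lt (.arr (.hh lev) (bs + .arr .log a)) (.arr (.hh lev) i)))
    (.set a (a - .arr .pow (.arr .log a)))

theorem popMask_spec (lev : Bool) {s : St} {N B o r : ℕ} (hB : 2 ^ B ≤ N)
    (hlog : ∀ x ≤ N, s.arr .log x = Nat.log 2 x) (hpow : ∀ k ≤ B, s.arr .pow k = 2 ^ k)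
    (hbs : s.var bs = o) (hi : s.var i = r) (hr : r ≤ N) (hor : o ≤ r)
    (hro : r < o + B) (hL : 2 * N + 2 < M.L) (hmask : IsMask (s.arr (.hh lev)) o r (s.var a)) :
    Run M (popMask lev) s (fun s' => (s'.var a < 2 ^ (r - o) ∧
      IsMask (s.arr (.hh lev)) o (r + 1) (s'.var a + 2 ^ (r - o)) ∧
      s'.time + ones B (s'.var a) = s.time + ones B (s.var a)) ∧ Frame (popMask lev) s s') := by
  refine Run.frame ?_
  have hBB : B < 2 ^ B := Nat.lt_two_pow_self
  generalize hH : s.arr (.hh lev) = H at *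
  generalize hA : s.var a = a0 at *
  have hlt := hmask.lt
  have hroB : 2 ^ (r - o) ≤ 2 ^ B := Nat.pow_le_pow_right two_pos (by omega)
  -- Bits are only removed, and only those whose value is at least H r. Each iteration clears
  -- exactly one, so the clock plus the number of ones is constant.
  refine Run.loop_frame (fun s' => ∃ a', s'.var a = a' ∧
      (∀ k, a'.testBit k = true → a0.testBit k = true) ∧
      (∀ k, a0.testBit k = true → a'.testBit k = true ∨ H r ≤ H (o + k)) ∧ a' ≤ a0 ∧
      s'.time + ones B a' = s.time + ones B a0)
    (fun s' => s'.var a) ?_ ?_ ?_ ?_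
  · exact ⟨a0, hA, by simp, by tauto, le_rfl, rfl⟩
  · rintro s' ⟨a', h1, h2, h3, h4, h5⟩ hf
    have e1 : s'.arr .log = s.arr .log := hf.arr .log rfl
    have e2 : s'.var bs = o := by rw [hf.var bs rfl, hbs]
    have e3 : s'.var i = r := by rw [hf.var i rfl, hi]
    have := hlog a' (by omega)
    have h6 := Nat.log_le_self 2 a'
    simp only [safe_mul, safe_lt, safe_ofNat, safe_var, safe_sub, safe_arr, safe_add, eval_mul,
      eval_lt, eval_sub, eval_arr, eval_add, eval_var, eval_ofNat, e1, e2, e3, h1, this, true_and, and_true]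
    and_intros
    any_goals omega
    have h7 : ∀ x y : ℕ, x ≤ 1 → y ≤ 1 → x * y ≤ 1 * 1 := fun x y hx hy => Nat.mul_le_mul hx hy
    refine (h7 _ _ ?_ (Nat.sub_le _ _)).trans_lt ?_
    · split_ifs <;> omega
    · omega
  · rintro s' ⟨a', h1, h2, h3, h4, h5⟩ hf hc
    have e1 : s'.arr .log = s.arr .log := hf.arr .log rfl
    have e2 : s'.var bs = o := by rw [hf.var bs rfl, hbs]
    have e3 : s'.var i = r := by rw [hf.var i rfl, hi]
    have e4 : s'.arr .pow = s.arr .pow := hf.arr .pow rfl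
    have e5 : s'.arr (.hh lev) = H := by rw [hf.arr (.hh lev) rfl, hH]
    have h6 := hlog a' (by omega)
    have ha : a' ≠ 0 := by rintro rfl; simp [h1] at hc
    have hcmp : H r ≤ H (o + Nat.log 2 a') := by
      by_contra hcon
      simp [h1, e1, e2, e3, e5, h6, not_le.1 hcon] at hc
    have h7 : Nat.log 2 a' < B := Nat.log_lt_of_lt_pow ha (by omega)
    have h8 := hpow (Nat.log 2 a') (by omega)
    have h9 := ones_sub_log (B := B) ha (by omega)
    have h10 : 2 ^ Nat.log 2 a' ≤ a' := Nat.pow_log_le_self 2 ha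
    have h11 : 0 < 2 ^ Nat.log 2 a' := by positivity
    rw [run_set]
    simp only [eval_sub, eval_arr, eval_var, safe_sub, safe_arr, safe_var, HState.set_var,
      HState.tick_var, HState.tick_arr, HState.set_time, HState.tick_time, e1, e4, h1, h6, h8,
      if_true, true_and, and_true]
    refine ⟨by omega, ⟨_, rfl, fun k hk => ?_, fun k hk => ?_, by omega, by omega⟩, by omega⟩
    · exact h2 k ((testBit_sub_log ha).1 hk).1
    · rcases h3 k hk with h | h
      · by_cases hkl : k = Nat.log 2 a'
        · rw [hkl]; exact Or.inr hcmp
        · exact Or.inl ((testBit_sub_log ha).2 ⟨h, hkl⟩)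
      · exact Or.inr h
  · rintro s' ⟨a', h1, h2, h3, h4, h5⟩ hf hc
    have e1 : s'.arr .log = s.arr .log := hf.arr .log rfl
    have e2 : s'.var bs = o := by rw [hf.var bs rfl, hbs]
    have e3 : s'.var i = r := by rw [hf.var i rfl, hi]
    have e5 : s'.arr (.hh lev) = H := by rw [hf.arr (.hh lev) rfl, hH]
    have h6 := hlog a' (by omega)
    rw [h1]
    refine ⟨by omega, fun k => ?_, h5⟩
    -- The values increase along the stack, so once the top is below H r, all remaining entries are.
    have hgood : ∀ k, a'.testBit k = true → H (o + k) < H r := by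
      intro k hk
      have ha : a' ≠ 0 := by rintro rfl; simp at hk
      have hcmp : H (o + Nat.log 2 a') < H r := by
        by_contra hcon
        simp [h1, e1, e2, e3, e5, h6, hcon, Nat.pos_of_ne_zero ha] at hc
      have hkl : k ≤ Nat.log 2 a' := Nat.le_log_of_pow_le (by norm_num) (Nat.ge_two_pow_of_testBit hk)
      have hl : a0.testBit (Nat.log 2 a') = true := h2 _ (testBit_log ha)
      rcases hkl.eq_or_lt with rfl | hkl
      · exact hcmp
      · exact (((hmask k).1 (h2 k hk)).2 (o + Nat.log 2 a') (by omega) ((hmask _).1 hl).1).trans hcmp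
    rw [testBit_add_two_pow (by omega)]
    constructor
    · rintro (hk | rfl)
      · have h7 := (hmask k).1 (h2 k hk)
        refine ⟨by omega, fun j hj1 hj2 => ?_⟩
        by_cases hjr : j = r
        · rw [hjr]; exact hgood k hk
        · exact h7.2 j hj1 (by omega)
      · exact ⟨by omega, fun j _ _ => by omega⟩
    · rintro ⟨hk1, hk2⟩
      by_cases hkr : k = r - o
      · exact Or.inr hkr
      · refine Or.inl ?_
        have h8 := hk2 r (by omega) (by omega)
        rcases h3 k ((hmask k).2 ⟨by omega, fun j hj1 hj2 => hk2 j hj1 (by omega)⟩) with h | h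
        · exact h
        · omega

/-- The stack is emptied at the start of every block. An assignment like `a := a` stands for the
empty statement. -/
def masks (lev : Bool) : Prog :=
  .set a 0 ;; .set bs 0 ;; .set i 0 ;; .for i (tot + 1) (
    .ite (.eq i (bs + b)) (.set bs i ;; .set a 0) (.set a a) ;;
    popMask lev ;; .set a (a + .arr .pow (i - bs)) ;; .put (.mask lev) i a)

theorem masks_spec (lev : Bool) {s : St} {N B : ℕ} (htot : s.var tot = N) (hb : s.var b = B)
    (hB1 : 1 ≤ B) (hB : 2 ^ B ≤ N)
    (hlog : ∀ x ≤ N, s.arr .log x = Nat.log 2 x) (hpow : ∀ k ≤ B, s.arr .pow k = 2 ^ k)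
    (hL : 3 * N + 2 < M.L) :
    Run M (masks lev) s (fun s' => ((∀ r ≤ N,
        IsMask (s.arr (.hh lev)) (r - r % B) (r + 1) (s'.arr (.mask lev) r)) ∧
      s'.time ≤ s.time + 2 * (N + 1)) ∧ Frame (masks lev) s s') := by
  refine Run.frame ?_
  have hBB : B < 2 ^ B := Nat.lt_two_pow_self
  rw [masks, run_seq, run_set, run_seq, run_set, run_seq, run_set]
  refine ⟨by simp; omega, by simp; omega, by simp; omega, ?_⟩
  -- The number of ones is the potential: each position pushes at most one bit, which can be popped
  -- once, whence 2 k.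
  refine (Run.for_inv (fun k s' => (∃ o a0, s'.var bs = o ∧ s'.var a = a0 ∧ o % B = 0 ∧ o ≤ k ∧
        k ≤ o + B ∧ IsMask (s.arr (.hh lev)) o k a0 ∧ s'.time + ones B a0 ≤ s.time + 2 * k) ∧
      ∀ r < k, IsMask (s.arr (.hh lev)) (r - r % B) (r + 1) (s'.arr (.mask lev) r)) 0 (N + 1)
    (by simp) (by omega) (by omega) ?_ (fun s' hf => ?_) rfl ?_).mono ?_
  · refine ⟨⟨0, 0, by simp, by simp, by simp, le_rfl, by omega, ?_, by simp [ones_zero]⟩, by simp⟩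
    intro k; simp
  · have : s'.var tot = N := by rw [hf.var tot rfl]; simpa
    simp [this]; omega
  · rintro k s' _ hk ⟨⟨o, a0, v1, v2, ho, hok, hko, hm, ht⟩, hI⟩ hf hik
    have e1 : s'.arr .log = s.arr .log := by rw [hf.arr .log rfl]; simp
    have e2 : s'.arr .pow = s.arr .pow := by rw [hf.arr .pow rfl]; simp
    have e3 : s'.var b = B := by rw [hf.var b rfl]; simpa
    have e4 : s'.arr (.hh lev) = s.arr (.hh lev) := by rw [hf.arr (.hh lev) rfl]; simp
    refine Run.seq (R := fun s₁ => (∃ o a0, s₁.var bs = o ∧ s₁.var a = a0 ∧ o % B = 0 ∧ o ≤ k ∧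
        k < o + B ∧ IsMask (s.arr (.hh lev)) o k a0 ∧
        s₁.time + ones B a0 ≤ s.time + 2 * k + 1) ∧ s₁.arr = s'.arr ∧ s₁.var i = k) ?_ ?_
    · rw [run_ite, run_seq, run_set, run_set, run_set]
      simp only [safe_eq, safe_add, safe_var, eval_eq, eval_add, eval_var, eval_ofNat, safe_ofNat,
        HState.set_var, HState.set_arr, HState.tick_var, HState.tick_arr, HState.set_time,
        HState.tick_time, v1, v2, e3, hik, reduceCtorEq, if_true, if_false, true_and, and_true]
      refine ⟨by omega, fun hc => ⟨by omega, ⟨k, 0, rfl, rfl, ?_, by omega, by omega, ?_, ?_⟩⟩,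
        fun hc => ⟨o, a0, rfl, rfl, ho, hok, ?_, hm, by omega⟩⟩
      · have : k = o + B := by by_contra h; simp [h] at hc
        rw [this]; simp [ho]
      · intro j; simp
      · rw [ones_zero]; omega
      · have : k ≠ o + B := by intro h; simp [h] at hc
        omega
    rintro s₁ ⟨⟨o, a0, v1, v2, ho, hok, hko, hm, ht⟩, hA, hik1⟩
    refine Run.seq (popMask_spec (M := M) (s := s₁) lev (N := N) (B := B) (o := o) (r := k) hB
      (by rwa [hA, e1]) (by rwa [hA, e2]) v1 hik1 (by omega) hok hko (by omega)
      (by rw [hA, e4, v2]; exact hm)) ?_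
    rintro s₂ ⟨⟨h1, h2, h3⟩, hf2⟩
    have w1 : s₂.var bs = o := by rw [hf2.var bs rfl, v1]
    have w2 : s₂.var i = k := by rw [hf2.var i rfl, hik1]
    have w3 : s₂.arr .pow = s.arr .pow := by rw [hf2.arr .pow rfl, hA, e2]
    have w4 : s₂.arr (.mask lev) = s'.arr (.mask lev) := by rw [hf2.arr (.mask lev) rfl, hA]
    have w5 := hpow (k - o) (by omega)
    have hroB : 2 ^ (k - o) ≤ 2 ^ B := Nat.pow_le_pow_right two_pos (by omega)
    have h4 := ones_add_two_pow (B := B) h1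
    rw [hA, e4] at h2
    rw [v2] at h3
    rw [run_seq, run_set, run_put]
    simp only [safe_eq, safe_add, safe_var, eval_eq, eval_add, eval_var, eval_ofNat, safe_ofNat,
      safe_arr, eval_arr, safe_sub, eval_sub, HState.put_var, HState.put_arr, HState.put_time,
      HState.set_var, HState.set_arr, HState.tick_var, HState.tick_arr, HState.set_time,
      HState.tick_time, w1, w2, w3, w4, w5, reduceCtorEq, if_true, if_false, true_and, and_true]
    refine ⟨by omega, by omega, ⟨o, _, rfl, rfl, ho, by omega, by omega, h2, by omega⟩,
      fun r hr => ?_⟩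
    rw [Function.update_apply]
    split_ifs with hrk
    · obtain ⟨x, hx⟩ := Nat.dvd_of_mod_eq_zero ho
      have : r % B = r - o := by
        rw [hrk, show k = (k - o) + B * x by omega, Nat.add_mul_mod_self_left,
          Nat.mod_eq_of_lt (by omega)]
        omega
      rw [this, show r - (r - o) = o by omega, hrk]
      exact h2
    · exact hI r (by omega)
  · rintro s' ⟨⟨⟨o, a0, -, -, -, -, -, -, ht⟩, h⟩, -⟩
    exact ⟨fun r hr => h r (by omega), by omega⟩

/-- The tables that do not depend on the string are present. -/
structure Tables (N B : ℕ) (s : St) : Prop where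
  tot : s.var tot = N
  str : s.var str = N + 1
  b : s.var b = B
  one_le : 1 ≤ B
  pow_le : 2 ^ B ≤ N
  lt_pow : N < 2 ^ (B + 1)
  pow : ∀ k ≤ B, s.arr .pow k = 2 ^ k
  lsb : ∀ x, 1 ≤ x → x < 2 ^ B → IsLsb x (s.arr .lsb x)
  log : ∀ x ≤ N, s.arr .log x = Nat.log 2 x

theorem Tables.frame {N B : ℕ} {s s' : St} (h : Tables N B s) {p : Prog} (hf : Frame p s s')
    (h1 : p.wv .tot = false) (h2 : p.wv .str = false) (h3 : p.wv .b = false)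
    (h4 : p.wa .pow = false) (h5 : p.wa .lsb = false) (h6 : p.wa .log = false) : Tables N B s' := by
  obtain ⟨g1, g2, g3, g4, g5, g6, g7, g8, g9⟩ := h
  refine ⟨?_, ?_, ?_, g4, g5, g6, ?_, ?_, ?_⟩
  · rw [hf.var _ h1, g1]
  · rw [hf.var _ h2, g2]
  · rw [hf.var _ h3, g3]
  · rw [hf.arr _ h4]; exact g7
  · rw [hf.arr _ h5]; exact g8
  · rw [hf.arr _ h6]; exact g9

theorem Tables.lt {N B : ℕ} {s : St} (h : Tables N B s) : B < N :=
  Nat.lt_two_pow_self.trans_le h.pow_le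

/-- The bit masks of the blocks of `H` of length `B`. -/
def IsMasks (H : ℕ → ℕ) (N B : ℕ) (m : ℕ → ℕ) : Prop :=
  ∀ r ≤ N, IsMask H (r - r % B) (r + 1) (m r)

/-- The sparse table of the minima of `H` over `2 ^ k` blocks of length `B`. -/
def IsSparse (H : ℕ → ℕ) (N B : ℕ) (f : ℕ → ℕ) : Prop :=
  ∀ k ≤ B, ∀ j, j + 2 ^ k ≤ (N + 1) / B → IsMin H (j * B) ((j + 2 ^ k) * B) (f (k * (N + 1) + j))

theorem mod_eq_of_div_eq {l r B : ℕ} (h : l / B = r / B) : r - r % B + l % B = l := by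
  have h1 := Nat.div_add_mod l B
  have h2 := Nat.div_add_mod r B
  rw [h] at h1
  omega

/-- Since l and r lie in the same block, l is at place l % B of the mask of r. Division by 2 ^ (l %
B) removes the positions before l, and the lowest remaining bit is the offset of the minimum from l.
-/
theorem Tables.inBlock {N B : ℕ} {s : St} (hT : Tables N B s) {H m : ℕ → ℕ}
    (hm : IsMasks H N B m) {l r : ℕ} (hlr : l ≤ r) (hr : r ≤ N) (h : l / B = r / B) :
    m r ≤ N ∧ l + s.arr .lsb (m r / s.arr .pow (l % B)) ≤ r ∧
      IsMin H l (r + 1) (H (l + s.arr .lsb (m r / s.arr .pow (l % B)))) := by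
  have h1 := mod_eq_of_div_eq h
  have h2 : l % B < B := Nat.mod_lt _ hT.one_le
  have h2' : r % B < B := Nat.mod_lt _ hT.one_le
  have h3 := hm r hr
  have h4 : m r < 2 ^ B := h3.lt.trans_le (Nat.pow_le_pow_right two_pos (by omega))
  have hlo : l - (r - r % B) = l % B := by omega
  rw [hT.pow _ (by omega)]
  have h5 := h3.ne_zero (l := l) (by omega) (by omega)
  rw [hlo] at h5
  have h6 : m r / 2 ^ (l % B) < 2 ^ B := (Nat.div_le_self _ _).trans_lt h4
  have h7 := hT.lsb _ (Nat.pos_of_ne_zero h5) h6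
  have h8 := h3.isMin (l := l) (p := s.arr .lsb (m r / 2 ^ (l % B))) (by omega) (by rwa [hlo])
  refine ⟨by have := hT.pow_le; omega, ?_, h8⟩
  have h9 := h7.1
  rw [← Nat.shiftRight_eq_div_pow, Nat.testBit_shiftRight] at h9
  have := ((h3 _).1 h9).1
  rw [← Nat.shiftRight_eq_div_pow]
  omega

def setMin (e : Ex) : Prog := .set t e ;; .ite (.lt t v) (.set v t) (.set v v)

theorem run_setMin {e : Ex} {s : St} {Q : St → Prop} : Run M (setMin e) s Q ↔
    e.Safe M s ∧ Q ((s.set t (e.eval M s)).set v (min (s.var v) (e.eval M s))) := by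
  rw [setMin, run_seq, run_set, run_ite, run_set, run_set]
  simp only [eval_lt, eval_var, safe_lt, safe_var, HState.set_var, reduceCtorEq, if_true, if_false,
    true_and, and_true]
  refine and_congr_right fun _ => ?_
  by_cases h : e.eval M s < s.var v
  · simp [h, min_eq_right h.le]
  · simp [h, min_eq_left (not_lt.1 h)]

/-- Row 0 holds the minima of the full blocks, read off the mask of the last position of each block.
An incomplete last block is left out, as it never lies strictly between two others. Rows are stored
at distance N + 1. -/
def sparse (lev : Bool) : Prog :=
  .set nb ((tot + 1) / b) ;; (.set j 0 ;; .for j nb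
    (.put (.sp lev) j (.arr (.hh lev) (j * b + .arr .lsb (.arr (.mask lev) (j * b + b - 1)))))) ;;
  .set i 1 ;; .for i (b + 1) (.set j 0 ;; .for j (nb + 1 - .arr .pow i) (
    .set v (.arr (.sp lev) ((i - 1) * str + j)) ;;
    setMin (.arr (.sp lev) ((i - 1) * str + (j + .arr .pow (i - 1)))) ;;
    .put (.sp lev) (i * str + j) v))

theorem sparse_spec (lev : Bool) {s : St} {N B : ℕ} (hT : Tables N B s)
    (hm : IsMasks (s.arr (.hh lev)) N B (s.arr (.mask lev))) (hL : N * (N + 1) + 3 * N + 4 < M.L) :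
    Run M (sparse lev) s (fun s' => (IsSparse (s.arr (.hh lev)) N B (s'.arr (.sp lev)) ∧
      s'.time ≤ s.time + 5 * N) ∧ Frame (sparse lev) s s') := by
  refine Run.frame ?_
  have hBN := hT.lt
  have hB1 := hT.one_le
  generalize hH : s.arr (.hh lev) = H at *
  generalize hK : s.arr (.mask lev) = K at *
  have hnb : (N + 1) / B * B ≤ N + 1 := Nat.div_mul_le_self _ _
  have hnb2 : (N + 1) / B ≤ N + 1 := Nat.div_le_self _ _
  rw [sparse, run_seq, run_set]
  refine ⟨by simp [hT.tot]; omega, ?_⟩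
  have he : (((tot + 1) / b : Ex)).eval M s = (N + 1) / B := by simp [hT.tot, hT.b]
  rw [he]
  generalize hnbe : (N + 1) / B = nB at *
  have hT0 : Tables N B (s.set nb nB) := ⟨hT.tot, hT.str, hT.b, hT.one_le, hT.pow_le, hT.lt_pow,
    hT.pow, hT.lsb, hT.log⟩
  refine Run.seq (R := fun s₁ => ((∀ j < nB, IsMin H (j * B) ((j + 1) * B) (s₁.arr (.sp lev) j)) ∧
    s₁.time ≤ s.time + nB) ∧ Frame _ (s.set nb nB) s₁) (Run.frame ?_) ?_
  · rw [run_seq, run_set]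
    refine ⟨by simp; omega, ?_⟩
    refine (Run.for (fun k s' => ∀ j < k, IsMin H (j * B) ((j + 1) * B) (s'.arr (.sp lev) j))
      0 nB 0 (by simp) (by omega) (by omega) (by simp) (fun s' hf => ?_) rfl ?_).mono ?_
    · have : s'.var nb = nB := by rw [hf.var nb rfl]; simp
      simp [this]
    · rintro k s' _ hk hI hf hik
      have e1 : s'.arr .lsb = s.arr .lsb := by rw [hf.arr .lsb rfl]; simp
      have e2 : s'.arr (.hh lev) = H := by rw [hf.arr (.hh lev) rfl]; simpa
      have e3 : s'.arr (.mask lev) = K := by rw [hf.arr (.mask lev) rfl]; simpa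
      have e4 : s'.var b = B := by rw [hf.var b rfl]; simpa using hT.b
      have h1 : (k + 1) * B ≤ nB * B := Nat.mul_le_mul_right B hk
      have h1' := add_mul k 1 B
      have h2 : k * B / B = k := Nat.mul_div_cancel _ (by omega)
      have h3 : (k * B + B - 1) / B = k := by
        rw [show k * B + B - 1 = (B - 1) + k * B by omega, Nat.add_mul_div_right _ _ (by omega),
          Nat.div_eq_of_lt (by omega)]
        omega
      obtain ⟨h4, h5, h6⟩ := hT.inBlock hm (l := k * B) (r := k * B + B - 1) (by omega) (by omega)
        (h2.trans h3.symm)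
      rw [Nat.mul_mod_left, hT.pow 0 (by omega), pow_zero, Nat.div_one] at h5 h6
      have h7 : k * B + B - 1 + 1 = (k + 1) * B := by omega
      rw [h7] at h6
      rw [run_put]
      simp only [eval_arr, eval_var, eval_add, eval_sub, eval_mul, eval_ofNat, safe_arr, safe_var,
        safe_add, safe_sub, safe_mul, safe_ofNat, HState.tick_var, HState.tick_arr, HState.put_arr,
        HState.put_time, HState.set_arr, HState.tick_time, e1, e2, e3, e4, hik, reduceCtorEq,
        if_true, if_false, true_and, and_true]
      and_intros
      any_goals omega
      intro j hj
      rw [Function.update_apply]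
      split_ifs with hjk
      · rw [hjk]; exact h6
      · exact hI j (by omega)
    · rintro s' ⟨h1, -, h2⟩
      exact ⟨h1, by simpa using h2⟩
  rintro s₁ ⟨⟨hS0, ht1⟩, hf1⟩
  have hT1 := hT0.frame hf1 rfl rfl rfl rfl rfl rfl
  have v1 : s₁.var nb = nB := by rw [hf1.var nb rfl]; simp
  rw [run_seq, run_set]
  refine ⟨by simp; omega, ?_⟩
  refine (Run.for (fun i s' => ∀ k < i, ∀ j, j + 2 ^ k ≤ nB →
      IsMin H (j * B) ((j + 2 ^ k) * B) (s'.arr (.sp lev) (k * (N + 1) + j)))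
      1 (B + 1) nB (by simp) (by omega) (by omega) ?_ (fun s' hf => ?_) rfl ?_).mono ?_
  · intro k hk j hj
    obtain rfl : k = 0 := by omega
    simpa using hS0 j (by simpa using hj)
  · have : s'.var b = B := by rw [hf.var b rfl]; simpa using hT1.b
    simp [this]; omega
  · rintro i s₂ hi1 hi hI hf2 hik
    have h2i : 2 ^ (i - 1) + 2 ^ (i - 1) = 2 ^ i := by
      obtain ⟨x, rfl⟩ := Nat.exists_eq_add_of_le' hi1
      rw [Nat.add_sub_cancel, pow_succ]; ring
    have hiB : 2 ^ i ≤ 2 ^ B := Nat.pow_le_pow_right two_pos (by omega)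
    have h2p := hT.pow_le
    have hpp : 0 < 2 ^ (i - 1) := by positivity
    have hiS : (i - 1) * (N + 1) + (N + 1) = i * (N + 1) := by
      obtain ⟨x, rfl⟩ := Nat.exists_eq_add_of_le' hi1
      rw [Nat.add_sub_cancel]; ring
    have hiN : i * (N + 1) ≤ N * (N + 1) := Nat.mul_le_mul_right _ (by omega)
    rw [run_seq, run_set]
    refine ⟨by simp; omega, ?_⟩
    refine (Run.for (fun j s' => (∀ k < i, ∀ j, j + 2 ^ k ≤ nB →
        IsMin H (j * B) ((j + 2 ^ k) * B) (s'.arr (.sp lev) (k * (N + 1) + j))) ∧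
        ∀ j' < j, IsMin H (j' * B) ((j' + 2 ^ i) * B) (s'.arr (.sp lev) (i * (N + 1) + j')))
        0 (nB + 1 - 2 ^ i) 0 (by simp) (by omega) (by omega) ⟨by simpa using hI, by simp⟩
        (fun s' hf => ?_) rfl ?_).mono ?_
    · have e1 : s'.var nb = nB := by
        rw [hf.var nb rfl]; simp [hf2.var nb rfl, v1]
      have e2 : s'.var .i = i := by rw [hf.var .i rfl]; simp [hik]
      have e3 : s'.arr .pow i = 2 ^ i := by
        rw [hf.arr .pow rfl]; simp [hf2.arr .pow rfl, hT1.pow i (by omega)]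
      simp [e1, e2, e3]; omega
    · rintro j s₃ _ hj ⟨hI1, hI2⟩ hf3 hjk
      have e1 : s₃.var str = N + 1 := by
        rw [hf3.var str rfl]; simp [hf2.var str rfl, hT1.str]
      have e2 : s₃.var .i = i := by rw [hf3.var .i rfl]; simp [hik]
      have e3 : s₃.arr .pow (i - 1) = 2 ^ (i - 1) := by
        rw [hf3.arr .pow rfl]; simp [hf2.arr .pow rfl, hT1.pow (i - 1) (by omega)]
      have g1 := hI1 (i - 1) (by omega) j (by omega)
      have g2 := hI1 (i - 1) (by omega) (j + 2 ^ (i - 1)) (by omega)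
      have g3 := g1.union g2 (Nat.mul_le_mul_right B (by omega)) le_rfl
        (Nat.mul_le_mul_right B (by omega))
      rw [add_assoc, h2i] at g3
      rw [run_seq, run_set, run_seq, run_setMin, run_put]
      simp only [eval_arr, eval_var, eval_add, eval_sub, eval_mul, eval_ofNat, safe_arr, safe_var,
        safe_add, safe_sub, safe_mul, safe_ofNat, HState.tick_var, HState.tick_arr, HState.put_arr,
        HState.put_time, HState.set_arr, HState.set_var, HState.set_time, HState.tick_time, e1, e2,
        e3, hjk, reduceCtorEq, if_true, if_false, true_and, and_true]
      generalize hV1 : s₃.arr (.sp lev) ((i - 1) * (N + 1) + j) = V1 at *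
      generalize hV2 : s₃.arr (.sp lev) ((i - 1) * (N + 1) + (j + 2 ^ (i - 1))) = V2 at *
      and_intros
      any_goals omega
      · intro k hk j' hj'
        have hk2 : (k + 1) * (N + 1) ≤ i * (N + 1) := Nat.mul_le_mul_right _ hk
        have hk3 := add_mul k 1 (N + 1)
        have : 0 < 2 ^ k := by positivity
        rw [Function.update_of_ne (by omega)]
        exact hI1 k hk j' hj'
      · intro j' hj'
        rw [Function.update_apply]
        split_ifs with hjj
        · rw [show j' = j by omega]; exact g3
        · exact hI2 j' (by omega)
    · rintro s' ⟨⟨g1, g2⟩, -, ht⟩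
      have hpi : 0 < 2 ^ i := by positivity
      simp only [HState.set_arr, HState.set_time, HState.tick_time] at ht ⊢
      refine ⟨fun k hk j hj => ?_, by omega⟩
      by_cases hki : k = i
      · subst hki; exact g2 j (by omega)
      · exact g1 k (by omega) j hj
  · rintro s' ⟨h1, -, h2⟩
    refine ⟨fun k hk j hj => h1 k (by omega) j (by rwa [hnbe] at hj), ?_⟩
    simp only [HState.set_time, Nat.add_sub_cancel] at h2
    -- B rows of at most nB + 1 iterations each, and nB · B ≤ N + 1: covering only blocks removes
    -- the logarithmic factor.
    have : B * (nB + 1) = nB * B + B := by ring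
    omega

/-! ### Queries for longest common suffixes -/

def inBlock (lev : Bool) (x y : Ex) : Ex :=
  .arr (.hh lev) (x + .arr .lsb (.arr (.mask lev) y / .arr .pow (x % b)))

/-- `v := min (H l, …, H r)` -/
def rangeMin (lev : Bool) : Prog :=
  .set lb (l / b) ;; .set rb (r / b) ;;
  .ite (.eq lb rb) (.set v (inBlock lev l r))
    (.set v (inBlock lev l (lb * b + b - 1)) ;; setMin (inBlock lev (rb * b) r) ;;
      .ite (.lt (lb + 1) rb)
        (.set k (.arr .log (rb - lb - 1)) ;;
          setMin (.arr (.sp lev) (k * str + (lb + 1))) ;;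
          setMin (.arr (.sp lev) (k * str + (rb - .arr .pow k))))
        (.set v v))

/-- An interval across blocks consists of the end of its first block, the beginning of its last one,
and full blocks between, which two overlapping runs of 2 ^ k blocks cover. -/
theorem rangeMin_spec (lev : Bool) {s : St} {N B l₀ r₀ : ℕ} (hT : Tables N B s)
    (hm : IsMasks (s.arr (.hh lev)) N B (s.arr (.mask lev)))
    (hs : IsSparse (s.arr (.hh lev)) N B (s.arr (.sp lev)))
    (hl : s.var l = l₀) (hr : s.var r = r₀) (hlr : l₀ ≤ r₀) (hrN : r₀ ≤ N)
    (hL : N * (N + 1) + 3 * N + 4 < M.L) :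
    Run M (rangeMin lev) s (fun s' => (IsMin (s.arr (.hh lev)) l₀ (r₀ + 1) (s'.var v) ∧
      s'.time = s.time) ∧ Frame (rangeMin lev) s s') := by
  refine Run.frame ?_
  have hBN := hT.lt
  have hB1 := hT.one_le
  have hb := hT.b
  have hpB := hT.pow_le
  have l1 := Nat.div_add_mod l₀ B
  have r1 := Nat.div_add_mod r₀ B
  have l2 : l₀ % B < B := Nat.mod_lt _ hB1
  have r2 : r₀ % B < B := Nat.mod_lt _ hB1
  have hdiv : l₀ / B ≤ r₀ / B := Nat.div_le_div_right hlr
  have hp0 := hT.pow 0 (by omega)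
  have hpl := hT.pow (l₀ % B) (by omega)
  rw [rangeMin, run_seq, run_set, run_seq, run_set, run_ite, run_set, run_seq, run_set, run_seq,
    run_setMin, run_ite, run_seq, run_set, run_seq, run_setMin, run_setMin, run_set]
  simp only [inBlock, eval_arr, eval_var, eval_add, eval_sub, eval_mul, eval_div, eval_mod, eval_eq,
    eval_lt, eval_ofNat, safe_arr, safe_var, safe_add, safe_sub, safe_mul, safe_div, safe_mod,
    safe_eq, safe_lt, safe_ofNat, HState.set_arr, HState.set_var, HState.set_time, hl, hr, hb,
    hT.str, reduceCtorEq, if_true, if_false, true_and, and_true]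
  rw [mul_comm (r₀ / B) B, mul_comm (l₀ / B) B]
  generalize hH : s.arr (.hh lev) = H at *
  generalize hK : s.arr (.mask lev) = K at *
  refine ⟨fun hc => ?_, fun hc => ?_⟩
  · have hc' : l₀ / B = r₀ / B := by by_contra h; simp [h] at hc
    obtain ⟨h1, h2, h3⟩ := hT.inBlock hm hlr hrN hc'
    have h4 := Nat.div_le_self (K r₀) (s.arr .pow (l₀ % B))
    refine ⟨⟨⟨⟨by omega, by omega⟩, by omega⟩, by omega⟩, h3⟩
  have hc' : l₀ / B < r₀ / B := by
    refine lt_of_le_of_ne hdiv fun h => ?_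
    simp [h] at hc
  generalize hx : l₀ / B = x at *
  generalize hy : r₀ / B = y at *
  have hxy : (x + 1) * B ≤ y * B := Nat.mul_le_mul_right B hc'
  have e1 := add_mul x 1 B
  have e2 := mul_comm x B
  have e3 := mul_comm y B
  have d1 : (B * x + B - 1) / B = x := by
    rw [show B * x + B - 1 = (B - 1) + B * x by omega, Nat.add_mul_div_left _ _ (by omega),
      Nat.div_eq_of_lt (by omega)]
    omega
  have d2 : B * y / B = y := Nat.mul_div_cancel_left _ (by omega)
  obtain ⟨a1, a2, a3⟩ := hT.inBlock hm (l := l₀) (r := B * x + B - 1) (by omega) (by omega)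
    (by rw [d1, hx])
  obtain ⟨b1, b2, b3⟩ := hT.inBlock hm (l := B * y) (r := r₀) (by omega) (by omega) (by rw [d2, hy])
  have a4 := Nat.div_le_self (K (B * x + B - 1)) (s.arr .pow (l₀ % B))
  have b4 := Nat.div_le_self (K r₀) (s.arr .pow (B * y % B))
  have a5 : B * x + B - 1 + 1 = (x + 1) * B := by omega
  rw [a5] at a3
  replace b3 : IsMin H (y * B) (r₀ + 1)
      (H (B * y + s.arr .lsb (K r₀ / s.arr .pow (B * y % B)))) := by rw [e3]; exact b3
  have hyB : y * 1 ≤ y * B := Nat.mul_le_mul_left y hB1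
  have hmm : B * y % B = 0 := Nat.mul_mod_right _ _
  refine ⟨by and_intros <;> omega, by and_intros <;> omega, by omega, fun hc2 => ?_, fun hc2 => ?_⟩
  · have hc3 : x + 1 < y := by by_contra h; simp [h] at hc2
    have hyn : y ≤ (N + 1) / B := (Nat.le_div_iff_mul_le (by omega)).2 (by omega)
    have hlog := hT.log (y - x - 1) (by omega)
    rw [hlog]
    have hk1 : 2 ^ Nat.log 2 (y - x - 1) ≤ y - x - 1 := Nat.pow_log_le_self 2 (by omega)
    have hk2 : y - x - 1 < 2 ^ (Nat.log 2 (y - x - 1) + 1) :=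
      Nat.lt_pow_succ_log_self (by norm_num) _
    -- At most N < 2 ^ (B + 1) blocks lie between, so row k of the sparse table exists.
    have hk3 : Nat.log 2 (y - x - 1) ≤ B := by
      by_contra hcon
      have : 2 ^ (B + 1) ≤ 2 ^ Nat.log 2 (y - x - 1) := Nat.pow_le_pow_right two_pos (by omega)
      have := hT.lt_pow
      omega
    generalize Nat.log 2 (y - x - 1) = k at *
    rw [hT.pow k hk3]
    have s1 := hs k hk3 (x + 1) (by omega)
    have s2 := hs k hk3 (y - 2 ^ k) (by omega)
    rw [Nat.sub_add_cancel (by omega)] at s2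
    have hkN : k * (N + 1) ≤ (N - 1) * (N + 1) := Nat.mul_le_mul_right _ (by omega)
    have hNN : (N - 1) * (N + 1) + (N + 1) = N * (N + 1) := by
      rw [← Nat.succ_mul]; congr 1; omega
    rw [pow_succ] at hk2
    refine ⟨by and_intros <;> omega, by and_intros <;> omega, by and_intros <;> omega, ?_⟩
    have u1 := s1.union s2 (Nat.mul_le_mul_right B (by omega)) (Nat.mul_le_mul_right B (by omega))
      (Nat.mul_le_mul_right B (by omega))
    have u2 := a3.union (u1.union b3 hxy le_rfl (by omega)) (by omega) le_rfl
      (by omega)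
    convert u2 using 1
    omega
  · have hc3 : x + 1 = y := by by_contra h; simp [show x + 1 < y by omega] at hc2
    rw [hc3] at a3 e1
    exact a3.union b3 (by omega) le_rfl (by omega)

/-- The data structure for longest common suffixes in `X` is present. -/
structure Lce (lev : Bool) (X : ℕ → ℕ) (N B : ℕ) (s : St) : Prop where
  tabs : Tables N B s
  sa : ∃ S, IsSA X N S ∧ (∀ t ≤ N, s.arr (.rk lev) (S t) = t) ∧
    ∀ t, 1 ≤ t → t ≤ N → s.arr (.hh lev) t = lcs X (S (t - 1)) (S t)
  mask : IsMasks (s.arr (.hh lev)) N B (s.arr (.mask lev))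
  sp : IsSparse (s.arr (.hh lev)) N B (s.arr (.sp lev))

theorem Lce.frame {lev : Bool} {X : ℕ → ℕ} {N B : ℕ} {s s' : St} (h : Lce lev X N B s) {p : Prog}
    (hf : Frame p s s') (h1 : p.wv .tot = false) (h2 : p.wv .str = false) (h3 : p.wv .b = false)
    (h4 : p.wa .pow = false) (h5 : p.wa .lsb = false) (h6 : p.wa .log = false)
    (h7 : p.wa (.rk lev) = false) (h8 : p.wa (.hh lev) = false) (h9 : p.wa (.mask lev) = false)
    (h10 : p.wa (.sp lev) = false) : Lce lev X N B s' := by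
  obtain ⟨g1, g2, g3, g4⟩ := h
  refine ⟨g1.frame hf h1 h2 h3 h4 h5 h6, ?_, ?_, ?_⟩
  · rw [hf.arr _ h7, hf.arr _ h8]; exact g2
  · rw [hf.arr _ h8, hf.arr _ h9]; exact g3
  · rw [hf.arr _ h8, hf.arr _ h10]; exact g4

/-- `v := lcs X d e` -/
def lce (lev : Bool) : Prog :=
  .set x (.arr (.rk lev) d) ;; .set y (.arr (.rk lev) e) ;;
  .ite (.lt x y) (.set l (x + 1) ;; .set r y) (.set l (y + 1) ;; .set r x) ;; rangeMin lev

/-- By `IsSA.lcs_isMin` the answer is the minimum of `hh` over the ranks after the smaller one up to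
the larger one. This interval is nonempty because the prefixes differ. -/
theorem lce_spec (lev : Bool) {X : ℕ → ℕ} {s : St} {N B d₀ e₀ : ℕ} (h : Lce lev X N B s)
    (hd : s.var d = d₀) (he : s.var e = e₀) (hdN : d₀ ≤ N) (heN : e₀ ≤ N) (hne : d₀ ≠ e₀)
    (hL : N * (N + 1) + 3 * N + 4 < M.L) :
    Run M (lce lev) s (fun s' => (s'.var v = lcs X d₀ e₀ ∧ s'.time = s.time) ∧
      Frame (lce lev) s s') := by
  refine Run.frame ?_
  obtain ⟨S, hS, hrk, hhh⟩ := h.sa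
  obtain ⟨p, hp, rfl⟩ := hS.surj hdN
  obtain ⟨q, hq, rfl⟩ := hS.surj heN
  have hpq : p ≠ q := fun h => hne (by rw [h])
  have key : ∀ p q, p < q → q ≤ N → ∀ s₁ : St, Lce lev X N B s₁ →
      s₁.arr (.hh lev) = s.arr (.hh lev) → s₁.time = s.time → s₁.var l = p + 1 → s₁.var r = q →
      Run M (rangeMin lev) s₁ fun s' => s'.var v = lcs X (S p) (S q) ∧ s'.time = s.time := by
    intro p q hpq hq s₁ h₁ e1 e2 hl hr
    refine (rangeMin_spec (M := M) (s := s₁) lev h₁.tabs h₁.mask h₁.sp hl hr (by omega) hq hL).mono ?_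
    rintro s' ⟨⟨g1, g2⟩, -⟩
    refine ⟨g1.unique ((hS.lcs_isMin hpq hq).congr fun i hi1 hi2 => ?_), by omega⟩
    rw [e1, hhh i (by omega) (by omega)]
  have hLs : ∀ s₁ : St, s₁.var .tot = s.var .tot → s₁.var .str = s.var .str →
      s₁.var .b = s.var .b → s₁.arr = s.arr → Lce lev X N B s₁ := by
    intro s₁ g1 g2 g3 g4
    obtain ⟨k1, k2, k3, k4⟩ := h
    obtain ⟨f1, f2, f3, f4, f5, f6, f7, f8, f9⟩ := k1
    refine ⟨⟨?_, ?_, ?_, f4, f5, f6, ?_, ?_, ?_⟩, ?_, ?_, ?_⟩ <;> simp only [g1, g2, g3, g4] <;>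
      assumption
  rw [lce, run_seq, run_set, run_seq, run_set, run_seq, run_ite, run_seq, run_set, run_set,
    run_seq, run_set, run_set]
  simp only [eval_arr, eval_var, eval_add, eval_lt, eval_ofNat, safe_arr, safe_var, safe_add,
    safe_lt, safe_ofNat, HState.set_arr, HState.set_var, HState.set_time, hd, he, hrk p hp, hrk q hq,
    reduceCtorEq, if_true, if_false, true_and, and_true]
  refine ⟨by omega, by omega, fun hc => ⟨⟨by omega, by omega⟩, ?_⟩, fun hc => ⟨⟨by omega, by omega⟩, ?_⟩⟩
  · have hc' : p < q := by by_contra h; simp [h] at hc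
    refine key p q hc' hq _ (hLs _ ?_ ?_ ?_ ?_) ?_ ?_ ?_ ?_ <;> simp
  · have hc' : ¬ p < q := by intro h; simp [h] at hc
    rw [lcs_comm]
    refine key q p (by omega) hp _ (hLs _ ?_ ?_ ?_ ?_) ?_ ?_ ?_ ?_ <;> simp

def build (lev : Bool) : Prog :=
  suffixSort ;; inverse lev ;; kasai lev ;; masks lev ;; sparse lev

/-- `Lce` refers to the string as a function and not to the array `.X`, so it remains valid when the
array is overwritten by the names. -/
theorem build_spec (lev : Bool) {s : St} {N B : ℕ} (hT : Tables N B s)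
    (hX : IsRanked (s.arr .X) N)
    (hL : (N + 1) * (N + 1) * (N + 1) + N * (N + 1) + 12 * N + 40 < M.L) :
    Run M (build lev) s (fun s' => ((Lce lev (s.arr .X) N B s' ∧ IsSA (s.arr .X) N (s'.arr .sa) ∧
      (∀ t, 1 ≤ t → t ≤ N →
        s'.arr (.hh lev) t = lcs (s.arr .X) (s'.arr .sa (t - 1)) (s'.arr .sa t)) ∧
      (∀ d ≤ N, s'.arr .X d = s.arr .X d) ∧ s'.time ≤ s.time + 220 * N) ∧
      Frame (build lev) s s')) := by
  refine Run.frame ?_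
  have hN : 2 ≤ N := by have := hT.lt; have := hT.one_le; omega
  refine Run.seq (suffixSort_spec (M := M) hT.tot hT.str hN hX hL) ?_
  rintro s₁ ⟨⟨h1, h1X, h1t⟩, f1⟩
  have T1 := hT.frame f1 rfl rfl rfl rfl rfl rfl
  refine Run.seq (inverse_spec (M := M) lev T1.tot h1 (by omega)) ?_
  rintro s₂ ⟨⟨h2, h2t⟩, f2⟩
  have T2 := T1.frame f2 rfl rfl rfl rfl rfl rfl
  have a2 : s₂.arr .sa = s₁.arr .sa := f2.arr .sa rfl
  refine Run.seq (kasai_spec (M := M) lev (X := s.arr .X) T2.tot ?_ hX.toIsStr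
    (by rwa [a2]) (by rwa [a2]) (by omega)) ?_
  · intro d hd; rw [f2.arr .X rfl, h1X d hd]
  rintro s₃ ⟨⟨h3, h3t⟩, f3⟩
  have T3 := T2.frame f3 rfl rfl rfl rfl rfl rfl
  have a3 : s₃.arr .sa = s₁.arr .sa := by rw [f3.arr .sa rfl, a2]
  have r3 : s₃.arr (.rk lev) = s₂.arr (.rk lev) := f3.arr (.rk lev) rfl
  refine Run.seq (masks_spec (M := M) lev T3.tot T3.b T3.one_le T3.pow_le T3.log T3.pow (by omega)) ?_
  rintro s₄ ⟨⟨h4, h4t⟩, f4⟩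
  have T4 := T3.frame f4 rfl rfl rfl rfl rfl rfl
  have hh4 : s₄.arr (.hh lev) = s₃.arr (.hh lev) := f4.arr (.hh lev) rfl
  refine (sparse_spec (M := M) lev T4 (by rw [hh4]; exact h4) (by omega)).mono ?_
  rintro s₅ ⟨⟨h5, h5t⟩, f5⟩
  have T5 := T4.frame f5 rfl rfl rfl rfl rfl rfl
  have hh5 : s₅.arr (.hh lev) = s₃.arr (.hh lev) := by rw [f5.arr (.hh lev) rfl, hh4]
  have rk5 : s₅.arr (.rk lev) = s₂.arr (.rk lev) := by
    rw [f5.arr (.rk lev) rfl, f4.arr (.rk lev) rfl, r3]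
  have mk5 : s₅.arr (.mask lev) = s₄.arr (.mask lev) := f5.arr (.mask lev) rfl
  have sa5 : s₅.arr .sa = s₁.arr .sa := by rw [f5.arr .sa rfl, f4.arr .sa rfl, a3]
  rw [a2] at h3
  refine ⟨⟨T5, ⟨s₁.arr .sa, h1, by rwa [rk5], by rwa [hh5]⟩, ?_, ?_⟩, by rwa [sa5], by rwa [hh5, sa5],
    fun d hd => ?_, by omega⟩
  · rw [hh5, mk5]; exact h4
  · rw [hh5, ← hh4]; exact h5
  · rw [f5.arr .X rfl, f4.arr .X rfl, f3.arr .X rfl, f2.arr .X rfl, h1X d hd]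

/-! ### Reading the input -/

/-- A natural number that represents the integer with the two's complement `u`. -/
def unsign (W u : ℕ) : ℕ := if (W - u) % W < u then (W - u) % W * 2 + 1 else u * 2

/-- The code is the smaller of u and W − u followed by a sign bit, so that characters of small
absolute value, negative ones included, become small table indices. -/
theorem unsign_inj {W u v : ℕ} (hu : u < W) (hv : v < W) (h : unsign W u = unsign W v) : u = v := by
  have key : ∀ x < W, (W - x) % W = if x = 0 then 0 else W - x := by
    intro x hx
    split_ifs with h0
    · simp [h0]
    · exact Nat.mod_eq_of_lt (by omega)
  unfold unsign at h
  rw [key u hu, key v hv] at h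
  split_ifs at h <;> omega

/-- The dictionary is a table indexed by the characters. Being initially zero, it needs no
initialization: an entry 0 means that the character is new and receives the next name. -/
def readCells : Prog :=
  .set i 0 ;; .for i cn (
    .set x (.io ip) ;; .set y (.io (ip + 1)) ;; .set v (.io (ip + 2)) ;; .set t (.neg v) ;;
    .ite (.lt t v) (.set v (t * 2 + 1)) (.set v (v * 2)) ;;
    .ite (.arr .dict v) (.set v v) (.set cnt (cnt + 1) ;; .put .dict v cnt) ;;
    .put .X (bs + x * st + y) (.arr .dict v) ;; .set ip (ip + 3))

/-- A dictionary that gives different positive names, at most `c`, to some numbers. -/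
structure IsDict (D : ℕ → ℕ) (c : ℕ) : Prop where
  le : ∀ v, D v ≤ c
  inj : ∀ u v, D u = D v → D u ≠ 0 → u = v

theorem IsDict.update {D : ℕ → ℕ} {c v : ℕ} (h : IsDict D c) :
    IsDict (Function.update D v (c + 1)) (c + 1) := by
  refine ⟨fun u => ?_, fun u u' he hne => ?_⟩
  · have := h.le u
    rw [Function.update_apply]; split_ifs <;> omega
  · have h1 := h.le u
    have h2 := h.le u'
    rw [Function.update_apply] at he hne
    rw [Function.update_apply] at he
    split_ifs at he hne with g1 g2 g2
    · rw [g1, g2]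
    · omega
    · omega
    · exact h.inj u u' he hne

/-- The input area lists `k` cells `x, y, character` of a table `T` of size `S × S`, from `o` on. -/
structure Cells (M : Mach) (io : ℕ → ℕ) (o k S : ℕ) (T : ℕ → ℕ → ℕ) : Prop where
  bound : o + 3 * k ≤ M.B
  x_lt : ∀ f < k, io (o + 3 * f) < S
  y_lt : ∀ f < k, io (o + 3 * f + 1) < S
  char : ∀ f < k, io (o + 3 * f + 2) = T (io (o + 3 * f)) (io (o + 3 * f + 1))
  small : ∀ f < k, unsign M.W (io (o + 3 * f + 2)) < M.L

/-- Called once for the text and once for the pattern with the same dictionary. Nonzero entries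
never change, so what the first call establishes survives the second. -/
theorem readCells_spec {s : St} {o k S c₀ b₀ : ℕ} {T : ℕ → ℕ → ℕ} (hI : Cells M s.io o k S T)
    (hip : s.var ip = o) (hcn : s.var cn = k) (hbs : s.var bs = b₀) (hst : s.var st = S)
    (hcnt : s.var cnt = c₀) (hD : IsDict (s.arr .dict) c₀)
    (hL : b₀ + S * S + c₀ + k + o + 3 * k + 10 < M.L) :
    Run M readCells s (fun s' => (s'.var ip = o + 3 * k ∧ (∃ c, s'.var cnt = c ∧ c ≤ c₀ + k ∧
      IsDict (s'.arr .dict) c) ∧ (∀ v, s.arr .dict v ≠ 0 → s'.arr .dict v = s.arr .dict v) ∧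
      (∀ j, j < b₀ ∨ b₀ + S * S ≤ j → s'.arr .X j = s.arr .X j) ∧
      (∀ f < k, ∀ x y, s.io (o + 3 * f) = x → s.io (o + 3 * f + 1) = y →
        s'.arr .X (b₀ + x * S + y) = s'.arr .dict (unsign M.W (T x y)) ∧
        s'.arr .dict (unsign M.W (T x y)) ≠ 0) ∧
      s'.time ≤ s.time + k) ∧ Frame readCells s s') := by
  refine Run.frame ?_
  rw [readCells, run_seq, run_set]
  refine ⟨by simp; omega, ?_⟩
  refine (Run.for (fun i s' => s'.var ip = o + 3 * i ∧ (∃ c, s'.var cnt = c ∧ c ≤ c₀ + i ∧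
      IsDict (s'.arr .dict) c) ∧ (∀ v, s.arr .dict v ≠ 0 → s'.arr .dict v = s.arr .dict v) ∧
      (∀ j, j < b₀ ∨ b₀ + S * S ≤ j → s'.arr .X j = s.arr .X j) ∧
      (∀ f < i, ∀ x y, s.io (o + 3 * f) = x → s.io (o + 3 * f + 1) = y →
        s'.arr .X (b₀ + x * S + y) = s'.arr .dict (unsign M.W (T x y)) ∧
        s'.arr .dict (unsign M.W (T x y)) ≠ 0)) 0 k 0
    (by simp) (by omega) (by omega) ?_ (fun s' hf => ?_) rfl ?_).mono ?_
  · refine ⟨by simpa, ⟨c₀, by simpa, by omega, hD⟩, by simp, by simp, by simp⟩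
  · have : s'.var cn = k := by rw [hf.var cn rfl]; simpa
    simp [this]
  · rintro f s' _ hf ⟨h1, ⟨c, h2, h3, h4⟩, h5, h6, h7⟩ hfr hik
    have e1 : s'.io = s.io := by rw [hfr.io rfl]; simp
    have e2 : s'.var bs = b₀ := by rw [hfr.var bs rfl]; simpa
    have e3 : s'.var st = S := by rw [hfr.var st rfl]; simpa
    have hx := hI.x_lt f hf
    have hy := hI.y_lt f hf
    have hch := hI.char f hf
    have hsm := hI.small f hf
    have hB := hI.bound
    generalize hx₀ : s.io (o + 3 * f) = x₀ at *
    generalize hy₀ : s.io (o + 3 * f + 1) = y₀ at *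
    generalize hu : s.io (o + 3 * f + 2) = u at *
    have hpos := digit_lt (a := x₀) (b := y₀) (A := S) (B := S) hx hy
    have hxS : x₀ * S ≤ S * S := Nat.mul_le_mul_right S hx.le
    rw [run_seq, run_set, run_seq, run_set, run_seq, run_set, run_seq, run_set]
    simp only [eval_io, eval_neg, eval_var, eval_add, eval_ofNat, safe_io, safe_neg, safe_var,
      safe_add, safe_ofNat, HState.set_var, HState.set_io, HState.tick_var, HState.tick_io, e1, h1,
      hx₀, hy₀, hu, reduceCtorEq, if_true, if_false, true_and, and_true]
    refine ⟨by omega, by omega, by omega, ?_⟩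
    refine Run.seq (R := fun s₁ => s₁ = (((((s'.tick.set x x₀).set y y₀).set v u).set t
      ((M.W - u) % M.W)).set v (unsign M.W u))) ?_ ?_
    · rw [run_ite, run_set, run_set]
      simp only [eval_io, eval_neg, eval_var, eval_add, eval_mul, eval_lt, eval_ofNat, safe_io,
        safe_neg, safe_var, safe_mul, safe_lt, safe_add, safe_ofNat, HState.set_var,
        reduceCtorEq, if_true, if_false, true_and, and_true]
      unfold unsign at hsm ⊢
      split_ifs at hsm ⊢ with hc
      · simp; omega
      · simp; omega
    rintro s₁ rfl
    generalize hw : unsign M.W u = w at *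
    refine Run.seq (R := fun s₂ => s₂.var ip = o + 3 * f ∧ s₂.var bs = b₀ ∧ s₂.var st = S ∧
      s₂.var x = x₀ ∧ s₂.var y = y₀ ∧ s₂.var v = w ∧
      (∃ c', s₂.var cnt = c' ∧ c' ≤ c₀ + f + 1 ∧ IsDict (s₂.arr .dict) c') ∧ s₂.arr .dict w ≠ 0 ∧
      (∀ v, s'.arr .dict v ≠ 0 → s₂.arr .dict v = s'.arr .dict v) ∧
      s₂.arr .X = s'.arr .X ∧ s₂.time = s'.time + 1) ?_ ?_
    · rw [run_ite, run_seq, run_set, run_set, run_put]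
      simp only [eval_arr, eval_var, eval_add, eval_ofNat, safe_arr, safe_var,
        safe_add, safe_ofNat, HState.set_var, HState.set_arr, HState.tick_var, HState.tick_arr,
        HState.put_var, HState.put_arr, HState.put_time, HState.set_time, HState.tick_time, h1, h2,
        e2, e3, reduceCtorEq, if_true, if_false, true_and, and_true]
      refine ⟨by omega, fun hc => ⟨⟨c, rfl, by omega, h4⟩, hc, fun _ _ => trivial⟩, fun hc =>
        ⟨by omega, by omega, ⟨c + 1, rfl, by omega, h4.update⟩, by simp, fun v hv => ?_⟩⟩
      rw [Function.update_of_ne]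
      rintro rfl
      exact hv hc
    rintro s₂ ⟨w1, w2, w3, w4, w5, w6, ⟨c', w7, w8, w9⟩, w10, w11, w12, w13⟩
    rw [run_seq, run_put, run_set]
    simp only [eval_arr, eval_var, eval_add, eval_mul, eval_ofNat, safe_arr, safe_var, safe_mul,
      safe_add, safe_ofNat, HState.set_var, HState.set_arr, HState.put_var, HState.put_arr,
      HState.put_time, HState.set_time, w1, w2, w3, w4, w5, w6, w7, w12,
      reduceCtorEq, if_true, if_false, true_and, and_true]
    refine ⟨by and_intros <;> omega, by omega, by omega, by omega, ⟨by omega, ⟨c', rfl, by omega,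
      w9⟩, fun v hv => ?_, fun j hj => ?_, fun g hg x y hgx hgy => ?_⟩, by omega⟩
    · rw [w11 v (by rwa [h5 v hv]), h5 v hv]
    · rw [Function.update_of_ne (by omega), h6 j hj]
    · have hxl := hI.x_lt g (by omega)
      have hyl := hI.y_lt g (by omega)
      by_cases hp : b₀ + x * S + y = b₀ + x₀ * S + y₀
      · have hxy : x = x₀ ∧ y = y₀ := (digit_eq_iff (by omega) hy).1 (by omega)
        rw [hp, Function.update_self, hxy.1, hxy.2, ← hch, hw]
        exact ⟨rfl, w10⟩
      · have hgf : g ≠ f := by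
          rintro rfl
          exact hp (by rw [← hgx, ← hgy, hx₀, hy₀])
        obtain ⟨g1, g2⟩ := h7 g (by omega) x y hgx hgy
        rw [Function.update_of_ne hp, w11 _ g2]
        exact ⟨g1, g2⟩
  · rintro s' ⟨h, -, ht⟩
    refine ⟨h.1, h.2.1, h.2.2.1, h.2.2.2.1, h.2.2.2.2, by simpa using ht⟩

/-- The input area holds a text `T`, a pattern `P` and shifts of the pattern. -/
structure Inst (M : Mach) (io : ℕ → ℕ) (n m nq : ℕ) (T P : ℕ → ℕ → ℕ) : Prop where
  one_le : 1 ≤ m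
  le : m ≤ n
  io_n : io 0 = n
  io_m : io 1 = m
  io_nq : io 2 = nq
  cellsT : Cells M io 3 (n * n) n T
  cellsP : Cells M io (3 + 3 * (n * n)) (m * m) m P
  surjT : ∀ x < n, ∀ y < n, ∃ f < n * n, io (3 + 3 * f) = x ∧ io (3 + 3 * f + 1) = y
  surjP : ∀ x < m, ∀ y < m, ∃ f < m * m,
    io (3 + 3 * (n * n) + 3 * f) = x ∧ io (3 + 3 * (n * n) + 3 * f + 1) = y
  T_lt : ∀ x < n, ∀ y < n, T x y < M.W
  P_lt : ∀ x < m, ∀ y < m, P x y < M.W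
  shift_x : ∀ i < nq, io (3 + 3 * (n * n) + 3 * (m * m) + 2 * i) + m ≤ n
  shift_y : ∀ i < nq, io (3 + 3 * (n * n) + 3 * (m * m) + 2 * i + 1) + m ≤ n
  bound : 3 + 3 * (n * n) + 3 * (m * m) + 2 * nq ≤ M.B
  large : ∀ N, N = n * n + m * m → (N + 1) * (N + 1) * (N + 1) + N * (N + 1) + 12 * N + 40 < M.L
  bound_lt : M.B < M.L

theorem Inst.two_le {io : ℕ → ℕ} {n m nq : ℕ} {T P : ℕ → ℕ → ℕ} (h : Inst M io n m nq T P) :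
    2 ≤ n * n + m * m := by
  have h1 : 1 * 1 ≤ m * m := Nat.mul_le_mul h.one_le h.one_le
  have h2 : 1 * 1 ≤ n * n := Nat.mul_le_mul (h.one_le.trans h.le) (h.one_le.trans h.le)
  omega

/-- The positions of the string are those of the text and those of the pattern. -/
theorem pos_cases {n m d : ℕ} (h1 : 1 ≤ d) (h2 : d ≤ n * n + m * m) :
    (∃ x < n, ∃ y < n, d = 1 + x * n + y) ∨ ∃ x < m, ∃ y < m, d = 1 + n * n + x * m + y := by
  have key : ∀ k e : ℕ, e < k * k → ∃ x < k, ∃ y < k, e = x * k + y := by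
    intro k e he
    have hk : 0 < k := by
      rcases Nat.eq_zero_or_pos k with rfl | hk
      · simp at he
      · exact hk
    exact ⟨e / k, Nat.div_lt_of_lt_mul he, e % k, Nat.mod_lt _ hk, by
      rw [mul_comm]; exact (Nat.div_add_mod e k).symm⟩
  by_cases h : d ≤ n * n
  · obtain ⟨x, hx, y, hy, hxy⟩ := key n (d - 1) (by omega)
    exact Or.inl ⟨x, hx, y, hy, by omega⟩
  · obtain ⟨x, hx, y, hy, hxy⟩ := key m (d - 1 - n * n) (by omega)
    exact Or.inr ⟨x, hx, y, hy, by omega⟩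

/-- The cell (x, y) of the text goes to position 1 + x n + y, that of the pattern to 1 + n² + x m +
y; position 0 is left to the sentinel. -/
def load : Prog :=
  (.set n (.io 0) ;; .set m (.io 1) ;; .set nq (.io 2) ;; .set tot (n * n + m * m) ;;
    .set str (tot + 1) ;; .set cnt 0 ;; .set ip 3 ;; .set cn (n * n) ;; .set bs 1 ;; .set st n) ;;
  readCells ;; (.set cn (m * m) ;; .set bs (1 + n * n) ;; .set st m) ;; readCells

/-- The variables that hold the sizes are set. -/
structure Sizes (n₀ m₀ nq₀ : ℕ) (s : St) : Prop where
  n : s.var n = n₀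
  m : s.var m = m₀
  nq : s.var nq = nq₀
  tot : s.var tot = n₀ * n₀ + m₀ * m₀
  str : s.var str = n₀ * n₀ + m₀ * m₀ + 1

theorem Sizes.frame {n₀ m₀ nq₀ : ℕ} {s s' : St} (h : Sizes n₀ m₀ nq₀ s) {p : Prog}
    (hf : Frame p s s') (h1 : p.wv .n = false) (h2 : p.wv .m = false) (h3 : p.wv .nq = false)
    (h4 : p.wv .tot = false) (h5 : p.wv .str = false) : Sizes n₀ m₀ nq₀ s' := by
  obtain ⟨g1, g2, g3, g4, g5⟩ := h
  exact ⟨by rw [hf.var _ h1, g1], by rw [hf.var _ h2, g2], by rw [hf.var _ h3, g3],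
    by rw [hf.var _ h4, g4], by rw [hf.var _ h5, g5]⟩

theorem load_spec {s : St} {n₀ m₀ nq₀ : ℕ} {T P : ℕ → ℕ → ℕ} (hI : Inst M s.io n₀ m₀ nq₀ T P)
    (hd : ∀ v, s.arr .dict v = 0) (hX0 : s.arr .X 0 = 0) :
    Run M load s (fun s' => (Sizes n₀ m₀ nq₀ s' ∧ IsRanked (s'.arr .X) (n₀ * n₀ + m₀ * m₀) ∧
      (∀ x < n₀, ∀ y < n₀, ∀ x' < m₀, ∀ y' < m₀, s'.arr .X (1 + x * n₀ + y) =
        s'.arr .X (1 + n₀ * n₀ + x' * m₀ + y') ↔ T x y = P x' y') ∧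
      s'.time ≤ s.time + (n₀ * n₀ + m₀ * m₀)) ∧ Frame load s s') := by
  refine Run.frame ?_
  have hL := hI.large _ rfl
  have hB := hI.bound
  have hBL := hI.bound_lt
  have h2 := hI.two_le
  have hN3 : 0 ≤ (n₀ * n₀ + m₀ * m₀) * (n₀ * n₀ + m₀ * m₀ + 1) := Nat.zero_le _
  refine Run.seq (R := fun s₁ => Sizes n₀ m₀ nq₀ s₁ ∧ s₁.var cnt = 0 ∧ s₁.var ip = 3 ∧
    s₁.var cn = n₀ * n₀ ∧ s₁.var bs = 1 ∧ s₁.var st = n₀ ∧ s₁.arr = s.arr ∧ s₁.io = s.io ∧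
    s₁.time = s.time) ?_ ?_
  · rw [run_seq, run_set, run_seq, run_set, run_seq, run_set, run_seq, run_set, run_seq, run_set,
      run_seq, run_set, run_seq, run_set, run_seq, run_set, run_seq, run_set, run_set]
    simp only [eval_io, eval_var, eval_add, eval_mul, eval_ofNat, safe_io, safe_var, safe_mul,
      safe_add, safe_ofNat, HState.set_var, HState.set_arr, HState.set_io, HState.set_time,
      hI.io_n, hI.io_m, hI.io_nq, reduceCtorEq, if_true, if_false, true_and, and_true]
    refine ⟨by omega, by omega, by omega, by omega, by omega, by omega, by omega, by omega,
      by omega, ⟨?_, ?_, ?_, ?_, ?_⟩⟩ <;> simp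
  rintro s₁ ⟨hS, v1, v2, v3, v4, v5, a1, i1, t1⟩
  refine Run.seq (readCells_spec (M := M) (s := s₁) (by rw [i1]; exact hI.cellsT) v2 v3 v4 v5 v1
    (by rw [a1]; exact ⟨by simp [hd], by simp [hd]⟩) (by nlinarith)) ?_
  rintro s₂ ⟨⟨b1, ⟨c, b2, b3, b4⟩, b5, b6, b7, b8⟩, f2⟩
  have hS2 := hS.frame f2 rfl rfl rfl rfl rfl
  refine Run.seq (R := fun s₃ => Sizes n₀ m₀ nq₀ s₃ ∧ s₃.var cnt = c ∧
    s₃.var ip = 3 + 3 * (n₀ * n₀) ∧ s₃.var cn = m₀ * m₀ ∧ s₃.var bs = 1 + n₀ * n₀ ∧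
    s₃.var st = m₀ ∧ s₃.arr = s₂.arr ∧ s₃.io = s₂.io ∧ s₃.time = s₂.time) ?_ ?_
  · rw [run_seq, run_set, run_seq, run_set, run_set]
    simp only [eval_io, eval_var, eval_add, eval_mul, eval_ofNat, safe_io, safe_var, safe_mul,
      safe_add, safe_ofNat, HState.set_var, HState.set_arr, HState.set_io, HState.set_time,
      hS2.n, hS2.m, hS2.nq, reduceCtorEq, if_true, if_false, true_and, and_true, b1, b2]
    obtain ⟨g1, g2, g3, g4, g5⟩ := hS2
    refine ⟨by omega, by omega, ⟨?_, ?_, ?_, ?_, ?_⟩⟩ <;> simp [g1, g2, g3, g4, g5]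
  rintro s₃ ⟨hS3, w1, w2, w3, w4, w5, a3, i3, t3⟩
  have i2 : s₂.io = s.io := by rw [f2.io rfl, i1]
  refine (readCells_spec (M := M) (s := s₃) (by rw [i3, i2]; exact hI.cellsP) w2 w3 w4 w5 w1
    (by rw [a3]; exact b4) (by nlinarith)).mono ?_
  rintro s₄ ⟨⟨c1, ⟨c', c2, c3, c4⟩, c5, c6, c7, c8⟩, f4⟩
  rw [a3] at c5 c6
  rw [i3, i2] at c7
  rw [i1] at b7
  rw [a1] at b6
  have hT : ∀ x < n₀, ∀ y < n₀, s₄.arr .X (1 + x * n₀ + y) = s₄.arr .dict (unsign M.W (T x y)) ∧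
      s₄.arr .dict (unsign M.W (T x y)) ≠ 0 := by
    intro x hx y hy
    obtain ⟨f, hf, hfx, hfy⟩ := hI.surjT x hx y hy
    obtain ⟨g1, g2⟩ := b7 f hf x y hfx hfy
    have := digit_lt hx hy
    rw [c5 _ g2, c6 _ (Or.inl (by omega))]
    exact ⟨g1, g2⟩
  have hP : ∀ x < m₀, ∀ y < m₀, s₄.arr .X (1 + n₀ * n₀ + x * m₀ + y) =
      s₄.arr .dict (unsign M.W (P x y)) ∧ s₄.arr .dict (unsign M.W (P x y)) ≠ 0 := by
    intro x hx y hy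
    obtain ⟨f, hf, hfx, hfy⟩ := hI.surjP x hx y hy
    exact c7 f hf x y hfx hfy
  refine ⟨hS3.frame f4 rfl rfl rfl rfl rfl, ⟨⟨?_, fun d hd1 hd2 => ?_⟩, fun d hd2 => ?_⟩,
    fun x hx y hy x' hx' y' hy' => ?_, by omega⟩
  · rw [c6 0 (Or.inl (by omega)), b6 0 (Or.inl (by omega)), hX0]
  · rcases pos_cases hd1 hd2 with ⟨x, hx, y, hy, rfl⟩ | ⟨x, hx, y, hy, rfl⟩
    · have := hT x hx y hy; omega
    · have := hP x hx y hy; omega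
  -- At most one name is created for each cell read, so no name exceeds n² + m², the length of the
  -- string.
  · rcases Nat.eq_zero_or_pos d with rfl | hd1
    · rw [c6 0 (Or.inl (by omega)), b6 0 (Or.inl (by omega)), hX0]; omega
    rcases pos_cases hd1 hd2 with ⟨x, hx, y, hy, rfl⟩ | ⟨x, hx, y, hy, rfl⟩
    · rw [(hT x hx y hy).1]
      have := c4.le (unsign M.W (T x y)); omega
    · rw [(hP x hx y hy).1]
      have := c4.le (unsign M.W (P x y)); omega
  · obtain ⟨g1, g2⟩ := hT x hx y hy
    rw [g1, (hP x' hx' y' hy').1]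
    constructor
    · intro h
      exact unsign_inj (hI.T_lt x hx y hy) (hI.P_lt x' hx' y' hy') (c4.inj _ _ h g2)
    · intro h; rw [h]

/-! ### Names of windows -/

/-- Gives names to the windows of length `m`. -/
def names : Prog :=
  .set c 0 ;; .set t 1 ;; .for t (tot + 1) (
    .ite (.lt (.arr (.hh false) t) m) (.set c (c + 1)) (.set c c) ;;
    .put .nm (.arr .sa t) c)

/-- The common suffix of two prefixes is the minimum over the neighbours in between, so classes of
equal windows are intervals of the sorted order, broken where neighbours share fewer than w
characters. A prefix shorter than w gets a name of its own; for it the equivalence fails when d = e,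
which is therefore excluded. -/
theorem names_spec {s : St} {N w : ℕ} {X : ℕ → ℕ} (htot : s.var tot = N) (hm : s.var m = w)
    (hw : 1 ≤ w) (hsa : IsSA X N (s.arr .sa))
    (hh : ∀ t, 1 ≤ t → t ≤ N → s.arr (.hh false) t = lcs X (s.arr .sa (t - 1)) (s.arr .sa t))
    (hL : N + 2 < M.L) :
    Run M names s (fun s' => ((∀ d, 1 ≤ d → d ≤ N → 1 ≤ s'.arr .nm d ∧ s'.arr .nm d ≤ N) ∧
      (∀ d e, 1 ≤ d → d ≤ N → 1 ≤ e → e ≤ N → d ≠ e →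
        (s'.arr .nm d = s'.arr .nm e ↔ w ≤ lcs X d e)) ∧ s'.time ≤ s.time + N) ∧
      Frame names s s') := by
  refine Run.frame ?_
  generalize hS : s.arr .sa = S at *
  rw [names, run_seq, run_set, run_seq, run_set]
  refine ⟨by simp; omega, by simp; omega, ?_⟩
  refine (Run.for (fun k s' => ∃ c₀, s'.var c = c₀ ∧ c₀ < k ∧ (1 < k → s'.arr .nm (S (k - 1)) = c₀) ∧
      (∀ a, 1 ≤ a → a < k → 1 ≤ s'.arr .nm (S a) ∧ s'.arr .nm (S a) ≤ c₀) ∧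
      ∀ a e, 1 ≤ a → a < e → e < k →
        (s'.arr .nm (S a) = s'.arr .nm (S e) ↔ w ≤ lcs X (S a) (S e))) 1 (N + 1) 0
    (by simp) (by omega) (by omega) ?_ (fun s' hf => ?_) rfl ?_).mono ?_
  · exact ⟨0, by simp, by omega, by omega, fun a _ _ => by omega, fun a e _ _ _ => by omega⟩
  · have : s'.var tot = N := by rw [hf.var tot rfl]; simpa
    simp [this]; omega
  · rintro k s' hk1 hk ⟨c₀, h1, h2, h3, h4, h5⟩ hf hik
    have e1 : s'.arr .sa = S := by rw [hf.arr .sa rfl]; simpa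
    have e2 : s'.arr (.hh false) = s.arr (.hh false) := by rw [hf.arr (.hh false) rfl]; simp
    have e3 : s'.var m = w := by rw [hf.var m rfl]; simpa
    have hk' := hh k hk1 (by omega)
    have hSk := hsa.le k hk1 (by omega)
    have hlt : ∀ a, 1 ≤ a → a < k - 1 → lcs X (S a) (S k) =
        min (lcs X (S a) (S (k - 1))) (lcs X (S (k - 1)) (S k)) := fun a ha1 ha2 =>
      lcs_eq_min (hsa.plt_of_lt ha2 (by omega)) (hsa.plt_of_lt (by omega) (by omega))
    have hne : ∀ a, a < k → S a ≠ S k := fun a ha h => by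
      have := hsa.inj (by omega) (by omega) h; omega
    rw [run_seq, run_ite, run_set, run_set, run_put, run_put]
    simp only [eval_arr, eval_var, eval_add, eval_lt, eval_ofNat, safe_arr, safe_var, safe_lt,
      safe_add, safe_ofNat, HState.set_var, HState.set_arr, HState.put_var, HState.put_arr,
      HState.put_time, HState.set_time, HState.tick_var, HState.tick_arr, HState.tick_time, h1,
      e1, e2, e3, hik, hk', reduceCtorEq, if_true, if_false, true_and, and_true]
    refine ⟨by omega, fun hc => ⟨by omega, by omega, by omega, ⟨c₀ + 1, rfl, by omega, ?_, ?_, ?_⟩,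
      by omega⟩, fun hc => ⟨by omega, by omega, ⟨c₀, rfl, by omega, ?_, ?_, ?_⟩, by omega⟩⟩
    · simp
    · intro a ha1 ha2
      rw [Function.update_apply]
      split_ifs with h
      · omega
      · have : a ≠ k := fun h' => h (by rw [h'])
        have := h4 a ha1 (by omega); omega
    · have hc' : lcs X (S (k - 1)) (S k) < w := by by_contra h; simp [h] at hc
      intro a e ha1 hae he
      rw [Function.update_of_ne (hne a (by omega))]
      by_cases hek : e = k
      · subst hek
        rw [Function.update_self]
        have g1 := (h4 a ha1 hae).2
        have g2 : lcs X (S a) (S e) < w := by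
          by_cases hak : a = e - 1
          · rw [hak]; exact hc'
          · rw [hlt a ha1 (by omega)]; omega
        omega
      · rw [Function.update_of_ne (hne e (by omega))]
        exact h5 a e ha1 hae (by omega)
    · simp
    -- The first prefix always opens a name, because it shares nothing with the empty prefix at rank
    -- 0; so names start at 1.
    · have hk2 : 1 < k := by
        by_contra h
        have hk1 : k = 1 := by omega
        subst hk1
        rw [show 1 - 1 = 0 from rfl, hsa.zero, lcs_zero_left] at hc
        simp [show 0 < w by omega] at hc
      intro a ha1 ha2
      rw [Function.update_apply]
      split_ifs with h
      · have := h4 (k - 1) (by omega) (by omega)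
        rw [h3 hk2] at this; omega
      · have : a ≠ k := fun h' => h (by rw [h'])
        exact h4 a ha1 (by omega)
    · have hc' : w ≤ lcs X (S (k - 1)) (S k) := by by_contra h; simp [not_le.1 h] at hc
      intro a e ha1 hae he
      rw [Function.update_of_ne (hne a (by omega))]
      by_cases hek : e = k
      · subst hek
        rw [Function.update_self]
        have g3 := h3 (by omega)
        by_cases hak : a = e - 1
        · rw [hak, g3]; simpa using hc'
        · have := h5 a (e - 1) ha1 (by omega) (by omega)
          rw [g3] at this
          rw [this, hlt a ha1 (by omega)]
          omega
      · rw [Function.update_of_ne (hne e (by omega))]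
        exact h5 a e ha1 hae (by omega)
  · rintro s' ⟨⟨c₀, h1, h2, h3, h4, h5⟩, -, ht⟩
    refine ⟨fun d hd1 hd2 => ?_, fun d e hd1 hd2 he1 he2 hne => ?_, by simpa using ht⟩
    · obtain ⟨t, ht1, ht2, rfl⟩ := hsa.surj' hd2 hd1
      have := h4 t ht1 (by omega); omega
    · obtain ⟨t, ht1, ht2, rfl⟩ := hsa.surj' hd2 hd1
      obtain ⟨u, hu1, hu2, rfl⟩ := hsa.surj' he2 he1
      rcases lt_trichotomy t u with h | h | h
      · exact h5 t u ht1 h (by omega)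
      · exact absurd (by rw [h]) hne
      · rw [lcs_comm, eq_comm]
        exact h5 u t hu1 h (by omega)

/-- Writing the names column by column makes vertically adjacent windows neighbours in the new
string. -/
def transpose : Prog :=
  .set i 0 ;; .for i cn (.put .X (bs + i) (.arr .nm (bs + i % st * st + i / st)))

theorem transpose_spec {s : St} {S b₀ : ℕ} (hcn : s.var cn = S * S) (hbs : s.var bs = b₀)
    (hst : s.var st = S) (hL : b₀ + S * S + 2 < M.L) :
    Run M transpose s (fun s' => ((∀ x < S, ∀ y < S,
        s'.arr .X (b₀ + y * S + x) = s.arr .nm (b₀ + x * S + y)) ∧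
      (∀ d, d < b₀ ∨ b₀ + S * S ≤ d → s'.arr .X d = s.arr .X d) ∧ s'.time ≤ s.time + S * S) ∧
      Frame transpose s s') := by
  refine Run.frame ?_
  rw [transpose, run_seq, run_set]
  refine ⟨by simp; omega, ?_⟩
  refine (Run.for (fun k s' => (∀ f < k, s'.arr .X (b₀ + f) =
      s.arr .nm (b₀ + f % S * S + f / S)) ∧
      (∀ d, d < b₀ ∨ b₀ + S * S ≤ d → s'.arr .X d = s.arr .X d)) 0 (S * S) 0
    (by simp) (by omega) (by omega) (by simp) (fun s' hf => ?_) rfl ?_).mono ?_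
  · have : s'.var cn = S * S := by rw [hf.var cn rfl]; simpa
    simp [this]
  · rintro k s' _ hk ⟨h1, h2⟩ hf hik
    have e1 : s'.arr .nm = s.arr .nm := by rw [hf.arr .nm rfl]; simp
    have e2 : s'.var bs = b₀ := by rw [hf.var bs rfl]; simpa
    have e3 : s'.var st = S := by rw [hf.var st rfl]; simpa
    have hS : 0 < S := by
      rcases Nat.eq_zero_or_pos S with rfl | h
      · simp at hk
      · exact h
    have hp := digit_lt (Nat.mod_lt k hS) (Nat.div_lt_of_lt_mul hk)
    rw [run_put]
    simp only [eval_arr, eval_var, eval_add, eval_mul, eval_div, eval_mod, eval_ofNat, safe_arr,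
      safe_var, safe_add, safe_mul, safe_div, safe_mod, safe_ofNat, HState.put_arr, HState.set_arr,
      HState.put_time, HState.tick_var, HState.tick_arr, HState.tick_time, e1, e2, e3, hik,
      reduceCtorEq, if_true, if_false, true_and, and_true]
    generalize hq : k / S = q at *
    generalize hu : k % S = u at *
    refine ⟨by omega, by and_intros <;> omega, by omega, ⟨fun f hf => ?_, fun d hd => ?_⟩, by omega⟩
    · by_cases hfk : f = k
      · rw [hfk, Function.update_self, hq, hu]
      · rw [Function.update_of_ne (by omega)]
        exact h1 f (by omega)
    · rw [Function.update_of_ne (by omega)]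
      exact h2 d hd
  · rintro s' ⟨⟨h1, h2⟩, -, ht⟩
    refine ⟨fun x hx y hy => ?_, h2, by simpa using ht⟩
    have h3 := h1 (y * S + x) (digit_lt hy hx)
    rwa [show (y * S + x) % S = x by
      rw [add_comm, Nat.add_mul_mod_self_right, Nat.mod_eq_of_lt hx], show (y * S + x) / S = y by
      rw [add_comm, Nat.add_mul_div_right _ _ (by omega), Nat.div_eq_of_lt hx, zero_add],
      ← add_assoc] at h3

def relabel : Prog :=
  (.set cn (n * n) ;; .set bs 1 ;; .set st n) ;; transpose ;;
  (.set cn (m * m) ;; .set bs (1 + n * n) ;; .set st m) ;; transpose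

theorem relabel_spec {s : St} {n₀ m₀ nq₀ : ℕ} (hS : Sizes n₀ m₀ nq₀ s)
    (hL : n₀ * n₀ + m₀ * m₀ + 4 < M.L) :
    Run M relabel s (fun s' => ((∀ x < n₀, ∀ y < n₀,
        s'.arr .X (1 + y * n₀ + x) = s.arr .nm (1 + x * n₀ + y)) ∧
      (∀ x < m₀, ∀ y < m₀,
        s'.arr .X (1 + n₀ * n₀ + y * m₀ + x) = s.arr .nm (1 + n₀ * n₀ + x * m₀ + y)) ∧
      s'.arr .X 0 = s.arr .X 0 ∧ s'.time ≤ s.time + (n₀ * n₀ + m₀ * m₀)) ∧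
      Frame relabel s s') := by
  refine Run.frame ?_
  refine Run.seq (R := fun s₁ => Sizes n₀ m₀ nq₀ s₁ ∧ s₁.var cn = n₀ * n₀ ∧ s₁.var bs = 1 ∧
    s₁.var st = n₀ ∧ s₁.arr = s.arr ∧ s₁.time = s.time) ?_ ?_
  · obtain ⟨g1, g2, g3, g4, g5⟩ := hS
    rw [run_seq, run_set, run_seq, run_set, run_set]
    simp only [eval_var, eval_mul, eval_ofNat, safe_var, safe_mul, safe_ofNat, HState.set_var,
      HState.set_arr, HState.set_time, g1, reduceCtorEq, if_true, if_false, true_and, and_true]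
    refine ⟨by omega, by omega, ⟨?_, ?_, ?_, ?_, ?_⟩⟩ <;> simp [g1, g2, g3, g4, g5]
  rintro s₁ ⟨hS1, v1, v2, v3, a1, t1⟩
  refine Run.seq (transpose_spec (M := M) v1 v2 v3 (by omega)) ?_
  rintro s₂ ⟨⟨b1, b2, b3⟩, f2⟩
  have hS2 := hS1.frame f2 rfl rfl rfl rfl rfl
  refine Run.seq (R := fun s₃ => s₃.var cn = m₀ * m₀ ∧ s₃.var bs = 1 + n₀ * n₀ ∧
    s₃.var st = m₀ ∧ s₃.arr = s₂.arr ∧ s₃.time = s₂.time) ?_ ?_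
  · rw [run_seq, run_set, run_seq, run_set, run_set]
    simp only [eval_var, eval_mul, eval_add, eval_ofNat, safe_var, safe_mul, safe_add, safe_ofNat,
      HState.set_var, HState.set_arr, HState.set_time, hS2.n, hS2.m, reduceCtorEq, if_true,
      if_false, true_and, and_true]
    omega
  rintro s₃ ⟨w1, w2, w3, a3, t3⟩
  refine (transpose_spec (M := M) w1 w2 w3 (by omega)).mono ?_
  rintro s₄ ⟨⟨c1, c2, c3⟩, -⟩
  have n2 : s₂.arr .nm = s.arr .nm := by rw [f2.arr .nm rfl, a1]
  rw [a3] at c1 c2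
  rw [a1] at b1 b2
  rw [n2] at c1
  refine ⟨fun x hx y hy => ?_, c1, ?_, by omega⟩
  · have := digit_lt hy hx
    rw [c2 _ (Or.inl (by omega)), b1 x hx y hy]
  · rw [c2 _ (Or.inl (by omega)), b2 _ (Or.inl (by omega))]

def setup : Prog :=
  load ;; powers ;; bitTables ;; build false ;; names ;; relabel ;; build true

/-- All data structures for the queries are present. -/
structure Ready (n₀ m₀ nq₀ : ℕ) (T P : ℕ → ℕ → ℕ) (X Y : ℕ → ℕ) (B : ℕ) (s : St) : Prop where
  sizes : Sizes n₀ m₀ nq₀ s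
  lceX : Lce false X (n₀ * n₀ + m₀ * m₀) B s
  lceY : Lce true Y (n₀ * n₀ + m₀ * m₀) B s
  X_eq : ∀ x < n₀, ∀ y < n₀, ∀ x' < m₀, ∀ y' < m₀,
    X (1 + x * n₀ + y) = X (1 + n₀ * n₀ + x' * m₀ + y') ↔ T x y = P x' y'
  Y_eq : ∀ x < n₀, ∀ y < n₀, ∀ x' < m₀, ∀ y' < m₀,
    Y (1 + y * n₀ + x) = Y (1 + n₀ * n₀ + y' * m₀ + x') ↔
      m₀ ≤ lcs X (1 + x * n₀ + y) (1 + n₀ * n₀ + x' * m₀ + y')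

/-- The phases take 1 + 1 + 2 + 220 + 1 + 1 + 220 = 446 times N iterations, within the stated 500 N.
-/
theorem setup_spec {s : St} {n₀ m₀ nq₀ : ℕ} {T P : ℕ → ℕ → ℕ} (hI : Inst M s.io n₀ m₀ nq₀ T P)
    (hd : ∀ v, s.arr .dict v = 0) (hX0 : s.arr .X 0 = 0) :
    Run M setup s (fun s' => ∃ X Y B, Ready n₀ m₀ nq₀ T P X Y B s' ∧ s'.io = s.io ∧
      s'.time ≤ s.time + 500 * (n₀ * n₀ + m₀ * m₀)) := by
  have hL := hI.large _ rfl
  have h2 := hI.two_le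
  suffices h : Run M setup s (fun s' => (∃ X Y B, Ready n₀ m₀ nq₀ T P X Y B s' ∧
      s'.time ≤ s.time + 500 * (n₀ * n₀ + m₀ * m₀)) ∧ Frame setup s s') by
    refine h.mono ?_
    rintro s' ⟨⟨X, Y, B, g1, g2⟩, hf⟩
    exact ⟨X, Y, B, g1, hf.io rfl, g2⟩
  refine Run.frame ?_
  generalize hN : n₀ * n₀ + m₀ * m₀ = N at *
  refine Run.seq (load_spec (M := M) hI hd hX0) ?_
  rintro s₁ ⟨⟨S1, R1, E1, t1⟩, f1⟩
  rw [hN] at R1 t1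
  refine Run.seq (powers_spec (M := M) (S1.tot.trans hN) (by omega) (by omega)) ?_
  rintro s₂ ⟨⟨B, g1, g2, g3, g4, g5, t2⟩, f2⟩
  have S2 := S1.frame f2 rfl rfl rfl rfl rfl
  refine Run.seq (bitTables_spec (M := M) (S2.tot.trans hN) h2 g2 g3 (by omega)) ?_
  rintro s₃ ⟨⟨g6, g7, t3⟩, f3⟩
  have S3 := S2.frame f3 rfl rfl rfl rfl rfl
  have X3 : s₃.arr .X = s₁.arr .X := by rw [f3.arr .X rfl, f2.arr .X rfl]
  have T3 : Tables N B s₃ := by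
    refine ⟨S3.tot.trans hN, by rw [S3.str, hN], by rw [f3.var b rfl, g1], ?_, g3, g4, ?_, g6, g7⟩
    · rcases Nat.eq_zero_or_pos B with rfl | h
      · simp at g4; omega
      · exact h
    · rw [f3.arr .pow rfl]; exact g5
  refine Run.seq (build_spec (M := M) false T3 (by rwa [X3]) hL) ?_
  rw [X3]
  rintro s₄ ⟨⟨L4, SA4, hh4, X4, t4⟩, f4⟩
  have S4 := S3.frame f4 rfl rfl rfl rfl rfl
  generalize s₁.arr .X = X at *
  refine Run.seq (names_spec (M := M) (S4.tot.trans hN) S4.m hI.one_le SA4 hh4 (by omega)) ?_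
  rintro s₅ ⟨⟨n5, e5, t5⟩, f5⟩
  have S5 := S4.frame f5 rfl rfl rfl rfl rfl
  have L5 := L4.frame f5 rfl rfl rfl rfl rfl rfl rfl rfl rfl rfl
  refine Run.seq (relabel_spec (M := M) S5 (by omega)) ?_
  rintro s₆ ⟨⟨r1, r2, r3, t6⟩, f6⟩
  have S6 := S5.frame f6 rfl rfl rfl rfl rfl
  have L6 := L5.frame f6 rfl rfl rfl rfl rfl rfl rfl rfl rfl rfl
  have posT : ∀ x < n₀, ∀ y < n₀, x * n₀ + y < n₀ * n₀ := fun x hx y hy => digit_lt hx hy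
  have posP : ∀ x < m₀, ∀ y < m₀, x * m₀ + y < m₀ * m₀ := fun x hx y hy => digit_lt hx hy
  -- The names lie in {1, …, N}, so the second string can again be suffix sorted. Remains of the
  -- first sort beyond position N in the array do not matter.
  have R6 : IsRanked (s₆.arr .X) N := by
    have X50 : s₅.arr .X 0 = 0 := by
      rw [f5.arr .X rfl, X4 0 (by omega)]; exact R1.zero
    have key : ∀ d, 1 ≤ d → d ≤ N → 0 < s₆.arr .X d ∧ s₆.arr .X d ≤ N := by
      intro d h1 h2
      rcases pos_cases h1 (by rwa [hN]) with ⟨x, hx, y, hy, rfl⟩ | ⟨x, hx, y, hy, rfl⟩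
      · rw [r1 y hy x hx]
        have := posT y hy x hx
        exact n5 _ (by omega) (by omega)
      · rw [r2 y hy x hx]
        have := posP y hy x hx
        exact n5 _ (by omega) (by omega)
    refine ⟨⟨by rw [r3, X50], fun d h1 h2 => (key d h1 h2).1⟩, fun d h2 => ?_⟩
    rcases Nat.eq_zero_or_pos d with rfl | h1
    · rw [r3, X50]; omega
    · exact (key d h1 h2).2
  refine (build_spec (M := M) true L6.tabs R6 hL).mono ?_
  rintro s₇ ⟨⟨L7, -, -, -, t7⟩, f7⟩
  refine ⟨X, s₆.arr .X, B, ⟨S6.frame f7 rfl rfl rfl rfl rfl, ?_, ?_, E1, ?_⟩, by omega⟩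
  · rw [hN]; exact L6.frame f7 rfl rfl rfl rfl rfl rfl rfl rfl rfl rfl
  · rw [hN]; exact L7
  · intro x hx y hy x' hx' y' hy'
    have h3 := posT x hx y hy
    have h4 := posP x' hx' y' hy'
    rw [r1 x hx y hy, r2 x' hx' y' hy', e5 _ _ (by omega) (by omega) (by omega) (by omega) (by omega)]

/-! ### Queries -/

set_option linter.constructorNameAsVariable false

theorem lcs_lt_ne {X : ℕ → ℕ} {d e : ℕ} (hd : lcs X d e < d) (he : lcs X d e < e) :
    X (d - lcs X d e) ≠ X (e - lcs X d e) := by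
  intro h
  have h1 := (le_lcs_iff.1 (le_refl (lcs X d e))).2.2
  have h2 : lcs X d e + 1 ≤ lcs X d e := le_lcs_iff.2 ⟨hd, he, fun i hi => by
    by_cases hi' : i = lcs X d e
    · rwa [hi']
    · exact h1 i (by omega)⟩
  omega

theorem sum_range_sub {f : ℕ → ℕ} {c v : ℕ} (h : ∀ i, c - v ≤ i → i < c → f i = 0) :
    ∑ i ∈ Finset.range c, f i = ∑ i ∈ Finset.range (c - v), f i := by
  refine (Finset.sum_subset (Finset.range_mono (Nat.sub_le c v)) fun i h1 h2 => ?_).symm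
  simp only [Finset.mem_range] at h1 h2
  exact h i (by omega) h1

/-- Tells whether the pattern, shifted by `(p, q)`, has a mismatch at its point `(x, y)`. -/
def mis (T P : ℕ → ℕ → ℕ) (p q x y : ℕ) : ℕ := if T (p + x) (q + y) = P x y then 0 else 1

/-- The number of mismatches in the row of the given index. -/
def misRow (T P : ℕ → ℕ → ℕ) (m p q x : ℕ) : ℕ := ∑ y ∈ Finset.range m, mis T P p q x y

/-- Jumps within one row from right to left; `col` counts the columns not yet inspected. A jump may
run past the beginning of the row, in which case the truncated difference `col - v` is 0 and the row
is finished. -/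
def scanRow : Prog :=
  .set col m ;; .loop (.lt 0 col) (
    .set d (1 + n * n + (row - 1) * m + (col - 1)) ;;
    .set e (1 + (qx + row - 1) * n + (qy + col - 1)) ;; lce false ;; .set col (col - v) ;;
    .ite col (.set cnt (cnt + 1) ;; .set col (col - 1)) (.set v v))

section

variable {n₀ m₀ nq₀ B : ℕ} {T P : ℕ → ℕ → ℕ} {X Y : ℕ → ℕ}

theorem Ready.frame {s s' : St} (h : Ready n₀ m₀ nq₀ T P X Y B s) {p : Prog} (hf : Frame p s s')
    (h1 : ∀ x ∈ [Var.n, .m, .nq, .tot, .str, .b], p.wv x = false)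
    (h2 : ∀ a ∈ [Arr.pow, .lsb, .log, .rk false, .rk true, .hh false, .hh true, .mask false,
      .mask true, .sp false, .sp true], p.wa a = false) : Ready n₀ m₀ nq₀ T P X Y B s' := by
  obtain ⟨g1, g2, g3, g4, g5⟩ := h
  refine ⟨g1.frame hf ?_ ?_ ?_ ?_ ?_, g2.frame hf ?_ ?_ ?_ ?_ ?_ ?_ ?_ ?_ ?_ ?_,
    g3.frame hf ?_ ?_ ?_ ?_ ?_ ?_ ?_ ?_ ?_ ?_, g4, g5⟩
  all_goals first | exact h1 _ (by simp) | exact h2 _ (by simp)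

theorem scanRow_spec {s : St} {p q x c₀ : ℕ} (hR : Ready n₀ m₀ nq₀ T P X Y B s)
    (hrow : s.var row = x + 1) (hqx : s.var qx = p) (hqy : s.var qy = q) (hcnt : s.var cnt = c₀)
    (hx : x < m₀) (hp : p + m₀ ≤ n₀) (hq : q + m₀ ≤ n₀)
    (hcL : c₀ + misRow T P m₀ p q x + 1 < M.L)
    (hL : (n₀ * n₀ + m₀ * m₀) * (n₀ * n₀ + m₀ * m₀ + 1) + 3 * (n₀ * n₀ + m₀ * m₀) + 4 < M.L) :
    Run M scanRow s (fun s' => (s'.var cnt = c₀ + misRow T P m₀ p q x ∧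
      s'.time ≤ s.time + misRow T P m₀ p q x + 1) ∧ Frame scanRow s s') := by
  refine Run.frame ?_
  have hS := hR.sizes
  have hN : 0 ≤ (n₀ * n₀ + m₀ * m₀) * (n₀ * n₀ + m₀ * m₀ + 1) := Nat.zero_le _
  have hn0 : n₀ ≤ n₀ * n₀ := Nat.le_mul_self n₀
  have hm0 : m₀ ≤ m₀ * m₀ := Nat.le_mul_self m₀
  rw [scanRow, run_seq, run_set]
  refine ⟨by simp, ?_⟩
  simp only [eval_var, hS.m]
  -- Every iteration finds a mismatch, except possibly a last one that exhausts the row; the summand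
  -- for c = 0 pays for it.
  refine Run.loop_frame (fun s' => ∃ c, s'.var col = c ∧ c ≤ m₀ ∧
      s'.var cnt + ∑ y ∈ Finset.range c, mis T P p q x y = c₀ + misRow T P m₀ p q x ∧
      s'.time + ∑ y ∈ Finset.range c, mis T P p q x y ≤
        s.time + misRow T P m₀ p q x + (if c = 0 then 1 else 0))
    (fun s' => s'.var col) ?_ ?_ ?_ ?_
  · exact ⟨m₀, by simp, le_rfl, by simp [hcnt, misRow], by simp [misRow]⟩
  · rintro s' - -; simp; omega
  · rintro s' ⟨c, h1, h2, h3, h4⟩ hf hc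
    have hc' : 0 < c := by by_contra h; simp [h1, h] at hc
    rw [if_neg (by omega)] at h4
    have w1 : s'.var row = x + 1 := by rw [hf.var row rfl]; simpa
    have w2 : s'.var qx = p := by rw [hf.var qx rfl]; simpa
    have w3 : s'.var qy = q := by rw [hf.var qy rfl]; simpa
    have w4 : s'.var n = n₀ := by rw [hf.var n rfl]; simpa using hS.n
    have w5 : s'.var m = m₀ := by rw [hf.var m rfl]; simpa using hS.m
    have L0 : Lce false X (n₀ * n₀ + m₀ * m₀) B s' := by
      obtain ⟨k1, k2, k3, k4⟩ := hR.lceX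
      have k1' : Tables (n₀ * n₀ + m₀ * m₀) B (s.set col m₀) := ⟨k1.tot, k1.str, k1.b, k1.one_le,
        k1.pow_le, k1.lt_pow, k1.pow, k1.lsb, k1.log⟩
      exact Lce.frame (s := s.set col m₀) ⟨k1', k2, k3, k4⟩ hf rfl rfl rfl rfl rfl rfl rfl rfl rfl rfl
    have posP := digit_lt (a := x) (b := c - 1) hx (show c - 1 < m₀ by omega)
    have posT := digit_lt (a := p + x) (b := q + c - 1) (A := n₀) (B := n₀) (by omega) (by omega)
    have mulT : (p + x) * n₀ ≤ n₀ * n₀ := Nat.mul_le_mul_right _ (by omega)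
    rw [run_seq, run_set, run_seq, run_set]
    simp only [eval_var, eval_add, eval_sub, eval_mul, eval_ofNat, safe_var, safe_add, safe_sub,
      safe_mul, safe_ofNat, HState.set_var, HState.tick_var, w1, w2, w3, w4, w5, h1,
      reduceCtorEq, if_true, if_false, true_and, and_true, Nat.add_sub_cancel]
    rw [show p + (x + 1) - 1 = p + x by omega]
    refine ⟨by and_intros <;> omega, by and_intros <;> omega, ?_⟩
    obtain ⟨k1, k2, k3, k4⟩ := L0
    refine Run.seq (lce_spec (M := M) false (X := X) (B := B)
      (d₀ := 1 + n₀ * n₀ + x * m₀ + (c - 1)) (e₀ := 1 + (p + x) * n₀ + (q + c - 1)) ⟨⟨k1.tot, k1.str, k1.b, k1.one_le,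
      k1.pow_le, k1.lt_pow, k1.pow, k1.lsb, k1.log⟩, k2, k3, k4⟩ (by simp) (by simp) (by omega)
      (by omega) (by omega) (by omega)) ?_
    rintro s₁ ⟨⟨hv, ht⟩, hf1⟩
    have u1 : s₁.var col = c := by rw [hf1.var col rfl]; simpa
    have u2 : s₁.var cnt = s'.var cnt := by rw [hf1.var cnt rfl]; simp
    simp only [HState.set_time, HState.tick_time] at ht
    have hle := (le_lcs_iff.1 (le_refl (lcs X (1 + n₀ * n₀ + x * m₀ + (c - 1))
      (1 + (p + x) * n₀ + (q + c - 1))))).2.2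
    have hlt := @lcs_lt_ne X (1 + n₀ * n₀ + x * m₀ + (c - 1)) (1 + (p + x) * n₀ + (q + c - 1))
    generalize lcs X (1 + n₀ * n₀ + x * m₀ + (c - 1)) (1 + (p + x) * n₀ + (q + c - 1)) = v₀ at *
    have hmis : ∀ y < c, mis T P p q x y =
        if X (1 + n₀ * n₀ + x * m₀ + (c - 1) - (c - 1 - y)) =
          X (1 + (p + x) * n₀ + (q + c - 1) - (c - 1 - y)) then 0 else 1 := by
      intro y hy
      have := hR.X_eq (p + x) (by omega) (q + y) (by omega) x hx y (by omega)
      rw [show 1 + n₀ * n₀ + x * m₀ + (c - 1) - (c - 1 - y) = 1 + n₀ * n₀ + x * m₀ + y by omega,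
        show 1 + (p + x) * n₀ + (q + c - 1) - (c - 1 - y) = 1 + (p + x) * n₀ + (q + y) by omega, mis]
      exact if_congr (this.symm.trans eq_comm) rfl rfl
    have hsum : ∑ y ∈ Finset.range c, mis T P p q x y =
        ∑ y ∈ Finset.range (c - v₀), mis T P p q x y := by
      refine sum_range_sub fun y hy1 hy2 => ?_
      rw [hmis y hy2, if_pos (hle _ (by omega))]
    rw [hsum] at h3 h4
    rw [run_seq, run_set, run_ite, run_seq, run_set, run_set, run_set]
    simp only [eval_var, eval_add, eval_sub, eval_mul, eval_ofNat, safe_var, safe_add, safe_sub,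
      safe_mul, safe_ofNat, HState.set_var, HState.set_time, hv, ht, u1, u2,
      reduceCtorEq, if_true, if_false, true_and, and_true]
    refine ⟨fun hcv => ?_, fun hcv => ⟨⟨0, hcv, by omega, ?_, ?_⟩, by omega⟩⟩
    · have hone : mis T P p q x (c - v₀ - 1) = 1 := by
        rw [hmis _ (by omega), if_neg]
        rw [show c - 1 - (c - v₀ - 1) = v₀ by omega]
        exact hlt (by omega) (by omega)
      obtain ⟨z, hz⟩ := Nat.exists_eq_succ_of_ne_zero hcv
      rw [hz, Nat.succ_sub_one] at hone
      rw [hz, Finset.sum_range_succ, hone] at h3 h4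
      rw [hz]
      refine ⟨by omega, by omega, ⟨z, by omega, by omega, by omega, ?_⟩, by omega⟩
      split_ifs <;> omega
    · rw [hcv] at h3; exact h3
    · rw [hcv] at h4; simp at h4 ⊢; omega
  · rintro s' ⟨c, h1, h2, h3, h4⟩ hf hc
    have hc' : c = 0 := by by_contra h; simp [h1, Nat.pos_of_ne_zero h] at hc
    subst hc'
    simp at h3 h4
    exact ⟨h3, by omega⟩

/-- The number of mismatches of the pattern, shifted by `(p, q)`. -/
def misAll (T P : ℕ → ℕ → ℕ) (m p q : ℕ) : ℕ := ∑ x ∈ Finset.range m, misRow T P m p q x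

theorem misAll_le (m p q : ℕ) : misAll T P m p q ≤ m * m := by
  have h : ∀ x, misRow T P m p q x ≤ m := fun x => by
    refine (Finset.sum_le_card_nsmul _ _ 1 fun y _ => ?_).trans (by simp)
    unfold mis; split_ifs <;> omega
  refine (Finset.sum_le_card_nsmul _ _ m fun x _ => h x).trans (by simp)

/-- The same walk one level higher: jumps through the rows, comparing the names of the windows that
end in the last column of the pattern. `scanRow` is entered only for rows with a mismatch. -/
def query : Prog :=
  .set row m ;; .set cnt 0 ;; .loop (.lt 0 row) (
    .set d (1 + n * n + (m - 1) * m + (row - 1)) ;;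
    .set e (1 + (qy + m - 1) * n + (qx + row - 1)) ;; lce true ;; .set row (row - v) ;;
    .ite row (scanRow ;; .set row (row - 1)) (.set v v))

/-- The windows ending in column m − 1 of the pattern and column q + m − 1 of the text are precisely
the row of the pattern and the piece of text it is compared with. Windows ending further left may
wrap into the preceding row, but these columns are not used. -/
theorem Ready.row_eq {s : St} (hR : Ready n₀ m₀ nq₀ T P X Y B s) {p q x : ℕ} (hm : 1 ≤ m₀)
    (hx : x < m₀) (hp : p + m₀ ≤ n₀) (hq : q + m₀ ≤ n₀) :
    Y (1 + n₀ * n₀ + (m₀ - 1) * m₀ + x) = Y (1 + (q + m₀ - 1) * n₀ + (p + x)) ↔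
      misRow T P m₀ p q x = 0 := by
  rw [eq_comm, hR.Y_eq (p + x) (by omega) (q + m₀ - 1) (by omega) x hx (m₀ - 1) (by omega),
    le_lcs_iff, misRow, Finset.sum_eq_zero_iff]
  have key : ∀ i < m₀, (X (1 + (p + x) * n₀ + (q + m₀ - 1) - i) =
      X (1 + n₀ * n₀ + x * m₀ + (m₀ - 1) - i) ↔ mis T P p q x (m₀ - 1 - i) = 0) := by
    intro i hi
    have := hR.X_eq (p + x) (by omega) (q + (m₀ - 1 - i)) (by omega) x hx (m₀ - 1 - i) (by omega)
    rw [show 1 + (p + x) * n₀ + (q + m₀ - 1) - i = 1 + (p + x) * n₀ + (q + (m₀ - 1 - i)) by omega,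
      show 1 + n₀ * n₀ + x * m₀ + (m₀ - 1) - i = 1 + n₀ * n₀ + x * m₀ + (m₀ - 1 - i) by omega, this,
      mis]
    split_ifs <;> simp_all
  constructor
  · rintro ⟨-, -, h⟩ y hy
    have hy := Finset.mem_range.1 hy
    have := (key (m₀ - 1 - y) (by omega)).1 (h _ (by omega))
    rwa [show m₀ - 1 - (m₀ - 1 - y) = y by omega] at this
  · intro h
    exact ⟨by omega, by omega, fun i hi => (key i hi).2 (h _ (Finset.mem_range.2 (by omega)))⟩

theorem query_spec {s : St} {p q : ℕ} (hR : Ready n₀ m₀ nq₀ T P X Y B s) (hm : 1 ≤ m₀)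
    (hqx : s.var qx = p) (hqy : s.var qy = q) (hp : p + m₀ ≤ n₀) (hq : q + m₀ ≤ n₀)
    (hL : (n₀ * n₀ + m₀ * m₀) * (n₀ * n₀ + m₀ * m₀ + 1) + 3 * (n₀ * n₀ + m₀ * m₀) + 4 < M.L) :
    Run M query s (fun s' => (s'.var cnt = misAll T P m₀ p q ∧
      s'.time ≤ s.time + 3 * misAll T P m₀ p q + 1) ∧ Frame query s s') := by
  refine Run.frame ?_
  have hS := hR.sizes
  have hN : 0 ≤ (n₀ * n₀ + m₀ * m₀) * (n₀ * n₀ + m₀ * m₀ + 1) := Nat.zero_le _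
  have hn0 : n₀ ≤ n₀ * n₀ := Nat.le_mul_self n₀
  have hm0 : m₀ ≤ m₀ * m₀ := Nat.le_mul_self m₀
  have hall := misAll_le (T := T) (P := P) m₀ p q
  rw [query, run_seq, run_set, run_seq, run_set]
  refine ⟨by simp, by simp; omega, ?_⟩
  simp only [eval_var, eval_ofNat, hS.m]
  -- Only the set of written variables matters for a frame, so a dummy program assigning to the same
  -- variables provides it.
  have hR' : Ready n₀ m₀ nq₀ T P X Y B ((s.set row m₀).set cnt 0) :=
    hR.frame (p := .set row 0 ;; .set cnt 0) ⟨fun x hx => by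
      simp [Stmt.wv] at hx; simp [hx], fun _ _ => rfl, fun _ => rfl⟩ (by decide) (by decide)
  -- A row with k ≥ 1 mismatches costs one iteration here and at most k + 1 in `scanRow`, together
  -- at most 3 k. A last jump over matching rows only is paid for by the summand for c = 0.
  refine Run.loop_frame (fun s' => ∃ c, s'.var row = c ∧ c ≤ m₀ ∧
      s'.var cnt + ∑ x ∈ Finset.range c, misRow T P m₀ p q x = misAll T P m₀ p q ∧
      s'.time + 3 * ∑ x ∈ Finset.range c, misRow T P m₀ p q x ≤
        s.time + 3 * misAll T P m₀ p q + (if c = 0 then 1 else 0))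
    (fun s' => s'.var row) ?_ ?_ ?_ ?_
  · exact ⟨m₀, by simp, le_rfl, by simp [misAll], by simp [misAll]⟩
  · rintro s' - -; simp; omega
  · rintro s' ⟨c, h1, h2, h3, h4⟩ hf hc
    have hc' : 0 < c := by by_contra h; simp [h1, h] at hc
    rw [if_neg (by omega)] at h4
    have R0 := hR'.frame hf (by decide) (by decide)
    have w2 : s'.var qx = p := by rw [hf.var qx rfl]; simpa
    have w3 : s'.var qy = q := by rw [hf.var qy rfl]; simpa
    have w4 := R0.sizes.n
    have w5 := R0.sizes.m
    have posP := digit_lt (a := m₀ - 1) (b := c - 1) (A := m₀) (B := m₀) (by omega) (by omega)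
    have posT := digit_lt (a := q + m₀ - 1) (b := p + c - 1) (A := n₀) (B := n₀) (by omega)
      (by omega)
    have mulP : (m₀ - 1) * m₀ ≤ m₀ * m₀ := Nat.mul_le_mul_right _ (by omega)
    rw [run_seq, run_set, run_seq, run_set]
    simp only [eval_var, eval_add, eval_sub, eval_mul, eval_ofNat, safe_var, safe_add, safe_sub,
      safe_mul, safe_ofNat, HState.set_var, HState.tick_var, w2, w3, w4, w5, h1,
      reduceCtorEq, if_true, if_false, true_and, and_true]
    refine ⟨by and_intros <;> omega, by and_intros <;> omega, ?_⟩
    have R1 : Ready n₀ m₀ nq₀ T P X Y B ((s'.tick.set d (1 + n₀ * n₀ + (m₀ - 1) * m₀ + (c - 1))).set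
        e (1 + (q + m₀ - 1) * n₀ + (p + c - 1))) :=
      R0.frame (p := .set d 0 ;; .set e 0) ⟨fun x hx => by
        simp [Stmt.wv] at hx; simp [hx], fun _ _ => rfl, fun _ => rfl⟩ (by decide) (by decide)
    refine Run.seq (lce_spec (M := M) true (X := Y) (B := B)
      (d₀ := 1 + n₀ * n₀ + (m₀ - 1) * m₀ + (c - 1)) (e₀ := 1 + (q + m₀ - 1) * n₀ + (p + c - 1))
      R1.lceY (by simp) (by simp) (by omega) (by omega) (by omega) (by omega)) ?_
    rintro s₁ ⟨⟨hv, ht⟩, hf1⟩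
    have R2 := R1.frame hf1 (by decide) (by decide)
    have u1 : s₁.var row = c := by rw [hf1.var row rfl]; simpa
    have u2 : s₁.var cnt = s'.var cnt := by rw [hf1.var cnt rfl]; simp
    have u3 : s₁.var qx = p := by rw [hf1.var qx rfl]; simpa
    have u4 : s₁.var qy = q := by rw [hf1.var qy rfl]; simpa
    simp only [HState.set_time, HState.tick_time] at ht
    have hle := (le_lcs_iff.1 (le_refl (lcs Y (1 + n₀ * n₀ + (m₀ - 1) * m₀ + (c - 1))
      (1 + (q + m₀ - 1) * n₀ + (p + c - 1))))).2.2
    have hlt := @lcs_lt_ne Y (1 + n₀ * n₀ + (m₀ - 1) * m₀ + (c - 1))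
      (1 + (q + m₀ - 1) * n₀ + (p + c - 1))
    generalize lcs Y (1 + n₀ * n₀ + (m₀ - 1) * m₀ + (c - 1))
      (1 + (q + m₀ - 1) * n₀ + (p + c - 1)) = v₀ at *
    have hmis : ∀ x < c, (Y (1 + n₀ * n₀ + (m₀ - 1) * m₀ + (c - 1) - (c - 1 - x)) =
          Y (1 + (q + m₀ - 1) * n₀ + (p + c - 1) - (c - 1 - x)) ↔ misRow T P m₀ p q x = 0) := by
      intro x hx
      rw [← hR.row_eq (x := x) hm (by omega) hp hq,
        show 1 + n₀ * n₀ + (m₀ - 1) * m₀ + (c - 1) - (c - 1 - x) =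
          1 + n₀ * n₀ + (m₀ - 1) * m₀ + x by omega,
        show 1 + (q + m₀ - 1) * n₀ + (p + c - 1) - (c - 1 - x) =
          1 + (q + m₀ - 1) * n₀ + (p + x) by omega]
    have hsum : ∑ x ∈ Finset.range c, misRow T P m₀ p q x =
        ∑ x ∈ Finset.range (c - v₀), misRow T P m₀ p q x := by
      refine sum_range_sub fun x hx1 hx2 => ?_
      exact (hmis x hx2).1 (hle _ (by omega))
    rw [hsum] at h3 h4
    rw [run_seq, run_set, run_ite, run_seq, run_set]
    simp only [eval_var, eval_sub, safe_var, safe_sub, HState.set_var, HState.set_time, hv, ht, u1,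
      u2, reduceCtorEq, if_true, if_false, true_and, and_true]
    refine ⟨fun hcv => ?_, fun hcv => ⟨⟨0, hcv, by omega, ?_, ?_⟩, by omega⟩⟩
    · have hbad : misRow T P m₀ p q (c - v₀ - 1) ≠ 0 := by
        intro h
        have := (hmis _ (by omega)).2 h
        rw [show c - 1 - (c - v₀ - 1) = v₀ by omega] at this
        exact hlt (by omega) (by omega) this
      obtain ⟨z, hz⟩ := Nat.exists_eq_succ_of_ne_zero hcv
      rw [hz, Nat.succ_sub_one] at hbad
      rw [hz, Finset.sum_range_succ] at h3 h4
      have R3 : Ready n₀ m₀ nq₀ T P X Y B (s₁.set row (c - v₀)) :=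
        R2.frame (p := .set row 0) ⟨fun x hx => by
          simp [Stmt.wv] at hx; simp [hx], fun _ _ => rfl, fun _ => rfl⟩ (by decide) (by decide)
      refine (scanRow_spec (M := M) (x := z) (c₀ := s'.var cnt) R3 (by simp [hz]) (by simpa)
        (by simpa) (by simpa) (by omega) hp hq (by omega) hL).mono ?_
      rintro s₂ ⟨⟨g1, g2⟩, hf2⟩
      have u5 : s₂.var row = z + 1 := by rw [hf2.var row rfl]; simp [hz]
      simp only [HState.set_time] at g2
      rw [run_set]
      simp only [eval_var, eval_sub, eval_ofNat, safe_var, safe_sub, safe_ofNat, HState.set_var,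
        HState.set_time, u5, g1, reduceCtorEq, if_true, if_false, true_and, and_true]
      refine ⟨by omega, ⟨z, by omega, by omega, by omega, ?_⟩, by omega⟩
      split_ifs <;> omega
    · rw [hcv] at h3; exact h3
    · rw [hcv] at h4; simp at h4 ⊢; omega
  · rintro s' ⟨c, h1, h2, h3, h4⟩ hf hc
    have hc' : c = 0 := by by_contra h; simp [h1, Nat.pos_of_ne_zero h] at hc
    subst hc'
    simp at h3 h4
    exact ⟨h3, by omega⟩

/-- The answers overwrite the input from cell 0 on. Answer k is written after shift k has been read,
and to a cell in front of all later shifts, so no unread input is lost. -/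
def queries : Prog :=
  .set ip (3 + 3 * (n * n) + 3 * (m * m)) ;; .set i 0 ;; .for i nq (
    .set qx (.io ip) ;; .set qy (.io (ip + 1)) ;; query ;; .output i cnt ;; .set ip (ip + 2))

theorem queries_spec {s : St} {io₀ : ℕ → ℕ} (hI : Inst M io₀ n₀ m₀ nq₀ T P) (hio : s.io = io₀)
    (hR : Ready n₀ m₀ nq₀ T P X Y B s) {f : ℕ → ℕ}
    (hf : ∀ i < nq₀, f i = misAll T P m₀ (io₀ (3 + 3 * (n₀ * n₀) + 3 * (m₀ * m₀) + 2 * i))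
      (io₀ (3 + 3 * (n₀ * n₀) + 3 * (m₀ * m₀) + 2 * i + 1))) :
    Run M queries s (fun s' => (∀ i < nq₀, s'.io i = f i) ∧
      s'.time ≤ s.time + 3 * ∑ i ∈ Finset.range nq₀, f i + 2 * nq₀) := by
  have hS := hR.sizes
  have hL := hI.large _ rfl
  have hB := hI.bound
  have hBL := hI.bound_lt
  have h2 := hI.two_le
  have hL' : (n₀ * n₀ + m₀ * m₀) * (n₀ * n₀ + m₀ * m₀ + 1) + 3 * (n₀ * n₀ + m₀ * m₀) + 4 < M.L := by
    omega
  rw [queries, run_seq, run_set, run_seq, run_set]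
  simp only [eval_var, eval_add, eval_mul, eval_ofNat, safe_var, safe_add, safe_mul,
    safe_ofNat, hS.n, hS.m, true_and, and_true]
  refine ⟨by and_intros <;> omega, by omega, ?_⟩
  have hR' : Ready n₀ m₀ nq₀ T P X Y B
      ((s.set ip (3 + 3 * (n₀ * n₀) + 3 * (m₀ * m₀))).set i 0) :=
    hR.frame (p := .set ip 0 ;; .set i 0) ⟨fun x hx => by
      simp [Stmt.wv] at hx; simp [hx], fun _ _ => rfl, fun _ => rfl⟩ (by decide) (by decide)
  refine (Run.for_inv (fun k s' => s'.var ip = 3 + 3 * (n₀ * n₀) + 3 * (m₀ * m₀) + 2 * k ∧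
      (∀ j < k, s'.io j = f j) ∧ (∀ j, k ≤ j → s'.io j = io₀ j) ∧
      s'.time ≤ s.time + 3 * ∑ i ∈ Finset.range k, f i + 2 * k) 0 nq₀
    (by simp) (by omega) (by omega) ?_ (fun s' hf => ?_) rfl ?_).mono ?_
  · simp [hio]
  · have := (hR'.frame hf (by decide) (by decide)).sizes.nq
    simp [this]
  · rintro k s' _ hk ⟨h1, h3, h4, h5⟩ hfr hik
    have R0 := hR'.frame hfr (by decide) (by decide)
    have e1 := h4 (3 + 3 * (n₀ * n₀) + 3 * (m₀ * m₀) + 2 * k) (by omega)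
    have e2 := h4 (3 + 3 * (n₀ * n₀) + 3 * (m₀ * m₀) + 2 * k + 1) (by omega)
    have g1 := hI.shift_x k hk
    have g2 := hI.shift_y k hk
    have g3 := hf k hk
    generalize io₀ (3 + 3 * (n₀ * n₀) + 3 * (m₀ * m₀) + 2 * k) = p at *
    generalize io₀ (3 + 3 * (n₀ * n₀) + 3 * (m₀ * m₀) + 2 * k + 1) = q at *
    rw [run_seq, run_set, run_seq, run_set]
    simp only [eval_var, eval_add, eval_io, eval_ofNat, safe_var, safe_add, safe_io, safe_ofNat,
      HState.set_var, HState.set_io, HState.tick_var, HState.tick_io, h1, e1, e2, reduceCtorEq,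
      if_true, if_false, true_and, and_true]
    refine ⟨by omega, by and_intros <;> omega, ?_⟩
    have R1 : Ready n₀ m₀ nq₀ T P X Y B ((s'.tick.set qx p).set qy q) :=
      R0.frame (p := .set qx 0 ;; .set qy 0) ⟨fun x hx => by
        simp [Stmt.wv] at hx; simp [hx], fun _ _ => rfl, fun _ => rfl⟩ (by decide) (by decide)
    refine Run.seq (query_spec (M := M) R1 hI.one_le (by simp) (by simp) g1 g2 hL') ?_
    rintro s₁ ⟨⟨b1, b2⟩, hf1⟩
    have u1 : s₁.var i = k := by rw [hf1.var i rfl]; simpa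
    have u2 : s₁.var ip = 3 + 3 * (n₀ * n₀) + 3 * (m₀ * m₀) + 2 * k := by
      rw [hf1.var ip rfl]; simpa
    have u3 : s₁.io = s'.io := by rw [hf1.io rfl]; simp
    simp only [HState.set_time, HState.tick_time] at b2
    rw [run_seq, run_output, run_set]
    simp only [eval_var, eval_add, eval_ofNat, safe_var, safe_add, safe_ofNat, HState.set_var,
      HState.set_io, HState.set_time, HState.output_var, HState.output_io, HState.output_time, u1, u2,
      u3, b1, reduceCtorEq, if_true, if_false, true_and, and_true]
    refine ⟨by omega, by omega, by omega, fun j hj => ?_, fun j hj => ?_, ?_⟩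
    · rw [Function.update_apply]
      split_ifs with hjk
      · rw [hjk, g3]
      · exact h3 j (by omega)
    · rw [Function.update_of_ne (by omega)]
      exact h4 j (by omega)
    · rw [Finset.sum_range_succ, g3]; omega
  · rintro s' ⟨⟨-, h1, -, h2⟩, -⟩
    exact ⟨h1, h2⟩

end

end Kangaroo

/-! ### The encoding of the input -/

namespace Kangaroo

set_option linter.unusedSimpArgs false

open WordRAM

theorem getD_flatMap_three {α : Type} (g₁ g₂ g₃ : α → ℤ) (l : List α) (rest : List ℤ) {i : ℕ}
    (hi : i < l.length) :
    (l.flatMap (fun e => [g₁ e, g₂ e, g₃ e]) ++ rest).getD (3 * i) 0 = g₁ l[i] ∧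
    (l.flatMap (fun e => [g₁ e, g₂ e, g₃ e]) ++ rest).getD (3 * i + 1) 0 = g₂ l[i] ∧
    (l.flatMap (fun e => [g₁ e, g₂ e, g₃ e]) ++ rest).getD (3 * i + 2) 0 = g₃ l[i] := by
  induction l generalizing i with
  | nil => simp at hi
  | cons e l ih =>
    cases i with
    | zero => simp
    | succ i =>
      have := ih (i := i) (by simpa using hi)
      simpa [Nat.mul_add, List.getD_eq_getElem?_getD] using this

theorem getD_flatMap_two {α : Type} (g₁ g₂ : α → ℤ) (l : List α) {i : ℕ} (hi : i < l.length) :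
    (l.flatMap (fun e => [g₁ e, g₂ e])).getD (2 * i) 0 = g₁ l[i] ∧
    (l.flatMap (fun e => [g₁ e, g₂ e])).getD (2 * i + 1) 0 = g₂ l[i] := by
  induction l generalizing i with
  | nil => simp at hi
  | cons e l ih =>
    cases i with
    | zero => simp
    | succ i =>
      have := ih (i := i) (by simpa using hi)
      simpa [Nat.mul_add, List.getD_eq_getElem?_getD] using this

theorem length_flatMap_three {α : Type} (g₁ g₂ g₃ : α → ℤ) (l : List α) :
    (l.flatMap (fun e => [g₁ e, g₂ e, g₃ e])).length = 3 * l.length := by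
  induction l with
  | nil => simp
  | cons e l ih => simp only [List.flatMap_cons, List.length_append, ih, List.length_cons]; simp; ring

theorem length_flatMap_two {α : Type} (g₁ g₂ : α → ℤ) (l : List α) :
    (l.flatMap (fun e => [g₁ e, g₂ e])).length = 2 * l.length := by
  induction l with
  | nil => simp
  | cons e l ih => simp only [List.flatMap_cons, List.length_append, ih, List.length_cons]; simp; ring

/-- The word that represents the integer `z`. -/
def word (w : ℕ) (z : ℤ) : ℕ := (BitVec.ofInt w z).toNat

theorem word_lt (w : ℕ) (z : ℤ) : word w z < 2 ^ w := (BitVec.ofInt w z).isLt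

theorem cast_word (w : ℕ) (z : ℤ) : (word w z : ℤ) = z % (2 ^ w : ℕ) := by
  rw [word, BitVec.toNat_ofInt, Int.toNat_of_nonneg]
  exact Int.emod_nonneg _ (by positivity)

theorem word_natCast {w k : ℕ} (h : k < 2 ^ w) : word w k = k := by
  have := cast_word w k
  rw [Int.emod_eq_of_lt (by omega) (by exact_mod_cast h)] at this
  exact_mod_cast this

theorem word_inj {w K : ℕ} {a b : ℤ} (ha : |a| ≤ K) (hb : |b| ≤ K) (hK : 2 * K < 2 ^ w) :
    word w a = word w b ↔ a = b := by
  refine ⟨fun h => ?_, fun h => by rw [h]⟩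
  have h1 := cast_word w a
  rw [h, cast_word w b] at h1
  have h3 : ((2 ^ w : ℕ) : ℤ) ∣ a - b := (Int.ModEq.dvd (show b ≡ a [ZMOD _] from h1))
  have h4 : |a - b| < ((2 ^ w : ℕ) : ℤ) := by
    have : ((2 * K : ℕ) : ℤ) < ((2 ^ w : ℕ) : ℤ) := by exact_mod_cast hK
    push_cast at this ⊢
    have := abs_sub a b
    linarith
  have := Int.eq_zero_of_abs_lt_dvd h3 h4
  omega

/-- Keeps the dictionary polynomially large, although a negative character is itself a huge word. -/
theorem unsign_word_le {w K : ℕ} {a : ℤ} (ha : |a| ≤ K) (hK : 2 * K < 2 ^ w) :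
    unsign (2 ^ w) (word w a) ≤ 2 * K + 1 := by
  have h := cast_word w a
  have hlt := word_lt w a
  generalize word w a = u at *
  generalize 2 ^ w = W at *
  have h1 := abs_le.1 ha
  unfold unsign
  rcases le_or_gt 0 a with h0 | h0
  · rw [Int.emod_eq_of_lt h0 (by omega)] at h
    split_ifs <;> omega
  · have : a % (W : ℤ) = a + W := by
      rw [← Int.add_emod_right, Int.emod_eq_of_lt (by omega) (by omega)]
    rw [this] at h
    have h2 : (W - u) % W = W - u := Nat.mod_eq_of_lt (by omega)
    rw [h2]
    split_ifs <;> omega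

/-- The characters of a string, as words. -/
def chars (w : ℕ) (S : String2D) (x y : ℕ) : ℕ := word w ((S (x, y)).getD 0)

theorem mem_square {k : ℕ} {u : ℤ × ℤ} :
    u ∈ String2D.square k ↔ ∃ x < k, ∃ y < k, u = ((x : ℤ), (y : ℤ)) := by
  constructor
  · rintro ⟨⟨h1, h2⟩, h3, h4⟩
    exact ⟨u.1.toNat, by omega, u.2.toNat, by omega, Prod.ext (by simp; omega) (by simp; omega)⟩
  · rintro ⟨x, hx, y, hy, rfl⟩
    exact ⟨⟨by simp, by simpa⟩, by simp, by simpa⟩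

def squareFinset (k : ℕ) : Finset (ℤ × ℤ) :=
  (Finset.range k ×ˢ Finset.range k).image (fun p => ((p.1 : ℤ), (p.2 : ℤ)))

theorem mem_squareFinset {k : ℕ} {u : ℤ × ℤ} : u ∈ squareFinset k ↔ u ∈ String2D.square k := by
  simp only [squareFinset, Finset.mem_image, Finset.mem_product, Finset.mem_range, mem_square]
  constructor
  · rintro ⟨⟨x, y⟩, ⟨hx, hy⟩, rfl⟩; exact ⟨x, hx, y, hy, rfl⟩
  · rintro ⟨x, hx, y, hy, rfl⟩; exact ⟨⟨x, y⟩, ⟨hx, hy⟩, rfl⟩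

theorem card_squareFinset (k : ℕ) : (squareFinset k).card = k * k := by
  rw [squareFinset, Finset.card_image_of_injective, Finset.card_product, Finset.card_range]
  rintro ⟨x, y⟩ ⟨x', y'⟩ h
  simpa using h

theorem length_of_stores {S : String2D} {k : ℕ} {l : List ((ℤ × ℤ) × ℤ)}
    (hdom : S.dom = String2D.square k) (h : String2D.Stores l S) : l.length = k * k := by
  rw [← card_squareFinset, ← List.length_map (as := l) Prod.fst, ← List.toFinset_card_of_nodup h.1]
  congr 1
  ext u
  rw [mem_squareFinset, ← hdom]
  simp only [List.mem_toFinset, List.mem_map, String2D.dom, Set.mem_ofPred_eq]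
  constructor
  · rintro ⟨⟨u', a⟩, h1, rfl⟩; exact ⟨a, (h.2 _ _).1 h1⟩
  · rintro ⟨a, ha⟩; exact ⟨(u, a), (h.2 _ _).2 ha, rfl⟩

theorem cells_of_stores {M : Mach} {S : String2D} {w k o K : ℕ} {l : List ((ℤ × ℤ) × ℤ)}
    {io : ℕ → ℕ} (hW : M.W = 2 ^ w) (hdom : S.dom = String2D.square k)
    (h : String2D.Stores l S) (hK : S.CharsBounded K)
    (hx : ∀ (f : ℕ) (hf : f < l.length), io (o + 3 * f) = word w l[f].1.1)
    (hy : ∀ (f : ℕ) (hf : f < l.length), io (o + 3 * f + 1) = word w l[f].1.2)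
    (hc : ∀ (f : ℕ) (hf : f < l.length), io (o + 3 * f + 2) = word w l[f].2)
    (hk : k ≤ 2 ^ w) (hKW : 2 * K < 2 ^ w) (hKL : 2 * K + 1 < M.L) (hB : o + 3 * (k * k) ≤ M.B) :
    Cells M io o (k * k) k (chars w S) ∧
      ∀ x < k, ∀ y < k, ∃ f < k * k, io (o + 3 * f) = x ∧ io (o + 3 * f + 1) = y := by
  have hlen := length_of_stores hdom h
  have key : ∀ (f : ℕ) (hf : f < l.length), ∃ x < k, ∃ y < k, io (o + 3 * f) = x ∧
      io (o + 3 * f + 1) = y ∧ io (o + 3 * f + 2) = chars w S x y ∧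
      unsign M.W (io (o + 3 * f + 2)) < M.L ∧ l[f].1 = ((x : ℤ), (y : ℤ)) := by
    intro f hf
    have h1 : S l[f].1 = some l[f].2 := (h.2 _ _).1 (List.getElem_mem hf)
    have h2 : l[f].1 ∈ S.dom := ⟨_, h1⟩
    rw [hdom, mem_square] at h2
    obtain ⟨x, hxk, y, hyk, hxy⟩ := h2
    refine ⟨x, hxk, y, hyk, ?_, ?_, ?_, ?_, hxy⟩
    · rw [hx f hf, hxy]; exact word_natCast (by omega)
    · rw [hy f hf, hxy]; exact word_natCast (by omega)
    · rw [hc f hf, chars, ← hxy, h1]; rfl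
    · rw [hc f hf, hW]
      exact (unsign_word_le (hK _ _ h1) hKW).trans_lt hKL
  refine ⟨⟨hB, fun f hf => ?_, fun f hf => ?_, fun f hf => ?_, fun f hf => ?_⟩, fun x hxk y hyk => ?_⟩
  any_goals
    obtain ⟨x, hxk, y, hyk, g1, g2, g3, g4, -⟩ := key f (by omega)
    simp only [g1, g2, hxk, hyk, g3]
  · rwa [← g3]
  · have h1 : ((x : ℤ), (y : ℤ)) ∈ S.dom := by
      rw [hdom, mem_square]; exact ⟨x, hxk, y, hyk, rfl⟩
    obtain ⟨a, ha⟩ := h1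
    obtain ⟨f, hf, hfa⟩ := List.getElem_of_mem ((h.2 _ _).2 ha)
    obtain ⟨x', -, y', -, g1, g2, -, -, g5⟩ := key f hf
    rw [hfa] at g5
    simp only [Prod.mk.injEq, Nat.cast_inj] at g5
    exact ⟨f, by omega, by rw [g1, g5.1], by rw [g2, g5.2]⟩

/-- The mismatch set is the translate by (p, q) of the points of the pattern where `mis` is 1, and
passing from characters to words identifies no two of them by `word_inj`. -/
theorem ham_eq {P T : String2D} {m n w K p q : ℕ} (hP : P.dom = String2D.square m)
    (hT : T.dom = String2D.square n) (hPK : P.CharsBounded K) (hTK : T.CharsBounded K)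
    (hK : 2 * K < 2 ^ w) (hp : p + m ≤ n) (hq : q + m ≤ n) :
    (P.shift ((p : ℤ), (q : ℤ))).Ham T = misAll (chars w T) (chars w P) m p q := by
  have hmis : ∀ x < m, ∀ y < m, ∃ a b, P ((x : ℤ), (y : ℤ)) = some a ∧
      T (((p + x : ℕ) : ℤ), ((q + y : ℕ) : ℤ)) = some b ∧
      (mis (chars w T) (chars w P) p q x y = if a ≠ b then 1 else 0) := by
    intro x hx y hy
    have h1 : ((x : ℤ), (y : ℤ)) ∈ P.dom := by rw [hP, mem_square]; exact ⟨x, hx, y, hy, rfl⟩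
    have h2 : (((p + x : ℕ) : ℤ), ((q + y : ℕ) : ℤ)) ∈ T.dom := by
      rw [hT, mem_square]; exact ⟨p + x, by omega, q + y, by omega, rfl⟩
    obtain ⟨a, ha⟩ := h1
    obtain ⟨b, hb⟩ := h2
    refine ⟨a, b, ha, hb, ?_⟩
    have hw := word_inj (hTK _ _ hb) (hPK _ _ ha) hK
    rw [mis, chars, chars, ha, hb, Option.getD_some, Option.getD_some]
    simp only [hw]
    by_cases hab : a = b
    · simp [hab]
    · simp [hab, Ne.symm hab]
  have hset : String2D.MI (P.shift ((p : ℤ), (q : ℤ))) T =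
      (((Finset.range m ×ˢ Finset.range m).filter
        (fun z => mis (chars w T) (chars w P) p q z.1 z.2 = 1)).image
        (fun z => (((p + z.1 : ℕ) : ℤ), ((q + z.2 : ℕ) : ℤ))) : Finset (ℤ × ℤ)) := by
    ext u
    simp only [Finset.coe_image, Set.mem_image, Finset.mem_coe, Finset.mem_filter,
      Finset.mem_product, Finset.mem_range, String2D.MI, Set.mem_ofPred_eq, String2D.shift]
    constructor
    · rintro ⟨a, b, ha, hb, hab⟩
      have h1 : u - ((p : ℤ), (q : ℤ)) ∈ P.dom := ⟨a, ha⟩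
      rw [hP, mem_square] at h1
      obtain ⟨x, hx, y, hy, hu⟩ := h1
      have hu' : u = (((p + x : ℕ) : ℤ), ((q + y : ℕ) : ℤ)) := by
        rw [sub_eq_iff_eq_add] at hu
        rw [hu]; simp [add_comm]
      obtain ⟨a', b', ha', hb', h⟩ := hmis x hx y hy
      rw [hu, ha'] at ha
      rw [hu', hb'] at hb
      simp only [Option.some.injEq] at ha hb
      refine ⟨(x, y), ⟨⟨hx, hy⟩, ?_⟩, hu'.symm⟩
      rw [h, ha, hb, if_pos hab]
    · rintro ⟨⟨x, y⟩, ⟨⟨hx, hy⟩, h1⟩, rfl⟩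
      obtain ⟨a, b, ha, hb, h⟩ := hmis x hx y hy
      refine ⟨a, b, ?_, hb, fun hab => ?_⟩
      · rw [← ha]; congr 1; simp
      · simp [h, hab] at h1
  rw [String2D.Ham, hset, Set.ncard_coe_finset, Finset.card_image_of_injective, Finset.card_filter,
    Finset.sum_product, misAll]
  · refine Finset.sum_congr rfl fun x hx => Finset.sum_congr rfl fun y hy => ?_
    simp only [mis]
    split_ifs <;> simp_all
  · rintro ⟨x, y⟩ ⟨x', y'⟩ h
    simp only [Prod.mk.injEq, Nat.cast_inj] at h
    exact Prod.ext (by simpa using h.1) (by simpa using h.2)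

/-- Two opposite corners of the square, (0, 0) and (m − 1, m − 1), already force all bounds. -/
theorem shift_bounds {P T : String2D} {m n : ℕ} {u : ℤ × ℤ} (hm : 1 ≤ m)
    (hP : P.dom = String2D.square m) (hT : T.dom = String2D.square n)
    (h : (P.shift u).dom ⊆ T.dom) : ∃ p q : ℕ, u = ((p : ℤ), (q : ℤ)) ∧ p + m ≤ n ∧ q + m ≤ n := by
  have key : ∀ v ∈ String2D.square m, v + u ∈ String2D.square n := by
    intro v hv
    rw [← hT]
    refine h ?_
    rw [← hP] at hv
    obtain ⟨a, ha⟩ := hv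
    exact ⟨a, by simpa [String2D.shift] using ha⟩
  have h1 := key (0, 0) (mem_square.2 ⟨0, by omega, 0, by omega, rfl⟩)
  have h2 := key (((m - 1 : ℕ) : ℤ), ((m - 1 : ℕ) : ℤ))
    (mem_square.2 ⟨m - 1, by omega, m - 1, by omega, rfl⟩)
  obtain ⟨⟨a1, a2⟩, a3, a4⟩ := h1
  obtain ⟨⟨b1, b2⟩, b3, b4⟩ := h2
  simp only [Prod.fst_add, Prod.snd_add] at a1 a2 a3 a4 b1 b2 b3 b4
  exact ⟨u.1.toNat, u.2.toNat, Prod.ext (by simp; omega) (by simp; omega), by omega, by omega⟩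

theorem sum_range_getD (l : List ℕ) : ∑ i ∈ Finset.range l.length, l.getD i 0 = l.sum := by
  induction l with
  | nil => simp
  | cons a l ih =>
    rw [List.length_cons, Finset.sum_range_succ']
    simp only [List.getD_cons_succ, List.getD_cons_zero, ih, List.sum_cons]
    ring

end Kangaroo

/-! ### Word length, initial state, and the final assembly -/

namespace Kangaroo

open WordRAM

/-- Computes the address of the arrays behind the input area. -/
def prelude : Program :=
  .seq (.load 3 0) (.seq (.const 5 11) (.seq (.op .mul 3 3 3) (.op .mul 1 3 5)))

/-- Registers 3 and 5 are the first two temporaries, so the values left in them do no harm. -/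
theorem prelude_exec {w : ℕ} (σ : State w) (h0 : σ.reg 0 = 0) : ∃ σ' : State w,
    Exec prelude σ 4 σ' ∧ σ'.mem = σ.mem ∧
    σ'.reg 1 = σ.mem 0 * σ.mem 0 * BitVec.ofNat w 11 ∧
    ∀ k, k ≠ 1 → k ≠ 3 → k ≠ 5 → σ'.reg k = σ.reg k := by
  refine ⟨_, .seq (t₁ := 1) (t₂ := 3) (.load _ _ _) (.seq (t₁ := 1) (t₂ := 2) (.const _ _ _)
    (.seq (t₁ := 1) (t₂ := 1) (.op _ _ _ _ _) (.op _ _ _ _ _))), rfl, ?_, fun k h1 h3 h5 => ?_⟩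
  · simp [State.setReg, BinOp.eval, h0]
  · simp [State.setReg, h1, h3, h5]

/-- Arrays of length N ^ (κ + 20) contain all codes, levels and dictionary indices. The further
factor N ^ 10 ≥ 2 ^ 10 makes room for up to 64 such arrays and the input area. The exponents are
generous because N may be as small as 2. -/
theorem size_bounds {N κ : ℕ} (hN : 2 ≤ N) :
    (N + 1) * (N + 1) * (N + 1) + N * (N + 1) + 12 * N + 40 < N ^ (κ + 20) ∧
    16 * N < N ^ (κ + 20) ∧ 2 * N ^ κ + 1 < N ^ (κ + 20) ∧ 16 * N + 64 * N ^ (κ + 20) ≤ N ^ (κ + 30) := by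
  have h1 : 1 ≤ N ^ κ := Nat.one_le_pow _ _ (by omega)
  have h2 : 2 ^ 10 ≤ N ^ 10 := Nat.pow_le_pow_left hN 10
  have h3 : 2 ^ 17 ≤ N ^ 17 := Nat.pow_le_pow_left hN 17
  have h4 : N ^ 20 ≤ N ^ (κ + 20) := Nat.pow_le_pow_right (by omega) (by omega)
  have h5 : N ^ 20 = N ^ 17 * (N * N * N) := by ring
  have h6 : 2 ^ 17 * (N * N * N) ≤ N ^ 17 * (N * N * N) := Nat.mul_le_mul_right _ h3
  have h7 : 2 * N ≤ N * N := Nat.mul_le_mul_right _ hN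
  have h8 : 2 * (N * N) ≤ N * N * N := by
    rw [mul_assoc]; exact Nat.mul_le_mul_right _ hN
  have h9 : N ^ (κ + 20) = N ^ κ * N ^ 20 := pow_add _ _ _
  have h10 : N ^ (κ + 30) = N ^ 10 * N ^ (κ + 20) := by rw [← pow_add]; congr 1; omega
  have h11 : 2 ^ 10 * N ^ (κ + 20) ≤ N ^ 10 * N ^ (κ + 20) := Nat.mul_le_mul_right _ h2
  have h12 : 2 ^ 20 ≤ N ^ 20 := Nat.pow_le_pow_left hN 20
  have h13 : N ^ κ * 2 ^ 20 ≤ N ^ κ * N ^ 20 := Nat.mul_le_mul_left _ h12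
  have h14 : (N + 1) * (N + 1) * (N + 1) = N * N * N + 3 * (N * N) + 3 * N + 1 := by ring
  have h15 : N * (N + 1) = N * N + N := by ring
  norm_num at *
  refine ⟨?_, ?_, ?_, ?_⟩ <;> omega

noncomputable def algorithm : Program := .seq prelude (compile (.seq setup queries))

/-- The arrays begin behind the input, where memory is zero, so the program starts with all arrays
zero; the dictionary and the sentinel rely on this. -/
theorem init_sim {w n B L : ℕ} {input : List ℤ} (h0 : input.getD 0 0 = n)
    (hB : B = 11 * (n * n)) (hlen : input.length ≤ B)
    (hF : Mach.Fits ⟨2 ^ w, L, B⟩ Arr w) : ∃ σ : State w,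
      Exec prelude (State.init w input) 4 σ ∧
      Sim ⟨2 ^ w, L, B⟩ σ (⟨fun _ => 0, fun _ _ => 0, fun i => word w (input.getD i 0), 0⟩ : St) := by
  obtain ⟨σ, h1, h2, h3, h4⟩ := prelude_exec (State.init w input) rfl
  have hmem := hF.mem
  have hnn : n ≤ n * n := Nat.le_mul_self n
  simp only at hmem
  have hlL : 0 < Fintype.card Arr * L := Nat.mul_pos (Fintype.card_pos_iff.2 ⟨.X⟩) (by
    have := hF.hL; simp only at this; omega)
  have hmem0 : (State.init w input).mem 0 = BitVec.ofNat w n := by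
    have h : (0 : BitVec w).toNat = 0 := by simp
    simp only [State.init, h, h0, BitVec.ofInt_natCast]
  refine ⟨σ, h1, ?_, ?_, fun z => ?_, fun a i hi => ?_, fun i hi => ?_⟩
  · rw [h4 0 (by omega) (by omega) (by omega)]; rfl
  · rw [h3, hmem0, ← BitVec.ofNat_mul, ← BitVec.ofNat_mul, BitVec.toNat_ofNat,
      Nat.mod_eq_of_lt (by omega)]
    simp only [hB]; ring
  · rw [h4 _ (by simp only [rvar]; omega) (by simp only [rvar]; omega) (by simp only [rvar]; omega)]
    rfl
  · have hlt := addr_lt hF a hi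
    have hge : B ≤ addr (⟨2 ^ w, L, B⟩ : Mach) a i := by simp only [addr]; omega
    rw [h2]
    simp only [State.init]
    rw [BitVec.toNat_ofNat, Nat.mod_eq_of_lt hlt, List.getD_eq_default _ _ (by omega)]
    simp
  · rw [h2]
    simp only [State.init, word]
    rw [BitVec.toNat_ofNat, Nat.mod_eq_of_lt (by simp only at hi; omega)]

end Kangaroo

open Kangaroo

/-- One word-RAM program computes all `Ham (P + q) T`, `q ∈ Q`, in `O(n² + ∑ Ham (P + q) T)` steps.
The characters are polynomially bounded in the size `n² + m²` of the strings (exponent `κ`), and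
the words have `w ≥ C log₂ (n² + m²)` bits; `C` and the constant `c` of the running time depend
only on `κ`. On halting, register `0` holds the address of the array of answers. -/
theorem mainTheorem7 :
    ∃ A : WordRAM.Program, ∀ κ : ℕ, ∃ C c : ℕ,
      ∀ (m n w : ℕ) (P T : String2D) (Q : Finset (ℤ × ℤ))
        (lP lT : List ((ℤ × ℤ) × ℤ)) (lQ : List (ℤ × ℤ)),
        1 ≤ m → m ≤ n →
        P.dom = String2D.square m → T.dom = String2D.square n →
        P.CharsBounded ((n ^ 2 + m ^ 2) ^ κ) → T.CharsBounded ((n ^ 2 + m ^ 2) ^ κ) →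
        (∀ q ∈ Q, (P.shift q).dom ⊆ T.dom) →
        String2D.Stores lP P → String2D.Stores lT T →
        lQ.Nodup → (∀ q, q ∈ lQ ↔ q ∈ Q) →
        (n ^ 2 + m ^ 2) ^ C ≤ 2 ^ w →
        ∃ (t : ℕ) (σ : WordRAM.State w),
          WordRAM.Exec A (WordRAM.State.init w (String2D.encodeInput m n lP lT lQ)) t σ ∧
          t ≤ c * (n ^ 2 + ∑ q ∈ Q, (P.shift q).Ham T) ∧
          ∀ (i : ℕ) (hi : i < lQ.length),
            (σ.mem (σ.reg 0 + BitVec.ofNat w i)).toNat = (P.shift lQ[i]).Ham T := by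
  obtain ⟨c, hc⟩ : ∃ c, (Stmt.seq setup queries).cost = c := ⟨_, rfl⟩
  -- The prelude takes 4 steps. With N ≤ 2 n² and |Q| ≤ n², the clock bound 500 N + 3 D + 2 |Q| + 1
  -- is at most 1010 (n² + D), where D is the total number of mismatches.
  refine ⟨algorithm, fun κ => ⟨κ + 30, 4 + c * 1010, ?_⟩⟩
  intro m n w P T Q lP lT lQ hm hmn hP hT hPK hTK hQ hlP hlT hnd hmem hw
  have hmm : 1 * 1 ≤ m * m := Nat.mul_le_mul hm hm
  have hmn2 : m * m ≤ n * n := Nat.mul_le_mul hmn hmn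
  have hNN : n ^ 2 + m ^ 2 = n * n + m * m := by ring
  rw [hNN] at hPK hTK hw
  generalize hN : n * n + m * m = N at hPK hTK hw
  obtain ⟨b1, b2, b3, b4⟩ := size_bounds (N := N) (κ := κ) (by omega)
  have hnn : n ≤ n * n := Nat.le_mul_self n
  generalize hL : N ^ (κ + 20) = L at b1 b2 b3 b4
  generalize hK : N ^ κ = K at hPK hTK b3
  have hcard : Fintype.card Arr ≤ 64 := by decide
  have hcL : Fintype.card Arr * L ≤ 64 * L := Nat.mul_le_mul_right _ hcard
  have lenT := length_of_stores hT hlT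
  have lenP := length_of_stores hP hlP
  have hshift : ∀ q ∈ lQ, ∃ x y : ℕ, q = ((x : ℤ), (y : ℤ)) ∧ x + m ≤ n ∧ y + m ≤ n := fun q hq =>
    shift_bounds hm hP hT (hQ q ((hmem q).1 hq))
  -- Distinct shifts with nonnegative coordinates below n: this is why a constant cost per shift is
  -- absorbed by n².
  have lenQ : lQ.length ≤ n * n := by
    rw [← card_squareFinset, ← List.toFinset_card_of_nodup hnd]
    refine Finset.card_le_card fun q hq => ?_
    obtain ⟨x, y, rfl, hx, hy⟩ := hshift q (List.mem_toFinset.1 hq)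
    rw [mem_squareFinset, mem_square]
    exact ⟨x, by omega, y, by omega, rfl⟩
  generalize hin : String2D.encodeInput m n lP lT lQ = input
  have hin' : input = ([(n : ℤ), (m : ℤ), (lQ.length : ℤ)] ++
      (lT.flatMap (fun e => [e.1.1, e.1.2, e.2]) ++ (lP.flatMap (fun e => [e.1.1, e.1.2, e.2]) ++
        lQ.flatMap (fun q => [q.1, q.2])))) := by
    rw [← hin]; simp [String2D.encodeInput]
  have hT3 := length_flatMap_three (fun e : (ℤ × ℤ) × ℤ => e.1.1) (fun e => e.1.2) (fun e => e.2) lT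
  have hP3 := length_flatMap_three (fun e : (ℤ × ℤ) × ℤ => e.1.1) (fun e => e.1.2) (fun e => e.2) lP
  have hQ2 := length_flatMap_two (fun e : ℤ × ℤ => e.1) (fun e => e.2) lQ
  -- The length is 3 + 3 n² + 3 m² + 2 |Q| ≤ 3 + 8 n², whence the factor 11 in the prelude; this
  -- bound is computable from n alone.
  have hlen : input.length ≤ 11 * (n * n) := by
    rw [hin', List.length_append, List.length_append, List.length_append, hT3, hP3, hQ2]
    simp only [List.length_cons, List.length_nil]
    omega
  have gT : ∀ j, input.getD (3 + j) 0 = (lT.flatMap (fun e => [e.1.1, e.1.2, e.2]) ++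
      (lP.flatMap (fun e => [e.1.1, e.1.2, e.2]) ++ lQ.flatMap (fun q => [q.1, q.2]))).getD j 0 := by
    intro j
    rw [hin', List.getD_append_right _ _ _ _ (by simp)]
    congr 1; simp
  have gP : ∀ j, input.getD (3 + 3 * (n * n) + j) 0 =
      (lP.flatMap (fun e => [e.1.1, e.1.2, e.2]) ++ lQ.flatMap (fun q => [q.1, q.2])).getD j 0 := by
    intro j
    rw [add_assoc, gT, List.getD_append_right _ _ _ _ (by rw [hT3]; omega), hT3, lenT]
    congr 1; omega
  have gQ : ∀ j, input.getD (3 + 3 * (n * n) + 3 * (m * m) + j) 0 =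
      (lQ.flatMap (fun q => [q.1, q.2])).getD j 0 := by
    intro j
    rw [add_assoc, gP, List.getD_append_right _ _ _ _ (by rw [hP3]; omega), hP3, lenP]
    congr 1; omega
  have hF : Mach.Fits ⟨2 ^ w, L, 11 * (n * n)⟩ Arr w :=
    ⟨rfl, by simp only; omega, by simp only; omega, by simp only; omega⟩
  obtain ⟨σ₀, e₀, sim₀⟩ := init_sim (w := w) (n := n) (L := L) (input := input)
    (by rw [hin']; simp) rfl hlen hF
  have hcT := cells_of_stores (M := ⟨2 ^ w, L, 11 * (n * n)⟩) (w := w) (k := n) (o := 3)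
    (io := fun i => word w (input.getD i 0)) rfl hT hlT hTK
    (fun f hf => by
      simp only [gT]
      rw [(getD_flatMap_three (fun e : (ℤ × ℤ) × ℤ => e.1.1) _ _ lT _ hf).1])
    (fun f hf => by
      simp only [add_assoc 3, gT]
      rw [(getD_flatMap_three (fun e : (ℤ × ℤ) × ℤ => e.1.1) _ _ lT _ hf).2.1])
    (fun f hf => by
      simp only [add_assoc 3, gT]
      rw [(getD_flatMap_three (fun e : (ℤ × ℤ) × ℤ => e.1.1) _ _ lT _ hf).2.2])
    (by omega) (by omega) (by simp only; omega) (by simp only; omega)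
  have hcP := cells_of_stores (M := ⟨2 ^ w, L, 11 * (n * n)⟩) (w := w) (k := m)
    (o := 3 + 3 * (n * n)) (io := fun i => word w (input.getD i 0)) rfl hP hlP hPK
    (fun f hf => by
      simp only [gP]
      rw [(getD_flatMap_three (fun e : (ℤ × ℤ) × ℤ => e.1.1) _ _ lP _ hf).1])
    (fun f hf => by
      simp only [add_assoc (3 + 3 * (n * n)), gP]
      rw [(getD_flatMap_three (fun e : (ℤ × ℤ) × ℤ => e.1.1) _ _ lP _ hf).2.1])
    (fun f hf => by
      simp only [add_assoc (3 + 3 * (n * n)), gP]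
      rw [(getD_flatMap_three (fun e : (ℤ × ℤ) × ℤ => e.1.1) _ _ lP _ hf).2.2])
    (by omega) (by omega) (by simp only; omega) (by simp only; omega)
  have hQx : ∀ (i : ℕ) (hi : i < lQ.length), ∃ x y : ℕ, lQ[i] = ((x : ℤ), (y : ℤ)) ∧ x + m ≤ n ∧
      y + m ≤ n ∧ word w (input.getD (3 + 3 * (n * n) + 3 * (m * m) + 2 * i) 0) = x ∧
      word w (input.getD (3 + 3 * (n * n) + 3 * (m * m) + 2 * i + 1) 0) = y := by
    intro i hi
    obtain ⟨x, y, hxy, hx, hy⟩ := hshift _ (List.getElem_mem hi)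
    obtain ⟨g1, g2⟩ := getD_flatMap_two (fun q : ℤ × ℤ => q.1) (fun q => q.2) lQ hi
    refine ⟨x, y, hxy, hx, hy, ?_, ?_⟩
    · rw [gQ, g1, hxy]; exact word_natCast (by omega)
    · rw [add_assoc _ (2 * i), gQ, g2, hxy]; exact word_natCast (by omega)
  have hI : Inst ⟨2 ^ w, L, 11 * (n * n)⟩ (fun i => word w (input.getD i 0)) n m lQ.length
      (chars w T) (chars w P) := by
    refine ⟨hm, hmn, ?_, ?_, ?_, hcT.1, hcP.1, hcT.2, hcP.2, fun _ _ _ _ => word_lt _ _,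
      fun _ _ _ _ => word_lt _ _, fun i hi => ?_, fun i hi => ?_, ?_, ?_, ?_⟩
    · rw [hin']; exact word_natCast (by omega)
    · rw [hin']; exact word_natCast (by omega)
    · rw [hin']; exact word_natCast (by omega)
    · obtain ⟨x, y, -, hx, hy, g1, g2⟩ := hQx i hi
      simp only [g1]; exact hx
    · obtain ⟨x, y, -, hx, hy, g1, g2⟩ := hQx i hi
      simp only [g2]; exact hy
    · simp only; omega
    · rintro N' rfl
      rw [hN]; exact b1
    · simp only; omega
  have hham : ∀ i < lQ.length, (lQ.map fun q => (P.shift q).Ham T).getD i 0 =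
      misAll (chars w T) (chars w P) m
        (word w (input.getD (3 + 3 * (n * n) + 3 * (m * m) + 2 * i) 0))
        (word w (input.getD (3 + 3 * (n * n) + 3 * (m * m) + 2 * i + 1) 0)) := by
    intro i hi
    obtain ⟨x, y, hxy, hx, hy, g1, g2⟩ := hQx i hi
    rw [g1, g2, ← ham_eq (w := w) hP hT hPK hTK (by omega) hx hy, ← hxy,
      List.getD_eq_getElem _ _ (by simpa using hi), List.getElem_map]
  obtain ⟨s', hs', hio, htime⟩ : Run ⟨2 ^ w, L, 11 * (n * n)⟩ (Stmt.seq setup queries)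
      (⟨fun _ => 0, fun _ _ => 0, fun i => word w (input.getD i 0), 0⟩ : St) (fun s' =>
        (∀ i < lQ.length, s'.io i = (lQ.map fun q => (P.shift q).Ham T).getD i 0) ∧
        s'.time ≤ 500 * N + 3 * ∑ q ∈ Q, (P.shift q).Ham T + 2 * lQ.length) := by
    refine Run.seq (setup_spec (M := ⟨2 ^ w, L, 11 * (n * n)⟩) hI (fun _ => rfl) rfl) ?_
    rintro s₁ ⟨X, Y, B, hR, hio, ht⟩
    refine (queries_spec (M := ⟨2 ^ w, L, 11 * (n * n)⟩) hI hio hR hham).mono ?_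
    rintro s₂ ⟨h1, h2⟩
    refine ⟨h1, ?_⟩
    have hsum : ∑ i ∈ Finset.range lQ.length, (lQ.map fun q => (P.shift q).Ham T).getD i 0 =
        ∑ q ∈ Q, (P.shift q).Ham T := by
      have := sum_range_getD (lQ.map fun q => (P.shift q).Ham T)
      rw [List.length_map] at this
      rw [this, ← List.sum_toFinset _ hnd]
      refine Finset.sum_congr ?_ fun _ _ => rfl
      ext q
      rw [List.mem_toFinset, hmem]
    rw [hsum] at h2
    rw [hN] at ht
    simp only at ht
    omega
  obtain ⟨t, σ, e₁, sim₁, ht⟩ := compile_correct hF hs' σ₀ sim₀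
  refine ⟨4 + t, σ, .seq e₀ e₁, ?_, fun i hi => ?_⟩
  · rw [hc] at ht
    simp only [mul_zero, add_zero] at ht
    generalize ∑ q ∈ Q, (P.shift q).Ham T = D at htime ⊢
    have h1 : c * (s'.time + 1) ≤ c * (1010 * (n ^ 2 + D)) :=
      Nat.mul_le_mul_left c (by rw [sq]; omega)
    have h2 : (4 + c * 1010) * (n ^ 2 + D) = 4 * (n ^ 2 + D) + c * (1010 * (n ^ 2 + D)) := by ring
    have h3 : 1 ≤ n ^ 2 := by rw [sq]; omega
    omega
  · have h0 : (0 : BitVec w) + BitVec.ofNat w i = BitVec.ofNat w i := by simp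
    rw [sim₁.zero, h0, sim₁.io i (by simp only; omega), hio i hi,
      List.getD_eq_getElem _ _ (by simpa using hi), List.getElem_map]
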